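/- Let $\mathbb F$ be a field and $p\ge 2$. Let $K$ be a real symmetric $p\times p$ matrix with eigenvalues $0<k_1<\dots<k_p$ and unit eigenvectors $v_1,\dots,v_p$, and let $f(x)=d(K)\exp(x^tKx)$ be the Bingham density on $S^{p-1}\subset\mathbb R^p$, where $d=d(K)=\big(\int_{S^{p-1}}\exp(x^tKx)\,d\nu\big)^{-1}$ and $\nu$ is the surface measure. *Definitions.* Let $C_*$ denote singular chains with coefficients in $\mathbb F$. For an increasing filtration $(\mathcal F_r)_{r\in[-\infty,\infty]}$ of $C_*(S^{p-1})$ by subcomplexes, and a cycle $\alpha\in Z_i$, let $I_\alpha$ be the set of all $r$ such that $\alpha$ is a cycle of $\mathcal F_r$ with $[\alpha]\neq0$ in $H_i(\mathcal F_r)$. A family of intervals $(J_\alpha)_{\alpha\in S}$, with $S\subset Z_i$, is a Betti–$i$ barcode if $J_\alpha\subset I_\alpha$ for all $\alpha\in S$ and if, for every $r$, the classes $[\alpha]$ with $\alpha\in S$, $r\in J_\alpha$ form a basis of $H_i(\mathcal F_r)$. All the barcodes below are realized with $J_\alpha=I_\alpha$. The *Morse filtration* is $\mathcal F_r=C_*(\{f\le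 r\})$. The *superlevel filtration* is $\mathcal F_r=C_*(\{f\ge 1/r\})$ for $r\ge0$ (with $1/0=\infty$, $1/\infty=0$) and $\mathcal F_r=0$ for $r<0$. The *Čech filtration* is $0$ for $r<0$, and for $r\ge 0$ it consists of all of $C_0(S^{p-1})$ in degree $0$ and of $\mathrm{Const}_i+C_i(\{f\ge1/r\})$ in degrees $i\ge1$, where $\mathrm{Const}_i$ is spanned by the constant singular $i$-simplices. 1. **Morse filtration.** The Betti–$0$ barcode consists of the two intervals $[de^{k_1},\infty]$ and $[de^{k_1},de^{k_2})$. For $1\le i\le p-2$ the Betti–$i$ barcode is the single interval $[de^{k_{i+1}},de^{k_{i+2}})$. The Betti–$(p-1)$ barcode is the single interval $[de^{k_p},\infty]$. For $i\ge p$ the Betti–$i$ barcode is empty. 2. **Cell structure.** For $1\le n\le p$ put $S^{n-1}=\{x\in S^{p-1}: x\perp v_m \text{ for all } m>n\}$. There is a CW structure on $S^{p-1}$ whose $(n-1)$-skeleton is $S^{n-1}$ for $1\le n\le p$, whose open $(n-1)$-cells are exactly the two open hemispheres $\{x\in S^{n-1}:\pm\langle x,v_n\rangle>0\}$, and which has no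 cells of dimension $\ge p$. It corresponds to the Morse filtration as follows: $\{f\le r\}=\emptyset$ for $r<de^{k_1}$; for $1\le n<p$ and $de^{k_n}\le r<de^{k_{n+1}}$ the $(n-1)$-skeleton is a strong deformation retract of $\{f\le r\}$; and the same holds for $n=p$ and $r\ge de^{k_p}$. 3. **Čech filtration.** For the superlevel filtration, the Betti–$0$ barcode consists of the two intervals $\frac1d[e^{-k_p},\infty]$ and $\frac1d[e^{-k_p},e^{-k_{p-1}})$. For both the superlevel and the Čech filtration: for $1\le i\le p-2$ the Betti–$i$ barcode is the single interval $\frac1d[e^{-k_{p-i}},e^{-k_{p-i-1}})$; the Betti–$(p-1)$ barcode is the single interval $\frac1d[e^{-k_1},\infty]$; and for $i\ge p$ the Betti–$i$ barcode is empty. 4. **Alexander duality.** For every $r\in\operatorname{im}(f)$ with $r<\sup f$ and all integers $i,j\ge0$ with $i+j=p-2$, $$\tilde H_i(\{f>r\};\mathbb F)\cong\tilde H^{j}(\{f\le r\};\mathbb F)\cong\tilde H_{j}(\{f\le r\};\mathbb F),$$ and $\tilde H_i(\{f>r\};\mathbb F)=\tilde H_i(\{f\le r\};\mathbb F)=0$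 for $i\ge p-1$. -/

import Mathlib

open MeasureTheory
open scoped ENNReal Matrix

noncomputable section

namespace PersistentDensity

/-- The quotient `Z / (B ∩ Z)`; for `B ⊆ Z` this is `Z / B`, the homology of cycles `Z` modulo
boundaries `B`. -/
abbrev Subquotient {F : Type*} [Field F] {M : Type*} [AddCommGroup M] [Module F M]
    (Z B : Submodule F M) : Type _ :=
  Z ⧸ B.submoduleOf Z

/-! ### Singular chains with coefficients in a field -/

/-- Singular `n`-simplices: continuous maps from the standard `n`-simplex to `X`. -/
abbrev SingularSimplex (X : Type*) [TopologicalSpace X] (n : ℕ) : Type _ :=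
  C(stdSimplex ℝ (Fin (n + 1)), X)

/-- The `i`-th face inclusion, `(x₀, …, xₙ) ↦ (x₀, …, xᵢ₋₁, 0, xᵢ, …, xₙ)`. -/
def faceInclusion (n : ℕ) (i : Fin (n + 2)) :
    C(stdSimplex ℝ (Fin (n + 1)), stdSimplex ℝ (Fin (n + 2))) :=
  ⟨stdSimplex.map i.succAbove, stdSimplex.continuous_map _⟩

/-- Singular `n`-chains: the free `F`-module on the singular `n`-simplices. -/
abbrev SingularChain (F : Type*) [Field F] (X : Type*) [TopologicalSpace X] (n : ℕ) : Type _ :=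
  SingularSimplex X n →₀ F

/-- The singular boundary `d φ = ∑ᵢ (-1)ⁱ φ ∘ δᵢ`. -/
def boundary (F : Type*) [Field F] (X : Type*) [TopologicalSpace X] (n : ℕ) :
    SingularChain F X (n + 1) →ₗ[F] SingularChain F X n :=
  Finsupp.linearCombination F fun φ : SingularSimplex X (n + 1) =>
    ∑ i : Fin (n + 2), (-1 : F) ^ (i : ℕ) • Finsupp.single (φ.comp (faceInclusion n i)) (1 : F)

theorem boundary_single (F : Type*) [Field F] (X : Type*) [TopologicalSpace X] (n : ℕ)
    (φ : SingularSimplex X (n + 1)) (a : F) :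
    boundary F X n (Finsupp.single φ a) = a • ∑ i : Fin (n + 2),
      (-1 : F) ^ (i : ℕ) • Finsupp.single (φ.comp (faceInclusion n i)) (1 : F) := by
  simp [boundary, Finsupp.linearCombination_single]

theorem faceInclusion_comp (n : ℕ) (i j : Fin (n + 2)) (h : i ≤ j) :
    (faceInclusion (n + 1) j.succ).comp (faceInclusion n i) =
      (faceInclusion (n + 1) i.castSucc).comp (faceInclusion n j) := by
  ext1 x
  simp only [faceInclusion, ContinuousMap.comp_apply, ContinuousMap.coe_mk]
  rw [stdSimplex.map_comp_apply, stdSimplex.map_comp_apply]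
  congr 1
  funext t
  have := congrArg (fun f => f.toOrderHom t) (SimplexCategory.δ_comp_δ h)
  exact this

/-- The boundary squares to zero. -/
theorem boundary_comp_boundary (F : Type*) [Field F] (X : Type*) [TopologicalSpace X] (n : ℕ) :
    boundary F X n ∘ₗ boundary F X (n + 1) = 0 := by
  refine Finsupp.lhom_ext fun φ a => ?_
  simp only [LinearMap.comp_apply, boundary_single, map_smul, map_sum, LinearMap.zero_apply,
    one_smul, ContinuousMap.comp_assoc]
  suffices h : ∑ j : Fin (n + 3), (-1 : F) ^ (j : ℕ) • ∑ i : Fin (n + 2), (-1 : F) ^ (i : ℕ) •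
      Finsupp.single (φ.comp ((faceInclusion (n + 1) j).comp (faceInclusion n i))) (1 : F) = 0 by
    rw [h, smul_zero]
  simp only [Finset.smul_sum, smul_smul, ← Finset.sum_product']
  let S : Finset (Fin (n + 3) × Fin (n + 2)) := {ji | (ji.1 : ℕ) ≤ (ji.2 : ℕ)}
  rw [Finset.univ_product_univ, ← Finset.sum_add_sum_compl S, ← eq_neg_iff_add_eq_zero,
    ← Finset.sum_neg_distrib]
  have hlt : ∀ ji ∈ S, (ji.1 : ℕ) < n + 2 := fun ji hji =>
    lt_of_le_of_lt (Finset.mem_filter.mp hji).2 ji.2.is_lt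
  refine Finset.sum_bij (fun ji hji => (ji.2.succ, ji.1.castLT (hlt ji hji))) ?_ ?_ ?_ ?_
  · rintro ⟨j, i⟩ h
    simp only [S, Finset.compl_filter, Finset.mem_filter_univ, Fin.val_succ,
      Fin.val_castLT] at h ⊢
    lia
  · rintro ⟨j, i⟩ h ⟨j', i'⟩ h' e
    simp only [Prod.mk.injEq, Fin.succ_inj] at e
    have e2 := congrArg Fin.val e.2
    simp only [Fin.val_castLT] at e2
    exact Prod.ext (Fin.ext e2) e.1
  · rintro ⟨j, i⟩ h
    simp only [S, Finset.compl_filter, Finset.mem_filter_univ, not_le] at h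
    have hj : j ≠ 0 := by
      rintro rfl
      simp at h
    refine ⟨(i.castSucc, j.pred hj), ?_, ?_⟩
    · simp only [S, Finset.mem_filter_univ, Fin.val_castSucc, Fin.val_pred]
      lia
    · simp
  · rintro ⟨j, i⟩ h
    have hle : j.castLT (hlt _ h) ≤ i := by
      simp only [S, Finset.mem_filter_univ] at h
      exact h
    have hc := faceInclusion_comp n _ _ hle
    rw [Fin.castSucc_castLT] at hc
    simp only [Fin.val_succ, Fin.val_castLT]
    rw [← hc, ← neg_smul]
    congr 1
    ring

/-- Singular `k`-cycles. -/
def singularCycles (F : Type*) [Field F] (X : Type*) [TopologicalSpace X] :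
    (k : ℕ) → Submodule F (SingularChain F X k)
  | 0 => ⊤
  | k + 1 => LinearMap.ker (boundary F X k)

/-- The singular chains of `X` all of whose simplices lie in `A`, i.e. `C_k(A) ⊆ C_k(X)`. -/
def chainsIn (F : Type*) [Field F] {X : Type*} [TopologicalSpace X] (A : Set X) (k : ℕ) :
    Submodule F (SingularChain F X k) :=
  Finsupp.supported F F {φ : SingularSimplex X k | ∀ t, φ t ∈ A}

/-- The span of the constant singular `k`-simplices. -/
def constChains (F : Type*) [Field F] (X : Type*) [TopologicalSpace X] (k : ℕ) :
    Submodule F (SingularChain F X k) :=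
  Submodule.span F {c | ∃ x : X, c = Finsupp.single (ContinuousMap.const _ x) 1}

theorem chainsIn_mono (F : Type*) [Field F] {X : Type*} [TopologicalSpace X] {A B : Set X}
    (h : A ⊆ B) (k : ℕ) : chainsIn F A k ≤ chainsIn F B k :=
  Finsupp.supported_mono fun _ hφ t => h (hφ t)

theorem chainsIn_empty (F : Type*) [Field F] {X : Type*} [TopologicalSpace X] (k : ℕ) :
    chainsIn F (∅ : Set X) k = ⊥ := by
  have : {φ : SingularSimplex X k | ∀ t, φ t ∈ (∅ : Set X)} = ∅ := by
    ext φ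
    simp only [Set.mem_ofPred_eq, Set.mem_empty_iff_false, iff_false, not_forall]
    exact ⟨Classical.arbitrary _, not_false⟩
  rw [chainsIn, this, Finsupp.supported_empty]

theorem chainsIn_univ (F : Type*) [Field F] {X : Type*} [TopologicalSpace X] (k : ℕ) :
    chainsIn F (Set.univ : Set X) k = ⊤ := by
  simp [chainsIn, Finsupp.supported_univ]

theorem boundary_mem_chainsIn (F : Type*) [Field F] {X : Type*} [TopologicalSpace X] (A : Set X)
    (k : ℕ) {c : SingularChain F X (k + 1)} (hc : c ∈ chainsIn F A (k + 1)) :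
    boundary F X k c ∈ chainsIn F A k := by
  rw [chainsIn, Finsupp.supported_eq_span_single] at hc
  refine Submodule.span_induction (p := fun c _ => boundary F X k c ∈ chainsIn F A k)
    ?_ (by simp) (fun x y _ _ hx hy => by rw [map_add]; exact Submodule.add_mem _ hx hy)
    (fun a x _ hx => by rw [map_smul]; exact Submodule.smul_mem _ a hx) hc
  rintro _ ⟨φ, hφ, rfl⟩
  rw [boundary_single]
  refine Submodule.smul_mem _ _ (Submodule.sum_mem _ fun i _ => Submodule.smul_mem _ _ ?_)
  exact Finsupp.single_mem_supported F _ fun t => hφ _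

theorem boundary_mem_constChains (F : Type*) [Field F] {X : Type*} [TopologicalSpace X]
    (k : ℕ) {c : SingularChain F X (k + 1)} (hc : c ∈ constChains F X (k + 1)) :
    boundary F X k c ∈ constChains F X k := by
  refine Submodule.span_induction (p := fun c _ => boundary F X k c ∈ constChains F X k)
    ?_ (by simp) (fun x y _ _ hx hy => by rw [map_add]; exact Submodule.add_mem _ hx hy)
    (fun a x _ hx => by rw [map_smul]; exact Submodule.smul_mem _ a hx) hc
  rintro _ ⟨x, rfl⟩
  rw [boundary_single]
  refine Submodule.smul_mem _ _ (Submodule.sum_mem _ fun i _ => Submodule.smul_mem _ _ ?_)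
  exact Submodule.subset_span ⟨x, rfl⟩

/-! ### Filtrations, persistence intervals and barcodes -/

/-- An increasing filtration, indexed by the extended reals, of the singular chain complex of `X`
by subcomplexes, starting at `0` and ending with the whole complex. -/
structure ChainFiltration (F : Type*) [Field F] (X : Type*) [TopologicalSpace X] where
  /-- The `k`-chains of the subcomplex at level `r`. -/
  part : EReal → (k : ℕ) → Submodule F (SingularChain F X k)
  mono : ∀ k {r s : EReal}, r ≤ s → part r k ≤ part s k
  boundary_mem : ∀ r k, ∀ c ∈ part r (k + 1), boundary F X k c ∈ part r k
  part_bot : ∀ k, part ⊥ k = ⊥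
  part_top : ∀ k, part ⊤ k = ⊤

namespace ChainFiltration

variable {F : Type*} [Field F] {X : Type*} [TopologicalSpace X]

/-- The `k`-cycles at level `r`. -/
def cycles (𝓕 : ChainFiltration F X) (r : EReal) (k : ℕ) : Submodule F (SingularChain F X k) :=
  𝓕.part r k ⊓ singularCycles F X k

/-- The `k`-boundaries at level `r`. -/
def boundaries (𝓕 : ChainFiltration F X) (r : EReal) (k : ℕ) :
    Submodule F (SingularChain F X k) :=
  (𝓕.part r (k + 1)).map (boundary F X k)

/-- The `k`-th homology at level `r`: cycles modulo boundaries. -/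
abbrev Homology (𝓕 : ChainFiltration F X) (r : EReal) (k : ℕ) : Type _ :=
  Subquotient (𝓕.cycles r k) (𝓕.boundaries r k)

/-- The persistence interval of `α`: the levels at which `α` is a cycle of the subcomplex and
represents a nonzero homology class there. -/
def homologyInterval (𝓕 : ChainFiltration F X) (k : ℕ) (α : SingularChain F X k) : Set EReal :=
  {r | α ∈ 𝓕.cycles r k ∧ α ∉ 𝓕.boundaries r k}

/-- The homology class at level `r` of a cycle `α` at level `r`. -/
def homologyClass (𝓕 : ChainFiltration F X) (r : EReal) (k : ℕ) (α : SingularChain F X k)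
    (h : α ∈ 𝓕.cycles r k) : 𝓕.Homology r k :=
  Submodule.Quotient.mk (⟨α, h⟩ : 𝓕.cycles r k)

/-- The distinct `k`-cycles `α j` and the intervals `J j` form a Betti-`k` barcode: each `J j` is a
subinterval of the persistence interval of `α j`, and at every level `r` the classes of those
`α j` with `r ∈ J j` form a basis of the `k`-th homology. -/
structure IsBettiBarcode (𝓕 : ChainFiltration F X) (k : ℕ) {ι : Type*}
    (α : ι → SingularChain F X k) (J : ι → Set EReal) : Prop where
  injective : Function.Injective α
  cycle : ∀ j, α j ∈ singularCycles F X k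
  ordConnected : ∀ j, (J j).OrdConnected
  subset : ∀ j, J j ⊆ 𝓕.homologyInterval k (α j)
  linearIndependent : ∀ r, LinearIndependent F fun j : {j // r ∈ J j} =>
    𝓕.homologyClass r k (α j) (subset j j.2).1
  span_eq_top : ∀ r, Submodule.span F (Set.range fun j : {j // r ∈ J j} =>
    𝓕.homologyClass r k (α j) (subset j j.2).1) = ⊤

/-- The family `J` of intervals is the Betti-`k` barcode: it is a barcode for some cycles, and each
of its intervals is the whole persistence interval of its cycle (so that bars cannot be cut into
pieces, and each class vanishes once its bar has ended). -/
def HasBettiBarcode (𝓕 : ChainFiltration F X) (k : ℕ) {ι : Type*} (J : ι → Set EReal) : Prop :=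
  ∃ α : ι → SingularChain F X k, 𝓕.IsBettiBarcode k α J ∧ ∀ j, J j = 𝓕.homologyInterval k (α j)

end ChainFiltration

/-! ### The filtrations defined by a density -/

/-- The sublevel set `{x | f x ≤ r}`, for an extended real `r`. -/
def sublevel {X : Type*} (f : X → ℝ) (r : EReal) : Set X := {x | (f x : EReal) ≤ r}

/-- The superlevel set `{x | f x ≥ s}` of a nonnegative function, for `s ∈ [0, ∞]`. -/
def superlevel {X : Type*} (f : X → ℝ) (s : ℝ≥0∞) : Set X := {x | s ≤ ENNReal.ofReal (f x)}

theorem superlevel_inv_mono {X : Type*} (f : X → ℝ) {r s : EReal} (h : r ≤ s) :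
    superlevel f (r.toENNReal)⁻¹ ⊆ superlevel f (s.toENNReal)⁻¹ := fun _ hx =>
  (ENNReal.inv_le_inv.2 (EReal.toENNReal_le_toENNReal h)).trans hx

theorem superlevel_inv_bot {X : Type*} (f : X → ℝ) :
    superlevel f ((⊥ : EReal).toENNReal)⁻¹ = ∅ := by
  ext x
  simp [superlevel]

theorem superlevel_inv_top {X : Type*} (f : X → ℝ) :
    superlevel f ((⊤ : EReal).toENNReal)⁻¹ = Set.univ := by
  ext x
  simp [superlevel]

/-- The Morse filtration: level `r` is the complex of singular chains of `{f ≤ r}`. -/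
def morseFiltration (F : Type*) [Field F] {X : Type*} [TopologicalSpace X] (f : X → ℝ) :
    ChainFiltration F X where
  part r k := chainsIn F (sublevel f r) k
  mono k _ _ h := chainsIn_mono F (fun _ hx => le_trans hx h) k
  boundary_mem r k _ hc := boundary_mem_chainsIn F _ k hc
  part_bot k := by
    have : sublevel f ⊥ = ∅ := by
      ext x
      simp [sublevel]
    rw [this, chainsIn_empty]
  part_top k := by
    have : sublevel f ⊤ = Set.univ := by
      ext x
      simp [sublevel]
    rw [this, chainsIn_univ]

/-- The superlevel filtration: level `r` is the complex of singular chains of `{f ≥ 1/r}`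
(with `1/0 = ∞` and `1/∞ = 0`), and is zero for `r < 0`. -/
def superlevelFiltration (F : Type*) [Field F] {X : Type*} [TopologicalSpace X] (f : X → ℝ) :
    ChainFiltration F X where
  part r k := chainsIn F (superlevel f (r.toENNReal)⁻¹) k
  mono k _ _ h := chainsIn_mono F (superlevel_inv_mono f h) k
  boundary_mem r k _ hc := boundary_mem_chainsIn F _ k hc
  part_bot k := by rw [superlevel_inv_bot, chainsIn_empty]
  part_top k := by rw [superlevel_inv_top, chainsIn_univ]

/-- The chains of the Čech filtration: zero for `r < 0`; for `r ≥ 0`, all chains in degree `0`, and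
`Const_k + C_k({f ≥ 1/r})` in degrees `k ≥ 1`. -/
def cechPart (F : Type*) [Field F] {X : Type*} [TopologicalSpace X] (f : X → ℝ) (r : EReal) :
    (k : ℕ) → Submodule F (SingularChain F X k)
  | 0 => if r < 0 then ⊥ else ⊤
  | k + 1 => if r < 0 then ⊥ else
      constChains F X (k + 1) ⊔ chainsIn F (superlevel f (r.toENNReal)⁻¹) (k + 1)

/-- The Čech filtration of a density `f`. -/
def cechFiltration (F : Type*) [Field F] {X : Type*} [TopologicalSpace X] (f : X → ℝ) :
    ChainFiltration F X where
  part := cechPart F f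
  mono k r s h := by
    by_cases hr : r < 0
    · cases k <;> simp [cechPart, hr]
    · have hs : ¬ s < 0 := fun hs => hr (h.trans_lt hs)
      cases k with
      | zero => simp [cechPart, hs]
      | succ k =>
        simp only [cechPart, hr, hs, if_false]
        exact sup_le_sup_left (chainsIn_mono F (superlevel_inv_mono f h) _) _
  boundary_mem r k c hc := by
    by_cases hr : r < 0
    · simp only [cechPart, hr, if_true, Submodule.mem_bot] at hc
      rw [hc, map_zero]
      exact Submodule.zero_mem _
    · cases k with
      | zero => simp [cechPart, hr]
      | succ k =>
        simp only [cechPart, hr, if_false] at hc ⊢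
        obtain ⟨a, ha, b, hb, rfl⟩ := Submodule.mem_sup.1 hc
        rw [map_add]
        exact Submodule.add_mem_sup (boundary_mem_constChains F _ ha)
          (boundary_mem_chainsIn F _ _ hb)
  part_bot k := by cases k <;> simp [cechPart]
  part_top k := by
    cases k with
    | zero => simp [cechPart]
    | succ k => simp only [cechPart, superlevel_inv_top, chainsIn_univ]; simp

/-! ### Reduced singular homology and cohomology -/

/-- The augmentation `C₀(X) → F`, sending every `0`-simplex to `1`. -/
def augmentation (F : Type*) [Field F] (X : Type*) [TopologicalSpace X] :
    SingularChain F X 0 →ₗ[F] F :=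
  Finsupp.linearCombination F fun _ => (1 : F)

/-- Cycles of the augmented singular chain complex. -/
def reducedCycles (F : Type*) [Field F] (X : Type*) [TopologicalSpace X] :
    (k : ℕ) → Submodule F (SingularChain F X k)
  | 0 => LinearMap.ker (augmentation F X)
  | k + 1 => LinearMap.ker (boundary F X k)

/-- Reduced singular homology with coefficients in `F`, in degree `k ≥ 0`. -/
abbrev ReducedHomology (F : Type*) [Field F] (X : Type*) [TopologicalSpace X] (k : ℕ) : Type _ :=
  Subquotient (reducedCycles F X k) (LinearMap.range (boundary F X k))

/-- Singular cocycles. -/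
def cocycles (F : Type*) [Field F] (X : Type*) [TopologicalSpace X] (k : ℕ) :
    Submodule F (Module.Dual F (SingularChain F X k)) :=
  LinearMap.ker (boundary F X k).dualMap

/-- Coboundaries of the dual of the augmented singular chain complex. -/
def reducedCoboundaries (F : Type*) [Field F] (X : Type*) [TopologicalSpace X] :
    (k : ℕ) → Submodule F (Module.Dual F (SingularChain F X k))
  | 0 => LinearMap.range (augmentation F X).dualMap
  | k + 1 => LinearMap.range (boundary F X k).dualMap

/-- Reduced singular cohomology with coefficients in `F`, in degree `k ≥ 0`. -/
abbrev ReducedCohomology (F : Type*) [Field F] (X : Type*) [TopologicalSpace X] (k : ℕ) : Type _ :=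
  Subquotient (cocycles F X k) (reducedCoboundaries F X k)

/-! ### Strong deformation retracts -/

/-- `A ⊆ B` and there is a homotopy of self-maps of `B`, fixing `A` pointwise throughout, from the
identity to a map with values in `A`. -/
def IsStrongDeformationRetract {X : Type*} [TopologicalSpace X] (A B : Set X) : Prop :=
  A ⊆ B ∧ ∃ H : C(unitInterval × B, B), (∀ x, H (0, x) = x) ∧ (∀ x, (H (1, x) : X) ∈ A) ∧
    ∀ (t : unitInterval) (x : B), (x : X) ∈ A → H (t, x) = x

/-! ### The Bingham density -/

/-- The unit sphere `S^{p-1}` of `ℝ^p`. -/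
abbrev UnitSphere (p : ℕ) : Type := Metric.sphere (0 : EuclideanSpace ℝ (Fin p)) 1

/-- The quadratic form `xᵗ K x` on the sphere. -/
def quadForm {p : ℕ} (K : Matrix (Fin p) (Fin p) ℝ) (x : UnitSphere p) : ℝ :=
  (x : EuclideanSpace ℝ (Fin p)).ofLp ⬝ᵥ K *ᵥ (x : EuclideanSpace ℝ (Fin p)).ofLp

/-- The normalizing constant `d(K)`, making `d(K) exp (xᵗ K x)` a probability density with respect
to the surface measure of the sphere. -/
def binghamConst {p : ℕ} (K : Matrix (Fin p) (Fin p) ℝ) : ℝ :=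
  (∫ x : UnitSphere p, Real.exp (quadForm K x)
    ∂(volume : Measure (EuclideanSpace ℝ (Fin p))).toSphere)⁻¹

/-- The Bingham density `f_K(x) = d(K) exp (xᵗ K x)`. -/
def binghamDensity {p : ℕ} (K : Matrix (Fin p) (Fin p) ℝ) (x : UnitSphere p) : ℝ :=
  binghamConst K * Real.exp (quadForm K x)

/-- The subsphere of those `x` orthogonal to `v m` for all `m > n`; when `v` is an orthonormal
basis this is the unit sphere of the span of `v 0, …, v n`. -/
def subsphere {p : ℕ} (v : Fin p → UnitSphere p) (n : Fin p) : Set (UnitSphere p) :=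
  {x | ∀ m, n < m →
    inner ℝ (v m : EuclideanSpace ℝ (Fin p)) (x : EuclideanSpace ℝ (Fin p)) = 0}

/-- The open hemisphere, on the side of `ε • v n` with `ε = ± 1`, of the subsphere `n`. -/
def openHemisphere {p : ℕ} (v : Fin p → UnitSphere p) (n : Fin p) (ε : ℤˣ) :
    Set (UnitSphere p) :=
  {x ∈ subsphere v n | 0 < ((ε : ℤ) : ℝ) *
    inner ℝ (v n : EuclideanSpace ℝ (Fin p)) (x : EuclideanSpace ℝ (Fin p))}

end PersistentDensity

end

open MeasureTheory
open scoped ENNReal Matrix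

noncomputable section

namespace PersistentDensity

/-! In orthonormal eigencoordinates `x i` the quadratic form is `∑ k i * x i ^ 2`. On the sphere `∑
x i ^ 2 = 1`, so `f ≤ r` reads `∑ (k i - c) * x i ^ 2 ≤ 0` with `c = log (r / d)`, a condition
invariant under positive scaling. If the indices with `k i ≤ c` are exactly those up to `n`,
shrinking the later coordinates linearly and normalizing retracts `{f ≤ r}` onto the unit sphere of
the first eigenvectors, of dimension `n` when indices start at `0`
(`isStrongDeformationRetract_sublevel`). Hence between consecutive critical values the sublevel set
has the homology of a sphere, whose dimension goes up by one at each critical value. A cycle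
generating the homology of the `n`-th subsphere is carried unchanged through all these levels; it
bounds at the next critical value because degree `n` homology vanishes there. This gives the bars in
positive degree (`IsSphereFamily.hasBettiBarcode`). Degree `0` is unreduced and needs an extra
infinite bar (`IsSphereFamily.hasBettiBarcode_zero`).

The reciprocal of the density is a function of the same kind, with negated exponents in reversed
order, so superlevel sets are sublevel sets of the reciprocal (`superlevel_coordDensity`). In
positive degrees the constant simplices of the Čech filtration contribute no homology
(`cechFiltration_computesHomology`). Alexander duality follows by computing both sides: `{f ≤ r}`
and `{f > r}` retract onto subspheres of dimensions `n` and `p - 2 - n`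
(`exists_hasSphereHomology_le_and_lt`), and over a field the cohomology is read off from
annihilators of cycles and boundaries.

The homology of the subspheres is computed from the definition of singular chains. Coning tuples of
points yields barycentric subdivision and the prism operator, first on affine simplices and then, by
naturality, on singular ones. Subdivision gives small chains (`exists_small_cycle`,
`mem_map_boundary_smallChains`), the prism operator gives invariance under deformation retracts, and
a Mayer–Vietoris step (`HasSphereHomology.of_cover`) raises the dimension by one by removing each of
two poles. The argument works with cycles and boundaries inside one ambient chain complex, so that
the same cycle can be compared across levels.

For the cell structure, the last nonzero coordinate of a point and its sign determine its open cell
(`hemisphereCWComplex`). -/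

/-! ### Ordered chains: formal combinations of tuples of points -/

section OrderedChains

variable (F : Type*) [Field F] {K L K' L' : Type*}

/-- Ordered `n`-chains of a set: formal combinations of `(n+1)`-tuples. -/
abbrev OrderedChain (K : Type*) (n : ℕ) : Type _ := (Fin (n + 1) → K) →₀ F

/-- The simplicial boundary of ordered chains. -/
def orderedBoundary (K : Type*) (n : ℕ) : OrderedChain F K (n + 1) →ₗ[F] OrderedChain F K n :=
  Finsupp.linearCombination F fun w =>
    ∑ i : Fin (n + 2), (-1 : F) ^ (i : ℕ) • Finsupp.single (w ∘ i.succAbove) (1 : F)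

/-- The map induced on ordered chains by a map of sets. -/
def orderedMap (f : K → L) (n : ℕ) : OrderedChain F K n →ₗ[F] OrderedChain F L n :=
  Finsupp.lmapDomain F F (f ∘ ·)

/-- The cone of an ordered chain with apex `b`. -/
def orderedCone (b : K) (n : ℕ) : OrderedChain F K n →ₗ[F] OrderedChain F K (n + 1) :=
  Finsupp.lmapDomain F F fun w => (Fin.cons b w : Fin (n + 2) → K)

/-- The augmentation of ordered `0`-chains. -/
def orderedAug (K : Type*) : OrderedChain F K 0 →ₗ[F] F :=
  Finsupp.linearCombination F fun _ => (1 : F)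

@[simp] theorem orderedMap_single (f : K → L) (n : ℕ) (w : Fin (n + 1) → K) (a : F) :
    orderedMap F f n (Finsupp.single w a) = Finsupp.single (f ∘ w) a := by
  simp [orderedMap]

@[simp] theorem orderedCone_single (b : K) (n : ℕ) (w : Fin (n + 1) → K) (a : F) :
    orderedCone F b n (Finsupp.single w a) =
      Finsupp.single (Fin.cons b w : Fin (n + 2) → K) a := by
  simp [orderedCone]

theorem orderedBoundary_single (n : ℕ) (w : Fin (n + 2) → K) :
    orderedBoundary F K n (Finsupp.single w 1) =
      ∑ i : Fin (n + 2), (-1 : F) ^ (i : ℕ) • Finsupp.single (w ∘ i.succAbove) (1 : F) := by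
  simp [orderedBoundary, Finsupp.linearCombination_single]

@[simp] theorem orderedAug_single (w : Fin 1 → K) (a : F) :
    orderedAug F K (Finsupp.single w a) = a := by
  simp [orderedAug, Finsupp.linearCombination_single]

variable {F} in
/-- Two linear maps on a free module agree when they agree on the basis. -/
theorem linearMap_congr_single {α M : Type*} [AddCommGroup M] [Module F M]
    {f g : (α →₀ F) →ₗ[F] M} (h : ∀ a, f (Finsupp.single a 1) = g (Finsupp.single a 1))
    (c : α →₀ F) : f c = g c := by
  have : f = g := Finsupp.lhom_ext' fun a => LinearMap.ext_ring (h a)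
  rw [this]

theorem orderedMap_boundary (f : K → L) (n : ℕ) (c : OrderedChain F K (n + 1)) :
    orderedMap F f n (orderedBoundary F K n c) =
      orderedBoundary F L n (orderedMap F f (n + 1) c) := by
  refine linearMap_congr_single (f := orderedMap F f n ∘ₗ orderedBoundary F K n)
    (g := orderedBoundary F L n ∘ₗ orderedMap F f (n + 1)) (fun w => ?_) c
  simp only [LinearMap.comp_apply, orderedBoundary_single, map_sum, map_smul, orderedMap_single,
    Function.comp_assoc]

theorem orderedMap_cone (f : K → L) (b : K) (n : ℕ) (c : OrderedChain F K n) :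
    orderedMap F f (n + 1) (orderedCone F b n c) =
      orderedCone F (f b) n (orderedMap F f n c) := by
  refine linearMap_congr_single (f := orderedMap F f (n + 1) ∘ₗ orderedCone F b n)
    (g := orderedCone F (f b) n ∘ₗ orderedMap F f n) (fun w => ?_) c
  simp only [LinearMap.comp_apply, orderedMap_single, orderedCone_single]
  congr 1
  ext i
  refine Fin.cases ?_ (fun j => ?_) i <;> simp

theorem orderedAug_map (f : K → L) (c : OrderedChain F K 0) :
    orderedAug F L (orderedMap F f 0 c) = orderedAug F K c := by
  refine linearMap_congr_single (f := orderedAug F L ∘ₗ orderedMap F f 0)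
    (g := orderedAug F K) (fun w => ?_) c
  simp

/-- In degree `0` the augmentation takes the place of the boundary. Together with the formula in
higher degrees, this says that coning contracts the augmented complex. -/
theorem orderedBoundary_cone_zero (b : K) (c : OrderedChain F K 0) :
    orderedBoundary F K 0 (orderedCone F b 0 c) =
      c - orderedAug F K c • Finsupp.single (fun _ => b) 1 := by
  refine linearMap_congr_single (f := orderedBoundary F K 0 ∘ₗ orderedCone F b 0)
    (g := LinearMap.id - (orderedAug F K).smulRight (Finsupp.single (fun _ => b) 1))
    (fun w => ?_) c
  simp only [LinearMap.comp_apply, orderedCone_single, orderedBoundary_single,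
    LinearMap.sub_apply, LinearMap.id_apply, LinearMap.smulRight_apply, orderedAug_single]
  erw [Fin.sum_univ_two]
  have h0 : (Fin.cons b w : Fin 2 → K) ∘ (0 : Fin 2).succAbove = w := by
    ext i
    simp
  have h1 : (Fin.cons b w : Fin 2 → K) ∘ (1 : Fin 2).succAbove = fun _ => b := by
    ext i
    fin_cases i
    rfl
  rw [h0, h1]
  simp [sub_eq_add_neg]

theorem orderedBoundary_cone_succ (b : K) (n : ℕ) (c : OrderedChain F K (n + 1)) :
    orderedBoundary F K (n + 1) (orderedCone F b (n + 1) c) =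
      c - orderedCone F b n (orderedBoundary F K n c) := by
  refine linearMap_congr_single (f := orderedBoundary F K (n + 1) ∘ₗ orderedCone F b (n + 1))
    (g := LinearMap.id - orderedCone F b n ∘ₗ orderedBoundary F K n) (fun w => ?_) c
  simp only [LinearMap.comp_apply, orderedCone_single, orderedBoundary_single,
    LinearMap.sub_apply, LinearMap.id_apply, map_sum, map_smul]
  rw [Fin.sum_univ_succ, sub_eq_add_neg, ← Finset.sum_neg_distrib]
  congr 1
  · have h0 : (Fin.cons b w : Fin (n + 3) → K) ∘ (0 : Fin (n + 3)).succAbove = w := by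
      ext i
      simp
    rw [h0]
    simp
  · refine Finset.sum_congr rfl fun i _ => ?_
    have h1 : (Fin.cons b w : Fin (n + 3) → K) ∘ i.succ.succAbove =
        (Fin.cons b (w ∘ i.succAbove) : Fin (n + 2) → K) := by
      ext j
      refine Fin.cases ?_ (fun k => ?_) j <;> simp
    rw [h1, Fin.val_succ, pow_succ, ← neg_smul]
    simp

theorem orderedAug_boundary (c : OrderedChain F K 1) :
    orderedAug F K (orderedBoundary F K 0 c) = 0 := by
  refine linearMap_congr_single (f := orderedAug F K ∘ₗ orderedBoundary F K 0)
    (g := 0) (fun w => ?_) c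
  simp [orderedBoundary_single, Fin.sum_univ_two]

/-- A tuple is the cone on its tail with its first entry as apex, so the cone formula gives the
vanishing by induction, with no cancellation of signs in a double sum. -/
theorem orderedBoundary_boundary (n : ℕ) (c : OrderedChain F K (n + 2)) :
    orderedBoundary F K n (orderedBoundary F K (n + 1) c) = 0 := by
  induction n with
  | zero =>
    refine linearMap_congr_single (f := orderedBoundary F K 0 ∘ₗ orderedBoundary F K 1)
      (g := 0) (fun w => ?_) c
    have hw : (Finsupp.single w 1 : OrderedChain F K 2) =
        orderedCone F (w 0) 1 (Finsupp.single (Fin.tail w) 1) := by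
      simp [Fin.cons_self_tail]
    rw [hw, LinearMap.comp_apply, orderedBoundary_cone_succ, map_sub, orderedBoundary_cone_zero,
      orderedAug_boundary]
    simp
  | succ n ih =>
    refine linearMap_congr_single
      (f := orderedBoundary F K (n + 1) ∘ₗ orderedBoundary F K (n + 2)) (g := 0) (fun w => ?_) c
    have hw : (Finsupp.single w 1 : OrderedChain F K (n + 3)) =
        orderedCone F (w 0) (n + 2) (Finsupp.single (Fin.tail w) 1) := by
      simp [Fin.cons_self_tail]
    rw [hw, LinearMap.comp_apply, orderedBoundary_cone_succ, map_sub, orderedBoundary_cone_succ,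
      ih]
    simp

/-- The chain homotopy between `f` and `g` built inductively by coning with apex `b`. -/
def coneHomotopy (f g : ∀ n, OrderedChain F K n →ₗ[F] OrderedChain F L n)
    (b : ∀ n, (Fin (n + 1) → K) → L) : ∀ n, OrderedChain F K n →ₗ[F] OrderedChain F L (n + 1)
  | 0 => Finsupp.linearCombination F fun w =>
      orderedCone F (b 0 w) 0 (f 0 (Finsupp.single w 1) - g 0 (Finsupp.single w 1))
  | n + 1 => Finsupp.linearCombination F fun w =>
      orderedCone F (b (n + 1) w) (n + 1) (f (n + 1) (Finsupp.single w 1) -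
        g (n + 1) (Finsupp.single w 1) -
        coneHomotopy f g b n (orderedBoundary F K n (Finsupp.single w 1)))

section ConeHomotopy

variable {F}
variable {f g : ∀ n, OrderedChain F K n →ₗ[F] OrderedChain F L n}
  {b : ∀ n, (Fin (n + 1) → K) → L}

theorem coneHomotopy_zero_single (w : Fin 1 → K) :
    coneHomotopy F f g b 0 (Finsupp.single w 1) =
      orderedCone F (b 0 w) 0 (f 0 (Finsupp.single w 1) - g 0 (Finsupp.single w 1)) := by
  rw [coneHomotopy, Finsupp.linearCombination_single, one_smul]

theorem coneHomotopy_succ_single (n : ℕ) (w : Fin (n + 2) → K) :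
    coneHomotopy F f g b (n + 1) (Finsupp.single w 1) =
      orderedCone F (b (n + 1) w) (n + 1) (f (n + 1) (Finsupp.single w 1) -
        g (n + 1) (Finsupp.single w 1) -
        coneHomotopy F f g b n (orderedBoundary F K n (Finsupp.single w 1))) := by
  rw [coneHomotopy, Finsupp.linearCombination_single, one_smul]

theorem orderedBoundary_coneHomotopy_zero
    (haug : ∀ c, orderedAug F L (f 0 c) = orderedAug F L (g 0 c)) (c : OrderedChain F K 0) :
    orderedBoundary F L 0 (coneHomotopy F f g b 0 c) = f 0 c - g 0 c := by
  refine linearMap_congr_single (f := orderedBoundary F L 0 ∘ₗ coneHomotopy F f g b 0)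
    (g := f 0 - g 0) (fun w => ?_) c
  rw [LinearMap.comp_apply, coneHomotopy_zero_single, orderedBoundary_cone_zero, map_sub, haug,
    sub_self, zero_smul, sub_zero, LinearMap.sub_apply]

/-- The chain being coned, `f - g - h ∂`, is a cycle by the identity one degree lower. The
correction term in the cone formula therefore vanishes and the cone fills it. -/
theorem orderedBoundary_coneHomotopy_succ
    (haug : ∀ c, orderedAug F L (f 0 c) = orderedAug F L (g 0 c))
    (hf : ∀ n c, orderedBoundary F L n (f (n + 1) c) = f n (orderedBoundary F K n c))
    (hg : ∀ n c, orderedBoundary F L n (g (n + 1) c) = g n (orderedBoundary F K n c))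
    (n : ℕ) (c : OrderedChain F K (n + 1)) :
    orderedBoundary F L (n + 1) (coneHomotopy F f g b (n + 1) c) =
      f (n + 1) c - g (n + 1) c - coneHomotopy F f g b n (orderedBoundary F K n c) := by
  induction n with
  | zero =>
    refine linearMap_congr_single (f := orderedBoundary F L 1 ∘ₗ coneHomotopy F f g b 1)
      (g := f 1 - g 1 - coneHomotopy F f g b 0 ∘ₗ orderedBoundary F K 0) (fun w => ?_) c
    rw [LinearMap.comp_apply, coneHomotopy_succ_single, orderedBoundary_cone_succ,
      (orderedBoundary F L _).map_sub, (orderedBoundary F L _).map_sub, hf, hg,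
      orderedBoundary_coneHomotopy_zero haug]
    simp
  | succ n ih =>
    refine linearMap_congr_single
      (f := orderedBoundary F L (n + 2) ∘ₗ coneHomotopy F f g b (n + 2))
      (g := f (n + 2) - g (n + 2) - coneHomotopy F f g b (n + 1) ∘ₗ orderedBoundary F K (n + 1))
      (fun w => ?_) c
    rw [LinearMap.comp_apply, coneHomotopy_succ_single, orderedBoundary_cone_succ,
      (orderedBoundary F L _).map_sub, (orderedBoundary F L _).map_sub, hf, hg, ih, orderedBoundary_boundary]
    simp

/-- The homotopy is built from `f`, `g` and the choice of apexes alone, so it respects any map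
respecting these. This allows it to be defined on one standard simplex and transported along
singular simplices. -/
theorem coneHomotopy_natural
    {f' g' : ∀ n, OrderedChain F K' n →ₗ[F] OrderedChain F L' n}
    {b' : ∀ n, (Fin (n + 1) → K') → L'} {φ : K → K'} {ψ : L → L'}
    (hf : ∀ n c, orderedMap F ψ n (f n c) = f' n (orderedMap F φ n c))
    (hg : ∀ n c, orderedMap F ψ n (g n c) = g' n (orderedMap F φ n c))
    (hb : ∀ n w, ψ (b n w) = b' n (φ ∘ w)) (n : ℕ) (c : OrderedChain F K n) :
    orderedMap F ψ (n + 1) (coneHomotopy F f g b n c) =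
      coneHomotopy F f' g' b' n (orderedMap F φ n c) := by
  induction n with
  | zero =>
    refine linearMap_congr_single (f := orderedMap F ψ 1 ∘ₗ coneHomotopy F f g b 0)
      (g := coneHomotopy F f' g' b' 0 ∘ₗ orderedMap F φ 0) (fun w => ?_) c
    simp only [LinearMap.comp_apply, coneHomotopy_zero_single, orderedMap_single,
      orderedMap_cone, map_sub, hf, hg, hb]
  | succ n ih =>
    refine linearMap_congr_single (f := orderedMap F ψ (n + 2) ∘ₗ coneHomotopy F f g b (n + 1))
      (g := coneHomotopy F f' g' b' (n + 1) ∘ₗ orderedMap F φ (n + 1)) (fun w => ?_) c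
    simp only [LinearMap.comp_apply, coneHomotopy_succ_single, orderedMap_single,
      orderedMap_cone, map_sub, hf, hg, hb, ih,
      orderedMap_boundary]

end ConeHomotopy

/-- Subdivision of ordered chains, with respect to a choice `b` of a centre for every tuple. -/
def orderedSd (b : ∀ n, (Fin (n + 1) → K) → K) : ∀ n, OrderedChain F K n →ₗ[F] OrderedChain F K n
  | 0 => LinearMap.id
  | n + 1 => Finsupp.linearCombination F fun w =>
      orderedCone F (b (n + 1) w) n
        (orderedSd b n (orderedBoundary F K n (Finsupp.single w 1)))

section OrderedSd

variable {F} {b : ∀ n, (Fin (n + 1) → K) → K}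

theorem orderedSd_succ_single (n : ℕ) (w : Fin (n + 2) → K) :
    orderedSd F b (n + 1) (Finsupp.single w 1) = orderedCone F (b (n + 1) w) n
      (orderedSd F b n (orderedBoundary F K n (Finsupp.single w 1))) := by
  rw [orderedSd, Finsupp.linearCombination_single, one_smul]

/-- In positive degree the subdivided boundary that gets coned is a cycle by induction, so the cone
formula returns exactly this subdivided boundary. -/
theorem orderedBoundary_sd (n : ℕ) (c : OrderedChain F K (n + 1)) :
    orderedBoundary F K n (orderedSd F b (n + 1) c) =
      orderedSd F b n (orderedBoundary F K n c) := by
  induction n with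
  | zero =>
    refine linearMap_congr_single (f := orderedBoundary F K 0 ∘ₗ orderedSd F b 1)
      (g := orderedSd F b 0 ∘ₗ orderedBoundary F K 0) (fun w => ?_) c
    simp only [LinearMap.comp_apply, orderedSd, Finsupp.linearCombination_single, one_smul,
      orderedBoundary_cone_zero, LinearMap.id_apply, orderedAug_boundary, zero_smul, sub_zero]
  | succ n ih =>
    refine linearMap_congr_single (f := orderedBoundary F K (n + 1) ∘ₗ orderedSd F b (n + 2))
      (g := orderedSd F b (n + 1) ∘ₗ orderedBoundary F K (n + 1)) (fun w => ?_) c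
    rw [LinearMap.comp_apply, orderedSd_succ_single, orderedBoundary_cone_succ, ih, orderedBoundary_boundary]
    simp

theorem orderedSd_natural {b' : ∀ n, (Fin (n + 1) → L) → L} {φ : K → L}
    (hb : ∀ n w, φ (b n w) = b' n (φ ∘ w)) (n : ℕ) (c : OrderedChain F K n) :
    orderedMap F φ n (orderedSd F b n c) = orderedSd F b' n (orderedMap F φ n c) := by
  induction n with
  | zero => rfl
  | succ n ih =>
    refine linearMap_congr_single (f := orderedMap F φ (n + 1) ∘ₗ orderedSd F b (n + 1))
      (g := orderedSd F b' (n + 1) ∘ₗ orderedMap F φ (n + 1)) (fun w => ?_) c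
    simp only [LinearMap.comp_apply, orderedSd_succ_single, orderedMap_single,
      orderedMap_cone, hb, ih, orderedMap_boundary]

end OrderedSd

end OrderedChains

/-! ### Convex spaces and the realization of ordered chains -/

/-- The convex combination of points of a convex set. -/
def convexComb {E : Type*} [AddCommGroup E] [Module ℝ E] {s : Set E} (hs : Convex ℝ s) {n : ℕ}
    (t : stdSimplex ℝ (Fin (n + 1))) (w : Fin (n + 1) → s) : s :=
  ⟨∑ i, t i • (w i : E), hs.sum_mem (fun i _ => t.2.1 i) t.2.2 fun i _ => (w i).2⟩

/-- A topological space with convex combinations that vary continuously with the weights. -/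
class ConvexTop (K : Type*) [TopologicalSpace K] where
  /-- The convex combination of `n + 1` points. -/
  comb : ∀ {n : ℕ}, stdSimplex ℝ (Fin (n + 1)) → (Fin (n + 1) → K) → K
  continuous_comb : ∀ {n : ℕ} (w : Fin (n + 1) → K), Continuous fun t => comb t w
  comb_vertex : ∀ {n : ℕ} (i : Fin (n + 1)) (w : Fin (n + 1) → K),
    comb (stdSimplex.vertex i) w = w i
  -- For face inclusions this makes affine simplices compatible with the singular boundary; for the
  -- map to one vertex it evaluates combinations of a constant tuple.
  comb_map : ∀ {n m : ℕ} (f : Fin (n + 1) → Fin (m + 1)) (t : stdSimplex ℝ (Fin (n + 1)))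
    (w : Fin (m + 1) → K), comb (stdSimplex.map f t) w = comb t (w ∘ f)
  -- Associativity of barycentres: it makes an affine simplex an affine map in the sense of
  -- `IsAffineMap`.
  comb_comb : ∀ {n m : ℕ} (t : stdSimplex ℝ (Fin (n + 1)))
    (u : Fin (n + 1) → stdSimplex ℝ (Fin (m + 1))) (w : Fin (m + 1) → K),
    comb (convexComb (convex_stdSimplex ℝ _) t u) w = comb t fun i => comb (u i) w

/-- Convex subsets of topological vector spaces have continuous convex combinations. -/
abbrev convexTopOfConvex {E : Type*} [AddCommGroup E] [Module ℝ E] [TopologicalSpace E]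
    [ContinuousAdd E] [ContinuousSMul ℝ E] {s : Set E} (hs : Convex ℝ s) : ConvexTop s where
  comb := convexComb hs
  continuous_comb {n} w := by
    refine Continuous.subtype_mk (continuous_finsetSum _ fun i _ => ?_) _
    exact ((continuous_apply i).comp continuous_subtype_val).smul continuous_const
  comb_vertex i w := by
    ext
    simp only [convexComb]
    rw [Finset.sum_eq_single i]
    · change (Pi.single i (1 : ℝ) : _ → ℝ) i • (w i : E) = _
      simp
    · intro j _ hj
      change (Pi.single i (1 : ℝ) : _ → ℝ) j • (w j : E) = _
      simp [hj]
    · simp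
  comb_map f t w := by
    ext
    simp only [convexComb, stdSimplex.map_coe, Function.comp_apply]
    change ∑ j, FunOnFinite.linearMap ℝ ℝ f t j • (w j : E) = _
    simp only [FunOnFinite.linearMap_apply_apply, Finset.sum_smul]
    rw [← Finset.sum_fiberwise_of_maps_to (s := Finset.univ) (t := Finset.univ) (g := f)
      (fun _ _ => Finset.mem_univ _)]
    refine Finset.sum_congr rfl fun j _ => ?_
    refine Finset.sum_congr rfl fun i hi => ?_
    rw [(Finset.mem_filter.1 hi).2]
  comb_comb t u w := by
    ext
    simp only [convexComb, Finset.smul_sum, smul_smul]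
    change ∑ j, (∑ i, t i • (u i : _ → ℝ)) j • (w j : E) = _
    simp only [Finset.sum_apply, Finset.sum_smul, Pi.smul_apply, smul_eq_mul]
    exact Finset.sum_comm

instance {m : ℕ} : ConvexTop (stdSimplex ℝ (Fin (m + 1))) :=
  convexTopOfConvex (convex_stdSimplex ℝ _)

instance : ConvexTop unitInterval := convexTopOfConvex (convex_Icc 0 1)

/-- Needed for the prism operator, whose model chains live in the product of the unit interval and a
simplex. -/
instance {K L : Type*} [TopologicalSpace K] [TopologicalSpace L] [ConvexTop K] [ConvexTop L] :
    ConvexTop (K × L) where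
  comb t w := (ConvexTop.comb t fun i => (w i).1, ConvexTop.comb t fun i => (w i).2)
  continuous_comb w :=
    (ConvexTop.continuous_comb fun i => (w i).1).prodMk (ConvexTop.continuous_comb fun i => (w i).2)
  comb_vertex i w := by simp [ConvexTop.comb_vertex]
  comb_map f t w := by
    simp only [ConvexTop.comb_map]
    rfl
  comb_comb t u w := by simp only [ConvexTop.comb_comb]

section Realization

variable (F : Type*) [Field F] {X Y Z : Type*} [TopologicalSpace X] [TopologicalSpace Y]
  [TopologicalSpace Z]
  {K L : Type*} [TopologicalSpace K] [ConvexTop K] [TopologicalSpace L] [ConvexTop L]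

/-- Maps that preserve convex combinations. -/
def IsAffineMap (f : K → L) : Prop :=
  ∀ (n : ℕ) (t : stdSimplex ℝ (Fin (n + 1))) (w : Fin (n + 1) → K),
    f (ConvexTop.comb t w) = ConvexTop.comb t (f ∘ w)

/-- The affine simplex with given vertices. -/
def realize {n : ℕ} (w : Fin (n + 1) → K) : SingularSimplex K n :=
  ⟨fun t => ConvexTop.comb t w, ConvexTop.continuous_comb w⟩

theorem realize_isAffineMap {n : ℕ} (w : Fin (n + 1) → K) : IsAffineMap (realize w) :=
  fun _ t u => ConvexTop.comb_comb t u w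

theorem realize_comp_vertex {n : ℕ} (w : Fin (n + 1) → K) :
    realize w ∘ stdSimplex.vertex = w :=
  funext fun i => ConvexTop.comb_vertex i w

theorem realize_vertex (n : ℕ) :
    realize (stdSimplex.vertex : Fin (n + 1) → stdSimplex ℝ (Fin (n + 1))) =
      ContinuousMap.id _ := by
  ext t j
  change (∑ i, t i • (stdSimplex.vertex (S := ℝ) i : Fin (n + 1) → ℝ)) j = t j
  simp [Finset.sum_apply, stdSimplex.vertex, Pi.single_apply]

/-- The chain map from ordered chains of a convex space to singular chains. -/
def realization (K : Type*) [TopologicalSpace K] [ConvexTop K] (n : ℕ) :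
    OrderedChain F K n →ₗ[F] SingularChain F K n :=
  Finsupp.lmapDomain F F realize

/-- The map induced on singular chains by a continuous map. -/
def push (φ : C(X, Y)) (n : ℕ) : SingularChain F X n →ₗ[F] SingularChain F Y n :=
  Finsupp.lmapDomain F F φ.comp

@[simp] theorem realization_single {n : ℕ} (w : Fin (n + 1) → K) (a : F) :
    realization F K n (Finsupp.single w a) = Finsupp.single (realize w) a := by
  simp [realization]

@[simp] theorem push_single (φ : C(X, Y)) {n : ℕ} (σ : SingularSimplex X n) (a : F) :
    push F φ n (Finsupp.single σ a) = Finsupp.single (φ.comp σ) a := by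
  simp [push]

theorem boundary_single_one (n : ℕ) (φ : SingularSimplex X (n + 1)) :
    boundary F X n (Finsupp.single φ 1) = ∑ i : Fin (n + 2),
      (-1 : F) ^ (i : ℕ) • Finsupp.single (φ.comp (faceInclusion n i)) (1 : F) := by
  rw [boundary_single, one_smul]

theorem push_push (ψ : C(Y, Z)) (φ : C(X, Y)) (n : ℕ) (c : SingularChain F X n) :
    push F ψ n (push F φ n c) = push F (ψ.comp φ) n c :=
  linearMap_congr_single (f := push F ψ n ∘ₗ push F φ n) (g := push F (ψ.comp φ) n)
    (fun σ => by simp [ContinuousMap.comp_assoc]) c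

theorem push_boundary (φ : C(X, Y)) (n : ℕ) (c : SingularChain F X (n + 1)) :
    push F φ n (boundary F X n c) = boundary F Y n (push F φ (n + 1) c) := by
  refine linearMap_congr_single (f := push F φ n ∘ₗ boundary F X n)
    (g := boundary F Y n ∘ₗ push F φ (n + 1)) (fun σ => ?_) c
  simp only [LinearMap.comp_apply, boundary_single_one, push_single, map_sum, map_smul,
    ContinuousMap.comp_assoc]

theorem realize_comp_faceInclusion {n : ℕ} (w : Fin (n + 2) → K) (i : Fin (n + 2)) :
    (realize w).comp (faceInclusion n i) = realize (w ∘ i.succAbove) :=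
  ContinuousMap.ext fun t => ConvexTop.comb_map i.succAbove t w

theorem realization_boundary (n : ℕ) (c : OrderedChain F K (n + 1)) :
    realization F K n (orderedBoundary F K n c) = boundary F K n (realization F K (n + 1) c) := by
  refine linearMap_congr_single (f := realization F K n ∘ₗ orderedBoundary F K n)
    (g := boundary F K n ∘ₗ realization F K (n + 1)) (fun w => ?_) c
  simp only [LinearMap.comp_apply, boundary_single_one, orderedBoundary_single,
    realization_single, map_sum, map_smul, realize_comp_faceInclusion]

theorem push_realization (φ : C(K, L)) (hφ : IsAffineMap φ) (n : ℕ) (c : OrderedChain F K n) :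
    push F φ n (realization F K n c) = realization F L n (orderedMap F φ n c) := by
  refine linearMap_congr_single (f := push F φ n ∘ₗ realization F K n)
    (g := realization F L n ∘ₗ orderedMap F φ n) (fun w => ?_) c
  simp only [LinearMap.comp_apply, push_single, realization_single, orderedMap_single]
  congr 1
  exact ContinuousMap.ext fun t => hφ _ t w

/-- The ordered chain consisting of the vertices of the standard simplex. -/
def vertexChain (n : ℕ) : OrderedChain F (stdSimplex ℝ (Fin (n + 1))) n :=
  Finsupp.single stdSimplex.vertex 1

/-- A singular simplex is its own image of the affine identity simplex. Identities between natural
operators thereby reduce to ordered chains of a standard simplex. -/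
theorem push_realization_vertexChain {n : ℕ} (σ : SingularSimplex X n) :
    push F σ n (realization F _ n (vertexChain F n)) = Finsupp.single σ 1 := by
  simp [vertexChain, realize_vertex]

theorem orderedMap_realize_vertexChain {n : ℕ} (w : Fin (n + 1) → K) :
    orderedMap F (realize w) n (vertexChain F n) = Finsupp.single w 1 := by
  simp [vertexChain, realize_comp_vertex]

/-- The operator on singular chains defined by a model chain in the standard simplex. -/
def modelOperator (X : Type*) [TopologicalSpace X] {n k : ℕ}
    (m : OrderedChain F (stdSimplex ℝ (Fin (n + 1))) k) :
    SingularChain F X n →ₗ[F] SingularChain F X k :=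
  Finsupp.linearCombination F fun σ => push F σ k (realization F _ k m)

variable {F}
variable {n k : ℕ} (m : OrderedChain F (stdSimplex ℝ (Fin (n + 1))) k)

theorem modelOperator_single (σ : SingularSimplex X n) :
    modelOperator F X m (Finsupp.single σ 1) = push F σ k (realization F _ k m) := by
  rw [modelOperator, Finsupp.linearCombination_single, one_smul]

theorem modelOperator_push (φ : C(X, Y)) (c : SingularChain F X n) :
    modelOperator F Y m (push F φ n c) = push F φ k (modelOperator F X m c) := by
  refine linearMap_congr_single (f := modelOperator F Y m ∘ₗ push F φ n)
    (g := push F φ k ∘ₗ modelOperator F X m) (fun σ => ?_) c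
  simp only [LinearMap.comp_apply, push_single, modelOperator_single, push_push]

/-- Transporting an affinely natural operator from the standard simplex to singular chains gives
nothing new on affine simplices: the hypothesis is its naturality along `realize w`, tested on the
vertex chain. -/
theorem modelOperator_realization {op : OrderedChain F K n →ₗ[F] OrderedChain F K k}
    (h : ∀ w : Fin (n + 1) → K, orderedMap F (realize w) k m = op (Finsupp.single w 1))
    (c : OrderedChain F K n) :
    modelOperator F K m (realization F K n c) = realization F K k (op c) := by
  refine linearMap_congr_single (f := modelOperator F K m ∘ₗ realization F K n)
    (g := realization F K k ∘ₗ op) (fun w => ?_) c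
  simp only [LinearMap.comp_apply, realization_single, modelOperator_single]
  rw [push_realization _ _ (realize_isAffineMap w), h]

theorem push_mem_chainsIn {A : Set X} {B : Set Y} (φ : C(X, Y)) (h : ∀ x ∈ A, φ x ∈ B)
    {c : SingularChain F X n} (hc : c ∈ chainsIn F A n) : push F φ n c ∈ chainsIn F B n := by
  rw [chainsIn, Finsupp.supported_eq_span_single] at hc
  refine Submodule.span_induction (p := fun c _ => push F φ n c ∈ chainsIn F B n)
    ?_ (by simp) (fun x y _ _ hx hy => by rw [map_add]; exact Submodule.add_mem _ hx hy)
    (fun a x _ hx => by rw [map_smul]; exact Submodule.smul_mem _ a hx) hc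
  rintro _ ⟨σ, hσ, rfl⟩
  rw [push_single]
  exact Finsupp.single_mem_supported F _ fun t => h _ (hσ t)

/-- A linear map sends chains supported in `s` into `S` if it does so for the generators. -/
theorem map_mem_of_mem_supported {α M : Type*} [AddCommGroup M] [Module F M]
    (op : (α →₀ F) →ₗ[F] M) {s : Set α} (S : Submodule F M)
    (h : ∀ a ∈ s, op (Finsupp.single a 1) ∈ S) {c : α →₀ F} (hc : c ∈ Finsupp.supported F F s) :
    op c ∈ S := by
  rw [Finsupp.supported_eq_span_single] at hc
  refine (Submodule.span_le (p := S.comap op)).2 ?_ hc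
  rintro _ ⟨a, ha, rfl⟩
  exact h a ha

theorem mem_chainsIn_univ (c : SingularChain F X n) : c ∈ chainsIn F (Set.univ : Set X) n := by
  rw [chainsIn_univ]
  trivial

theorem modelOperator_mem_chainsIn {A : Set X} {c : SingularChain F X n}
    (hc : c ∈ chainsIn F A n) : modelOperator F X m c ∈ chainsIn F A k := by
  refine map_mem_of_mem_supported _ _ (fun σ hσ => ?_) hc
  rw [modelOperator_single]
  exact push_mem_chainsIn (A := Set.univ) σ (fun t _ => hσ t) (mem_chainsIn_univ _)

end Realization

/-! ### Barycentric subdivision of singular chains -/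

section Subdivision

variable (F : Type*) [Field F] {X : Type*} [TopologicalSpace X]

/-- The barycentre of a tuple. -/
def baryPoint (K : Type*) [TopologicalSpace K] [ConvexTop K] (n : ℕ) (w : Fin (n + 1) → K) : K :=
  ConvexTop.comb stdSimplex.barycenter w

/-- Barycentric subdivision of ordered chains. -/
def barySd (K : Type*) [TopologicalSpace K] [ConvexTop K] (n : ℕ) :
    OrderedChain F K n →ₗ[F] OrderedChain F K n :=
  orderedSd F (baryPoint K) n

/-- The chain homotopy between the identity and barycentric subdivision. -/
def baryHomotopy (K : Type*) [TopologicalSpace K] [ConvexTop K] (n : ℕ) :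
    OrderedChain F K n →ₗ[F] OrderedChain F K (n + 1) :=
  coneHomotopy F (fun _ => LinearMap.id) (barySd F K) (baryPoint K) n

/-- Barycentric subdivision of singular chains. -/
def singularSd (X : Type*) [TopologicalSpace X] (n : ℕ) :
    SingularChain F X n →ₗ[F] SingularChain F X n :=
  modelOperator F X (barySd F _ n (vertexChain F n))

/-- The chain homotopy between the identity and barycentric subdivision of singular chains. -/
def singularSdHomotopy (X : Type*) [TopologicalSpace X] (n : ℕ) :
    SingularChain F X n →ₗ[F] SingularChain F X (n + 1) :=
  modelOperator F X (baryHomotopy F _ n (vertexChain F n))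

variable {F}
variable {K L : Type*} [TopologicalSpace K] [ConvexTop K] [TopologicalSpace L] [ConvexTop L]

theorem barySd_natural {φ : K → L} (hφ : IsAffineMap φ) (n : ℕ) (c : OrderedChain F K n) :
    orderedMap F φ n (barySd F K n c) = barySd F L n (orderedMap F φ n c) :=
  orderedSd_natural (fun n w => hφ n _ w) n c

theorem baryHomotopy_natural {φ : K → L} (hφ : IsAffineMap φ) (n : ℕ) (c : OrderedChain F K n) :
    orderedMap F φ (n + 1) (baryHomotopy F K n c) = baryHomotopy F L n (orderedMap F φ n c) :=
  coneHomotopy_natural (f := fun _ => LinearMap.id) (f' := fun _ => LinearMap.id)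
    (g := barySd F K) (g' := barySd F L) (fun _ _ => rfl) (fun n c => barySd_natural hφ n c)
    (fun n w => hφ n _ w) n c

theorem orderedBoundary_baryHomotopy_zero (c : OrderedChain F K 0) :
    orderedBoundary F K 0 (baryHomotopy F K 0 c) = c - barySd F K 0 c :=
  orderedBoundary_coneHomotopy_zero (f := fun _ => LinearMap.id) (g := barySd F K)
    (fun _ => rfl) c

theorem orderedBoundary_baryHomotopy_succ (n : ℕ) (c : OrderedChain F K (n + 1)) :
    orderedBoundary F K (n + 1) (baryHomotopy F K (n + 1) c) =
      c - barySd F K (n + 1) c - baryHomotopy F K n (orderedBoundary F K n c) :=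
  orderedBoundary_coneHomotopy_succ (f := fun _ => LinearMap.id) (g := barySd F K)
    (fun _ => rfl) (fun _ _ => rfl) (fun n c => orderedBoundary_sd n c) n c

theorem singularSd_realization (n : ℕ) (c : OrderedChain F K n) :
    singularSd F K n (realization F K n c) = realization F K n (barySd F K n c) :=
  modelOperator_realization _ (fun w => by
    rw [barySd_natural (realize_isAffineMap w), orderedMap_realize_vertexChain]) c

theorem singularSdHomotopy_realization (n : ℕ) (c : OrderedChain F K n) :
    singularSdHomotopy F K n (realization F K n c) =
      realization F K (n + 1) (baryHomotopy F K n c) :=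
  modelOperator_realization _ (fun w => by
    rw [baryHomotopy_natural (realize_isAffineMap w), orderedMap_realize_vertexChain]) c

/-- Both sides are natural in the simplex, so it suffices to treat the affine identity simplex,
where the claim is `orderedBoundary_sd`. The two homotopy formulas below are transported in the same
way. -/
theorem boundary_singularSd (n : ℕ) (c : SingularChain F X (n + 1)) :
    boundary F X n (singularSd F X (n + 1) c) = singularSd F X n (boundary F X n c) := by
  refine linearMap_congr_single (f := boundary F X n ∘ₗ singularSd F X (n + 1))
    (g := singularSd F X n ∘ₗ boundary F X n) (fun σ => ?_) c
  simp only [LinearMap.comp_apply]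
  rw [← push_realization_vertexChain, singularSd, modelOperator_push, ← push_boundary,
    ← push_boundary, ← singularSd, singularSd_realization, ← realization_boundary,
    ← realization_boundary, barySd, orderedBoundary_sd, ← barySd, singularSd, modelOperator_push, ← singularSd,
    singularSd_realization]

theorem boundary_singularSdHomotopy_zero (c : SingularChain F X 0) :
    boundary F X 0 (singularSdHomotopy F X 0 c) = c - singularSd F X 0 c := by
  refine linearMap_congr_single (f := boundary F X 0 ∘ₗ singularSdHomotopy F X 0)
    (g := LinearMap.id - singularSd F X 0) (fun σ => ?_) c
  simp only [LinearMap.comp_apply, LinearMap.sub_apply, LinearMap.id_apply]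
  rw [← push_realization_vertexChain, singularSdHomotopy, modelOperator_push, ← push_boundary,
    ← singularSdHomotopy, singularSdHomotopy_realization, ← realization_boundary,
    orderedBoundary_baryHomotopy_zero, singularSd, modelOperator_push, ← singularSd,
    singularSd_realization]
  simp

theorem boundary_singularSdHomotopy_succ (n : ℕ) (c : SingularChain F X (n + 1)) :
    boundary F X (n + 1) (singularSdHomotopy F X (n + 1) c) =
      c - singularSd F X (n + 1) c - singularSdHomotopy F X n (boundary F X n c) := by
  refine linearMap_congr_single (f := boundary F X (n + 1) ∘ₗ singularSdHomotopy F X (n + 1))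
    (g := LinearMap.id - singularSd F X (n + 1) - singularSdHomotopy F X n ∘ₗ boundary F X n)
    (fun σ => ?_) c
  simp only [LinearMap.comp_apply, LinearMap.sub_apply, LinearMap.id_apply]
  rw [← push_realization_vertexChain]
  have h1 : singularSdHomotopy F X (n + 1)
      (push F σ (n + 1) (realization F _ (n + 1) (vertexChain F (n + 1)))) =
      push F σ (n + 2) (realization F _ (n + 2) (baryHomotopy F _ (n + 1) (vertexChain F (n + 1)))) := by
    rw [singularSdHomotopy, modelOperator_push, ← singularSdHomotopy,
      singularSdHomotopy_realization]
  have h2 : singularSd F X (n + 1)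
      (push F σ (n + 1) (realization F _ (n + 1) (vertexChain F (n + 1)))) =
      push F σ (n + 1) (realization F _ (n + 1) (barySd F _ (n + 1) (vertexChain F (n + 1)))) := by
    rw [singularSd, modelOperator_push, ← singularSd, singularSd_realization]
  rw [h1, h2, ← push_boundary, ← push_boundary, ← realization_boundary, ← realization_boundary,
    orderedBoundary_baryHomotopy_succ,
    singularSdHomotopy, modelOperator_push, ← singularSdHomotopy, singularSdHomotopy_realization]
  simp

end Subdivision

/-! ### The prism operator -/

section Prism

variable (F : Type*) [Field F] {X Y : Type*} [TopologicalSpace X] [TopologicalSpace Y]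

/-- The inclusion `x ↦ (s, x)`. -/
def sliceMap (X : Type*) [TopologicalSpace X] (s : unitInterval) : C(X, unitInterval × X) :=
  ⟨fun x => (s, x), by fun_prop⟩

/-- The prism operator on ordered chains. -/
def orderedPrism (K : Type*) [TopologicalSpace K] (n : ℕ) :
    OrderedChain F K n →ₗ[F] OrderedChain F (unitInterval × K) (n + 1) :=
  coneHomotopy F (fun n => orderedMap F (sliceMap K 0) n) (fun n => orderedMap F (sliceMap K 1) n)
    -- The apex only has to depend naturally on the tuple; the first vertex on the bottom face is
    -- such a choice.
    (fun _ w => ((0 : unitInterval), w 0)) n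

/-- The prism operator on singular chains. -/
def prism (X : Type*) [TopologicalSpace X] (n : ℕ) :
    SingularChain F X n →ₗ[F] SingularChain F (unitInterval × X) (n + 1) :=
  Finsupp.linearCombination F fun σ => push F ((ContinuousMap.id unitInterval).prodMap σ) (n + 1)
    (realization F _ (n + 1) (orderedPrism F _ n (vertexChain F n)))

variable {F}

theorem prism_single {n : ℕ} (σ : SingularSimplex X n) :
    prism F X n (Finsupp.single σ 1) = push F ((ContinuousMap.id unitInterval).prodMap σ) (n + 1)
      (realization F _ (n + 1) (orderedPrism F _ n (vertexChain F n))) := by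
  rw [prism, Finsupp.linearCombination_single, one_smul]

theorem prism_push (φ : C(X, Y)) (n : ℕ) (c : SingularChain F X n) :
    prism F Y n (push F φ n c) =
      push F ((ContinuousMap.id unitInterval).prodMap φ) (n + 1) (prism F X n c) := by
  refine linearMap_congr_single (f := prism F Y n ∘ₗ push F φ n)
    (g := push F ((ContinuousMap.id unitInterval).prodMap φ) (n + 1) ∘ₗ prism F X n)
    (fun σ => ?_) c
  simp only [LinearMap.comp_apply, push_single, prism_single, push_push]
  rfl

variable {K L : Type*} [TopologicalSpace K] [ConvexTop K] [TopologicalSpace L] [ConvexTop L]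

/-- A constant tuple factors through the one-point index set, and the simplex on that set is a
single vertex. -/
theorem comb_const (n : ℕ) (t : stdSimplex ℝ (Fin (n + 1))) (x : K) :
    ConvexTop.comb t (fun _ : Fin (n + 1) => x) = x := by
  have h := ConvexTop.comb_map (n := n) (m := 0) (fun _ => 0) t (fun _ => x)
  rw [show stdSimplex.map (fun _ => (0 : Fin 1)) t = stdSimplex.vertex 0 from
    Subsingleton.elim _ _, ConvexTop.comb_vertex] at h
  exact h.symm

theorem sliceMap_isAffineMap (s : unitInterval) : IsAffineMap (sliceMap K s) := fun n t w => by
  refine Prod.ext ?_ rfl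
  exact (comb_const n t s).symm

theorem prodMap_isAffineMap {φ : C(K, L)} (hφ : IsAffineMap φ) :
    IsAffineMap ((ContinuousMap.id unitInterval).prodMap φ) := fun n t _ =>
  Prod.ext rfl (hφ n t _)

theorem orderedPrism_natural (φ : C(X, Y)) (n : ℕ) (c : OrderedChain F X n) :
    orderedMap F ((ContinuousMap.id unitInterval).prodMap φ) (n + 1) (orderedPrism F X n c) =
      orderedPrism F Y n (orderedMap F φ n c) := by
  have h : ∀ s n (c : OrderedChain F X n),
      orderedMap F ((ContinuousMap.id unitInterval).prodMap φ) n (orderedMap F (sliceMap X s) n c) =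
      orderedMap F (sliceMap Y s) n (orderedMap F φ n c) := fun s n c => by
    refine linearMap_congr_single (f := orderedMap F ((ContinuousMap.id unitInterval).prodMap φ) n ∘ₗ
      orderedMap F (sliceMap X s) n) (g := orderedMap F (sliceMap Y s) n ∘ₗ orderedMap F φ n)
      (fun w => ?_) c
    simp only [LinearMap.comp_apply, orderedMap_single]
    rfl
  exact coneHomotopy_natural (h 0) (h 1) (fun _ _ => rfl) n c

theorem prism_realization (n : ℕ) (c : OrderedChain F K n) :
    prism F K n (realization F K n c) = realization F _ (n + 1) (orderedPrism F K n c) := by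
  refine linearMap_congr_single (f := prism F K n ∘ₗ realization F K n)
    (g := realization F _ (n + 1) ∘ₗ orderedPrism F K n) (fun w => ?_) c
  simp only [LinearMap.comp_apply, realization_single, prism_single]
  rw [push_realization _ _ (prodMap_isAffineMap (realize_isAffineMap w)), orderedPrism_natural,
    orderedMap_realize_vertexChain]

theorem push_sliceMap_push (φ : C(X, Y)) (s : unitInterval) (n : ℕ) (c : SingularChain F X n) :
    push F (sliceMap Y s) n (push F φ n c) =
      push F ((ContinuousMap.id unitInterval).prodMap φ) n (push F (sliceMap X s) n c) := by
  rw [push_push, push_push]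
  rfl

theorem boundary_prism_zero (c : SingularChain F X 0) :
    boundary F _ 0 (prism F X 0 c) = push F (sliceMap X 0) 0 c - push F (sliceMap X 1) 0 c := by
  refine linearMap_congr_single (f := boundary F _ 0 ∘ₗ prism F X 0)
    (g := push F (sliceMap X 0) 0 - push F (sliceMap X 1) 0) (fun σ => ?_) c
  simp only [LinearMap.comp_apply, LinearMap.sub_apply]
  rw [← push_realization_vertexChain, prism_push, ← push_boundary, prism_realization,
    ← realization_boundary, orderedPrism, orderedBoundary_coneHomotopy_zero
      (fun c => by rw [orderedAug_map, orderedAug_map]), push_sliceMap_push, push_sliceMap_push,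
    push_realization _ _ (sliceMap_isAffineMap 0), push_realization _ _ (sliceMap_isAffineMap 1),
    map_sub, map_sub]

theorem boundary_prism_succ (n : ℕ) (c : SingularChain F X (n + 1)) :
    boundary F _ (n + 1) (prism F X (n + 1) c) = push F (sliceMap X 0) (n + 1) c -
      push F (sliceMap X 1) (n + 1) c - prism F X n (boundary F X n c) := by
  refine linearMap_congr_single (f := boundary F _ (n + 1) ∘ₗ prism F X (n + 1))
    (g := push F (sliceMap X 0) (n + 1) - push F (sliceMap X 1) (n + 1) -
      prism F X n ∘ₗ boundary F X n) (fun σ => ?_) c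
  simp only [LinearMap.comp_apply, LinearMap.sub_apply]
  rw [← push_realization_vertexChain, prism_push, ← push_boundary, prism_realization,
    ← realization_boundary, orderedPrism, orderedBoundary_coneHomotopy_succ
      (fun c => by rw [orderedAug_map, orderedAug_map])
      (fun n c => (orderedMap_boundary F _ n c).symm)
      (fun n c => (orderedMap_boundary F _ n c).symm), push_sliceMap_push, push_sliceMap_push,
    push_realization _ _ (sliceMap_isAffineMap 0), push_realization _ _ (sliceMap_isAffineMap 1),
    map_sub, map_sub, map_sub, map_sub, ← push_boundary, ← realization_boundary, prism_push,
    prism_realization]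
  rfl

end Prism

/-! ### The mesh of iterated barycentric subdivisions -/

section Mesh

variable {F : Type*} [Field F] {m n : ℕ}

theorem dist_comb_le (x : stdSimplex ℝ (Fin (m + 1))) {R : ℝ}
    (t : stdSimplex ℝ (Fin (n + 1))) (w : Fin (n + 1) → stdSimplex ℝ (Fin (m + 1)))
    (h : ∀ i, dist x (w i) ≤ R) : dist x (ConvexTop.comb t w) ≤ R := by
  rw [dist_comm, Subtype.dist_eq]
  refine (convex_closedBall (x : Fin (m + 1) → ℝ) R).sum_mem (fun i _ => t.2.1 i) t.2.2
    fun i _ => ?_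
  rw [Metric.mem_closedBall, dist_comm]
  exact h i

/-- The difference is the average of the `n + 1` vectors `w i - w j`, one of which is zero; this
produces the contraction factor `n / (n + 1)`. -/
theorem dist_baryPoint_le {D : ℝ} (w : Fin (n + 1) → stdSimplex ℝ (Fin (m + 1)))
    (h : ∀ i j, dist (w i) (w j) ≤ D) (j : Fin (n + 1)) :
    dist (baryPoint _ n w) (w j) ≤ n / (n + 1) * D := by
  have hsum : (baryPoint _ n w).1 - (w j).1 =
      ∑ i, ((n : ℝ) + 1)⁻¹ • ((w i).1 - (w j).1) := by
    have h1 : (baryPoint _ n w).1 =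
        ∑ i, ((n : ℝ) + 1)⁻¹ • (w i).1 := by
      change ∑ i, (stdSimplex.barycenter (𝕜 := ℝ) : stdSimplex ℝ (Fin (n + 1))).1 i •
        (w i).1 = _
      simp
    have hn : ((n : ℝ) + 1) ≠ 0 := by positivity
    rw [h1]
    simp only [smul_sub, Finset.sum_sub_distrib, Finset.sum_const, Finset.card_univ,
      Fintype.card_fin]
    rw [← Nat.cast_smul_eq_nsmul ℝ, smul_smul]
    push_cast
    rw [mul_inv_cancel₀ hn, one_smul]
  rw [Subtype.dist_eq, dist_eq_norm, hsum]
  calc ‖∑ i, ((n : ℝ) + 1)⁻¹ • ((w i).1 - (w j).1)‖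
      ≤ ∑ i, ‖((n : ℝ) + 1)⁻¹ • ((w i).1 - (w j).1)‖ := norm_sum_le _ _
    _ = ∑ i ∈ Finset.univ.erase j, ‖((n : ℝ) + 1)⁻¹ • ((w i).1 - (w j).1)‖ := by
        rw [← Finset.add_sum_erase _ _ (Finset.mem_univ j)]
        simp
    _ ≤ ∑ i ∈ Finset.univ.erase j, ((n : ℝ) + 1)⁻¹ * D := by
        refine Finset.sum_le_sum fun i _ => ?_
        rw [norm_smul, norm_inv, Real.norm_of_nonneg (by positivity), ← dist_eq_norm]
        exact mul_le_mul_of_nonneg_left (h i j) (by positivity)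
    _ = n / (n + 1) * D := by
        rw [Finset.sum_const, Finset.card_erase_of_mem (Finset.mem_univ j), Finset.card_univ,
          Fintype.card_fin, nsmul_eq_mul]
        simp only [add_tsub_cancel_right]
        ring

/-- The tuples with all entries in a closed ball. -/
def tupleBall {K : Type*} [Dist K] (x : K) (R : ℝ) (n : ℕ) : Set (Fin (n + 1) → K) :=
  {w | ∀ i, dist x (w i) ≤ R}

/-- The tuples whose entries have pairwise distance at most `D`. -/
def tupleMesh (K : Type*) [Dist K] (D : ℝ) (n : ℕ) : Set (Fin (n + 1) → K) :=
  {w | ∀ i j, dist (w i) (w j) ≤ D}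

theorem orderedBoundary_mem_supported {K : Type*} (s : ∀ n, Set (Fin (n + 1) → K))
    (hs : ∀ w ∈ s (n + 1), ∀ i : Fin (n + 2), w ∘ i.succAbove ∈ s n)
    {w : Fin (n + 2) → K} (hw : w ∈ s (n + 1)) :
    orderedBoundary F K n (Finsupp.single w 1) ∈ Finsupp.supported F F (s n) := by
  rw [orderedBoundary_single]
  exact Submodule.sum_mem _ fun i _ => Submodule.smul_mem _ _
    (Finsupp.single_mem_supported F _ (hs w hw i))

/-- Balls are convex, so subdivision stays inside them. Applied around a barycentre, this bounds the
distances from the apex to the other vertices of the subdivided pieces. -/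
theorem barySd_mem_tupleBall (x : stdSimplex ℝ (Fin (m + 1))) (R : ℝ)
    {c : OrderedChain F (stdSimplex ℝ (Fin (m + 1))) n}
    (hc : c ∈ Finsupp.supported F F (tupleBall x R n)) :
    barySd F _ n c ∈ Finsupp.supported F F (tupleBall x R n) := by
  induction n with
  | zero => exact hc
  | succ n ih =>
    refine map_mem_of_mem_supported _ _ (fun w hw => ?_) hc
    rw [barySd, orderedSd_succ_single]
    refine map_mem_of_mem_supported _ _ (fun u hu => ?_)
      (ih (orderedBoundary_mem_supported (tupleBall x R) (fun w hw i j => hw _) hw))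
    rw [orderedCone_single]
    refine Finsupp.single_mem_supported F _ fun i => ?_
    refine Fin.cases ?_ (fun j => ?_) i
    · exact dist_comb_le x _ w hw
    · exact hu j

/-- Two kinds of edges occur: those at the apex are controlled by the ball around the barycentre,
and those in a subdivided face by induction, with a smaller factor since `n / (n + 1)` increases
with `n`. -/
theorem barySd_mem_tupleMesh {D : ℝ} (hD : 0 ≤ D)
    {c : OrderedChain F (stdSimplex ℝ (Fin (m + 1))) n}
    (hc : c ∈ Finsupp.supported F F (tupleMesh _ D n)) :
    barySd F _ n c ∈ Finsupp.supported F F (tupleMesh _ (n / (n + 1) * D) n) := by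
  induction n with
  | zero =>
    refine Finsupp.supported_mono (fun w _ i j => ?_) hc
    rw [show i = j from Subsingleton.elim (α := Fin 1) i j]
    simp
  | succ n ih =>
    refine map_mem_of_mem_supported _ _ (fun w hw => ?_) hc
    rw [barySd, orderedSd_succ_single]
    set R : ℝ := ((n + 1 : ℕ) : ℝ) / ((n + 1 : ℕ) + 1) * D with hR
    have hb := dist_baryPoint_le w hw
    have h1 := barySd_mem_tupleBall (baryPoint _ (n + 1) w) R
      (orderedBoundary_mem_supported (F := F) (tupleBall (baryPoint _ (n + 1) w) R)
        (fun w hw i j => hw _) hb)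
    have h2 := ih (orderedBoundary_mem_supported (F := F) (tupleMesh _ D)
        (fun w hw i j k => hw _ _) hw)
    -- The two supports are intersected so that both bounds hold for each tuple separately.
    have h12 := Submodule.mem_inf.2 ⟨h1, h2⟩
    rw [← Finsupp.supported_inter] at h12
    refine map_mem_of_mem_supported _ _ (fun u hu => ?_) h12
    rw [orderedCone_single]
    refine Finsupp.single_mem_supported F _ fun i j => ?_
    have hR0 : 0 ≤ R := by positivity
    have hle : (n : ℝ) / (n + 1) * D ≤ R := by
      rw [hR]
      refine mul_le_mul_of_nonneg_right ?_ hD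
      rw [div_le_div_iff₀ (by positivity) (by positivity)]
      push_cast
      nlinarith
    refine Fin.cases ?_ (fun i => ?_) i <;> refine Fin.cases ?_ (fun j => ?_) j
    · simpa using hR0
    · exact hu.1 j
    · rw [dist_comm]
      exact hu.1 i
    · exact (hu.2 i j).trans hle

theorem iterate_barySd_vertexChain_mem (n k : ℕ) :
    (barySd F _ n)^[k] (vertexChain F n) ∈
      Finsupp.supported F F (tupleMesh _ ((n / (n + 1) : ℝ) ^ k) n) := by
  induction k with
  | zero =>
    refine Finsupp.single_mem_supported F _ fun i j => ?_
    rw [pow_zero]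
    -- The initial mesh is at most `1`, the bound on the diameter of the standard simplex.
    exact (Metric.dist_le_diam_of_mem (bounded_stdSimplex _) (Subtype.mem _)
      (Subtype.mem _)).trans diam_stdSimplex_le
  | succ k ih =>
    rw [Function.iterate_succ_apply', pow_succ']
    exact barySd_mem_tupleMesh (by positivity) ih

end Mesh

/-! ### Small chains -/

section Small

variable {F : Type*} [Field F] {X : Type*} [TopologicalSpace X] {A U V : Set X} {n : ℕ}

/-- The chains of `A` that are sums of a chain in `U` and a chain in `V`. -/
def smallChains (F : Type*) [Field F] {X : Type*} [TopologicalSpace X] (A U V : Set X) (n : ℕ) :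
    Submodule F (SingularChain F X n) :=
  chainsIn F (A ∩ U) n ⊔ chainsIn F (A ∩ V) n

theorem modelOperator_mem_smallChains {k : ℕ}
    (m : OrderedChain F (stdSimplex ℝ (Fin (n + 1))) k) {c : SingularChain F X n}
    (hc : c ∈ smallChains F A U V n) : modelOperator F X m c ∈ smallChains F A U V k := by
  obtain ⟨a, ha, b, hb, rfl⟩ := Submodule.mem_sup.1 hc
  rw [map_add]
  exact Submodule.add_mem_sup (modelOperator_mem_chainsIn m ha) (modelOperator_mem_chainsIn m hb)

theorem iterate_singularSd_single (σ : SingularSimplex X n) (k : ℕ) :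
    (singularSd F X n)^[k] (Finsupp.single σ 1) =
      push F σ n (realization F _ n ((barySd F _ n)^[k] (vertexChain F n))) := by
  induction k with
  | zero => exact (push_realization_vertexChain F σ).symm
  | succ k ih =>
    rw [Function.iterate_succ_apply', ih, singularSd, modelOperator_push, ← singularSd,
      singularSd_realization, Function.iterate_succ_apply']

/-- The cover pulls back to an open cover of a compact simplex. Once the mesh is below a Lebesgue
number, each affine piece lies in a ball about its first vertex, hence is sent into `U` or into `V`.
-/
theorem eventually_iterate_singularSd_single_mem (hU : IsOpen U) (hV : IsOpen V)
    (hA : A ⊆ U ∪ V) (σ : SingularSimplex X n) (hσ : ∀ t, σ t ∈ A) :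
    ∀ᶠ k in Filter.atTop, (singularSd F X n)^[k] (Finsupp.single σ 1) ∈ smallChains F A U V n := by
  let W : Bool → Set (stdSimplex ℝ (Fin (n + 1))) := fun b => σ ⁻¹' (if b then U else V)
  obtain ⟨δ, hδ, hball⟩ := lebesgue_number_lemma_of_metric (s := Set.univ) (c := W)
    isCompact_univ (fun b => by
      cases b
      · exact hV.preimage σ.continuous
      · exact hU.preimage σ.continuous) (fun t _ => by
      rcases hA (hσ t) with h | h
      · exact Set.mem_iUnion.2 ⟨true, h⟩
      · exact Set.mem_iUnion.2 ⟨false, h⟩)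
  have hlim : Filter.Tendsto (fun k : ℕ => ((n : ℝ) / (n + 1)) ^ k) Filter.atTop (nhds 0) :=
    tendsto_pow_atTop_nhds_zero_of_lt_one (by positivity)
      ((div_lt_one (by positivity)).2 (by linarith))
  filter_upwards [hlim.eventually (gt_mem_nhds hδ)] with k hk
  rw [iterate_singularSd_single]
  refine map_mem_of_mem_supported (push F σ n ∘ₗ realization F _ n) _ (fun w hw => ?_)
    (iterate_barySd_vertexChain_mem n k)
  rw [LinearMap.comp_apply, realization_single, push_single]
  obtain ⟨b, hb⟩ := hball (w 0) trivial
  have hmem : ∀ t, realize w t ∈ W b := fun t => hb <| by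
    rw [Metric.mem_ball, dist_comm]
    exact (dist_comb_le (w 0) t w fun i => hw 0 i).trans_lt hk
  cases b
  · exact Submodule.mem_sup_right (Finsupp.single_mem_supported F _ fun t => ⟨hσ _, hmem t⟩)
  · exact Submodule.mem_sup_left (Finsupp.single_mem_supported F _ fun t => ⟨hσ _, hmem t⟩)

/-- A chain involves finitely many simplices, so one number of subdivisions serves for all of them.
-/
theorem exists_iterate_singularSd_mem (hU : IsOpen U) (hV : IsOpen V) (hA : A ⊆ U ∪ V)
    {c : SingularChain F X n} (hc : c ∈ chainsIn F A n) :
    ∃ k, (singularSd F X n)^[k] c ∈ smallChains F A U V n := by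
  have h : ∀ᶠ k in Filter.atTop, ∀ σ ∈ c.support,
      (singularSd F X n)^[k] (Finsupp.single σ 1) ∈ smallChains F A U V n :=
    (Filter.eventually_all_finset _).2 fun σ hσ =>
      eventually_iterate_singularSd_single_mem hU hV hA σ (hc hσ)
  obtain ⟨k, hk⟩ := h.exists
  refine ⟨k, ?_⟩
  rw [← Module.End.pow_apply]
  refine map_mem_of_mem_supported (s := (c.support : Set _)) _ _ (fun σ hσ => ?_)
    (Finsupp.mem_supported_support F c)
  rw [Module.End.pow_apply]
  exact hk σ hσ

theorem boundary_mem_reducedCycles (c : SingularChain F X (n + 1)) :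
    boundary F X n c ∈ reducedCycles F X n := by
  cases n with
  | zero =>
    refine linearMap_congr_single (f := augmentation F X ∘ₗ boundary F X 0) (g := 0) (fun σ => ?_) c
    simp [boundary_single_one, Fin.sum_univ_two, augmentation, Finsupp.linearCombination_single]
  | succ n => exact LinearMap.congr_fun (boundary_comp_boundary F X n) c

theorem boundary_singularSdHomotopy_of_mem {c : SingularChain F X n}
    (hc : c ∈ reducedCycles F X n) :
    boundary F X n (singularSdHomotopy F X n c) = c - singularSd F X n c := by
  cases n with
  | zero => exact boundary_singularSdHomotopy_zero c
  | succ n =>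
    rw [boundary_singularSdHomotopy_succ, show boundary F X n c = 0 from hc, map_zero, sub_zero]

theorem singularSd_mem_reducedCycles {c : SingularChain F X n}
    (hc : c ∈ reducedCycles F X n) : singularSd F X n c ∈ reducedCycles F X n := by
  have h := boundary_mem_reducedCycles (singularSdHomotopy F X n c)
  rw [boundary_singularSdHomotopy_of_mem hc] at h
  exact (Submodule.sub_mem_iff_right _ hc).1 h

/-- The subdivision homotopies telescope. The family `S` is left general because both all chains of
`A` and the small chains are needed, each being stable under subdivision and its homotopy. -/
theorem exists_boundary_eq_sub_iterate_singularSd {S : ∀ n, Submodule F (SingularChain F X n)}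
    (h1 : ∀ c ∈ S n, singularSd F X n c ∈ S n)
    (h2 : ∀ c ∈ S n, singularSdHomotopy F X n c ∈ S (n + 1)) (k : ℕ) {c : SingularChain F X n}
    (hc : c ∈ S n) (hcyc : c ∈ reducedCycles F X n) :
    (singularSd F X n)^[k] c ∈ reducedCycles F X n ∧
      ∃ e ∈ S (n + 1), boundary F X n e = c - (singularSd F X n)^[k] c := by
  induction k generalizing c with
  | zero => exact ⟨hcyc, 0, Submodule.zero_mem _, by simp⟩
  | succ k ih =>
    obtain ⟨h3, e, he, h4⟩ := ih (h1 c hc) (singularSd_mem_reducedCycles hcyc)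
    refine ⟨h3, e + singularSdHomotopy F X n c, Submodule.add_mem _ he (h2 c hc), ?_⟩
    rw [map_add, h4, boundary_singularSdHomotopy_of_mem hcyc, Function.iterate_succ_apply]
    abel

/-- Every cycle is homologous to a small cycle. -/
theorem exists_small_cycle (hU : IsOpen U) (hV : IsOpen V) (hA : A ⊆ U ∪ V)
    {c : SingularChain F X n} (hc : c ∈ chainsIn F A n) (hcyc : c ∈ reducedCycles F X n) :
    ∃ c' ∈ smallChains F A U V n, c' ∈ reducedCycles F X n ∧
      c - c' ∈ (chainsIn F A (n + 1)).map (boundary F X n) := by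
  obtain ⟨k, hk⟩ := exists_iterate_singularSd_mem hU hV hA hc
  obtain ⟨h3, e, he, h4⟩ := exists_boundary_eq_sub_iterate_singularSd (S := chainsIn F A)
    (fun c hc => modelOperator_mem_chainsIn _ hc) (fun c hc => modelOperator_mem_chainsIn _ hc)
    k hc hcyc
  exact ⟨_, hk, h3, e, he, h4⟩

/-- A small chain that bounds also bounds a small chain. -/
theorem mem_map_boundary_smallChains (hU : IsOpen U) (hV : IsOpen V) (hA : A ⊆ U ∪ V)
    {c : SingularChain F X n} (hc : c ∈ smallChains F A U V n)
    (hb : c ∈ (chainsIn F A (n + 1)).map (boundary F X n)) :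
    c ∈ (smallChains F A U V (n + 1)).map (boundary F X n) := by
  obtain ⟨e, he, rfl⟩ := hb
  obtain ⟨k, hk⟩ := exists_iterate_singularSd_mem hU hV hA he
  -- Since `∂e` is already small, the homotopy from it to its subdivision is small as well; adding
  -- the subdivided `e`, also small, recovers `∂e` as a boundary.
  obtain ⟨-, e', he', h4⟩ := exists_boundary_eq_sub_iterate_singularSd (S := smallChains F A U V)
    (fun c hc => modelOperator_mem_smallChains _ hc)
    (fun c hc => modelOperator_mem_smallChains _ hc) k hc (boundary_mem_reducedCycles e)
  refine ⟨e' + (singularSd F X (n + 1))^[k] e, Submodule.add_mem _ he' hk, ?_⟩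
  have hcomm : boundary F X n ((singularSd F X (n + 1))^[k] e) =
      (singularSd F X n)^[k] (boundary F X n e) :=
    Function.Semiconj.iterate_right (f := boundary F X n) (fun c => boundary_singularSd n c) k e
  rw [map_add, h4, hcomm, sub_add_cancel]

end Small

/-! ### Acyclic sets and sets with the homology of a sphere -/

section SphereHomology

variable {F : Type*} [Field F] {X : Type*} [TopologicalSpace X] {A B U V : Set X} {n k : ℕ}

/-- The boundaries of the chains in `A`. -/
abbrev boundariesIn (F : Type*) [Field F] {X : Type*} [TopologicalSpace X] (A : Set X) (n : ℕ) :
    Submodule F (SingularChain F X n) :=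
  (chainsIn F A (n + 1)).map (boundary F X n)

/-- The reduced cycles in `A`. -/
abbrev reducedCyclesIn (F : Type*) [Field F] {X : Type*} [TopologicalSpace X] (A : Set X) (n : ℕ) :
    Submodule F (SingularChain F X n) :=
  chainsIn F A n ⊓ reducedCycles F X n

theorem boundariesIn_mono (h : A ⊆ B) : boundariesIn F A n ≤ boundariesIn F B n :=
  Submodule.map_mono (chainsIn_mono F h _)

theorem boundariesIn_le_reducedCycles : boundariesIn F A n ≤ reducedCycles F X n := by
  rintro _ ⟨c, -, rfl⟩
  exact boundary_mem_reducedCycles c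

/-- The reduced homology of `A` vanishes. -/
def IsAcyclic (F : Type*) [Field F] {X : Type*} [TopologicalSpace X] (A : Set X) : Prop :=
  ∀ n, reducedCyclesIn F A n ≤ boundariesIn F A n

/-- The reduced homology of `A` is that of the `n`-sphere, generated by the class of `α`. -/
structure HasSphereHomology (A : Set X) (n : ℕ) (α : SingularChain F X n) : Prop where
  mem : α ∈ reducedCyclesIn F A n
  notMem : α ∉ boundariesIn F A n
  le_of_ne : ∀ k, k ≠ n → reducedCyclesIn F A k ≤ boundariesIn F A k
  exists_sub_mem : ∀ z ∈ reducedCyclesIn F A n, ∃ a : F, z - a • α ∈ boundariesIn F A n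

theorem HasSphereHomology.nonempty {α : SingularChain F X n} (h : HasSphereHomology A n α) :
    A.Nonempty := by
  rw [Set.nonempty_iff_ne_empty]
  rintro rfl
  have := h.mem.1
  rw [chainsIn_empty] at this
  exact h.notMem ((Submodule.mem_bot F).1 this ▸ Submodule.zero_mem _)

theorem chainsIn_inter : chainsIn F (A ∩ B) n = chainsIn F A n ⊓ chainsIn F B n := by
  rw [chainsIn, chainsIn, chainsIn, ← Finsupp.supported_inter]
  congr 1
  ext σ
  exact forall_and

/-- The singular `0`-simplex at a point. -/
def pointChain (F : Type*) [Field F] {X : Type*} [TopologicalSpace X] (x : X) :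
    SingularChain F X 0 :=
  Finsupp.single (ContinuousMap.const _ x) 1

theorem pointChain_mem {x : X} (hx : x ∈ A) : pointChain F x ∈ chainsIn F A 0 :=
  Finsupp.single_mem_supported F _ fun _ => hx

@[simp] theorem augmentation_single (σ : SingularSimplex X 0) (a : F) :
    augmentation F X (Finsupp.single σ a) = a := by
  simp [augmentation, Finsupp.linearCombination_single]

@[simp] theorem augmentation_pointChain (x : X) : augmentation F X (pointChain F x) = 1 := by
  simp [pointChain]

theorem mem_reducedCycles_of_boundary_eq {c c' : SingularChain F X (n + 1)}
    (h : boundary F X n c = boundary F X n c') : c - c' ∈ reducedCycles F X (n + 1) :=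
  LinearMap.mem_ker.2 (by rw [map_sub, h, sub_self])

/-- The Mayer–Vietoris step: a set covered by two acyclic pieces, open in it, whose intersection
has the homology of the `n`-sphere, has the homology of the `(n+1)`-sphere. -/
theorem HasSphereHomology.of_cover (hU : IsOpen U) (hV : IsOpen V) (hA : A ⊆ U ∪ V)
    (hAU : IsAcyclic F (A ∩ U)) (hAV : IsAcyclic F (A ∩ V)) {α : SingularChain F X n}
    (hα : HasSphereHomology (A ∩ (U ∩ V)) n α) :
    ∃ β : SingularChain F X (n + 1), HasSphereHomology A (n + 1) β := by
  have hsubU : A ∩ (U ∩ V) ⊆ A ∩ U := fun x hx => ⟨hx.1, hx.2.1⟩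
  have hsubV : A ∩ (U ∩ V) ⊆ A ∩ V := fun x hx => ⟨hx.1, hx.2.2⟩
  have hinter : ∀ k, chainsIn F (A ∩ U) k ⊓ chainsIn F (A ∩ V) k = chainsIn F (A ∩ (U ∩ V)) k := by
    intro k
    rw [← chainsIn_inter]
    congr 1
    ext x
    simp only [Set.mem_inter_iff]
    tauto
  have hleU : ∀ k, boundariesIn F (A ∩ U) k ≤ boundariesIn F A k := fun k =>
    boundariesIn_mono Set.inter_subset_left
  have hleV : ∀ k, boundariesIn F (A ∩ V) k ≤ boundariesIn F A k := fun k =>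
    boundariesIn_mono Set.inter_subset_left
  -- The generator of the intersection bounds in each acyclic piece. Gluing the two fillings along
  -- it gives the generator `wU - wV` one degree higher.
  obtain ⟨wU, hwU, hwUα⟩ := hAU n ⟨chainsIn_mono F hsubU n hα.mem.1, hα.mem.2⟩
  obtain ⟨wV, hwV, hwVα⟩ := hAV n ⟨chainsIn_mono F hsubV n hα.mem.1, hα.mem.2⟩
  -- reduction to small cycles
  have key : ∀ k z, z ∈ reducedCyclesIn F A k → ∃ zU ∈ chainsIn F (A ∩ U) k,
      ∃ zV ∈ chainsIn F (A ∩ V) k, zU + zV ∈ reducedCycles F X k ∧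
        z - (zU + zV) ∈ boundariesIn F A k := by
    rintro k z ⟨hz, hzc⟩
    obtain ⟨c', hc', hcyc, h⟩ := exists_small_cycle hU hV hA hz hzc
    obtain ⟨zU, hzU, zV, hzV, rfl⟩ := Submodule.mem_sup.1 hc'
    exact ⟨zU, hzU, zV, hzV, hcyc, h⟩
  -- The connecting map: the boundary of the `U`-part equals minus that of the `V`-part, so it is
  -- supported in both pieces.
  have split : ∀ k (zU zV : SingularChain F X (k + 1)), zU ∈ chainsIn F (A ∩ U) (k + 1) →
      zV ∈ chainsIn F (A ∩ V) (k + 1) → zU + zV ∈ reducedCycles F X (k + 1) →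
      boundary F X k zU ∈ reducedCyclesIn F (A ∩ (U ∩ V)) k ∧
        boundary F X k zV = -boundary F X k zU := by
    intro k zU zV hzU hzV hcyc
    have h0 : boundary F X k zV = -boundary F X k zU := by
      have : boundary F X k (zU + zV) = 0 := hcyc
      rw [map_add] at this
      exact eq_neg_of_add_eq_zero_right this
    refine ⟨⟨?_, boundary_mem_reducedCycles _⟩, h0⟩
    rw [← hinter]
    refine ⟨boundary_mem_chainsIn F _ _ hzU, ?_⟩
    have := boundary_mem_chainsIn F _ _ hzV
    rw [h0] at this
    exact (Submodule.neg_mem_iff _).1 this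
  refine ⟨wU - wV, ⟨⟨?_, ?_⟩, ?_, ?_, ?_⟩⟩
  · exact Submodule.sub_mem _ (chainsIn_mono F Set.inter_subset_left _ hwU)
      (chainsIn_mono F Set.inter_subset_left _ hwV)
  · exact mem_reducedCycles_of_boundary_eq (hwUα.trans hwVα.symm)
  · intro hb
    obtain ⟨e, he, hbe⟩ := mem_map_boundary_smallChains hU hV hA
      (Submodule.sub_mem _ (Submodule.mem_sup_left hwU) (Submodule.mem_sup_right hwV)) hb
    obtain ⟨eU, heU, eV, heV, rfl⟩ := Submodule.mem_sup.1 he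
    -- If `wU - wV = ∂(eU + eV)`, then `wU - ∂eU = wV + ∂eV` lies in the intersection and still has
    -- boundary `α`, contradicting the choice of `α`.
    refine hα.notMem ⟨wU - boundary F X (n + 1) eU, ?_, ?_⟩
    · rw [← hinter]
      refine ⟨Submodule.sub_mem _ hwU (boundary_mem_chainsIn F _ _ heU), ?_⟩
      have : wU - boundary F X (n + 1) eU = wV + boundary F X (n + 1) eV := by
        rw [map_add] at hbe
        rw [sub_eq_iff_eq_add, add_assoc, add_comm (boundary F X (n + 1) eV), hbe]
        abel
      rw [this]
      exact Submodule.add_mem _ hwV (boundary_mem_chainsIn F _ _ heV)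
    · rw [map_sub, hwUα, sub_eq_self]
      exact LinearMap.congr_fun (boundary_comp_boundary F X n) eU
  · intro k hk z hz
    obtain ⟨zU, hzU, zV, hzV, hcyc, hb⟩ := key k z hz
    refine (Submodule.sub_mem_iff_left _ ?_).1 hb
    cases k with
    | zero =>
      -- A point of the intersection balances the augmentations: `a` times it is subtracted on one
      -- side and added on the other, making both parts reduced cycles.
      obtain ⟨x, hx⟩ := hα.nonempty
      set a := augmentation F X zU
      have hcyc' : augmentation F X zU + augmentation F X zV = 0 := by
        rw [← map_add]
        exact hcyc
      have h1 : zU - a • pointChain F x ∈ boundariesIn F (A ∩ U) 0 :=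
        hAU 0 ⟨Submodule.sub_mem _ hzU (Submodule.smul_mem _ _ (pointChain_mem (hsubU hx))),
          LinearMap.mem_ker.2 (by simp [a])⟩
      have h2 : zV + a • pointChain F x ∈ boundariesIn F (A ∩ V) 0 :=
        hAV 0 ⟨Submodule.add_mem _ hzV (Submodule.smul_mem _ _ (pointChain_mem (hsubV hx))),
          LinearMap.mem_ker.2 (by simpa [a, add_comm] using hcyc')⟩
      convert! Submodule.add_mem _ (hleU _ h1) (hleV _ h2) using 1
      abel
    | succ k =>
      obtain ⟨h1, h2⟩ := split k zU zV hzU hzV hcyc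
      -- A filling `y` of the common boundary inside the intersection turns both parts into cycles
      -- of acyclic sets.
      obtain ⟨y, hy, hyb⟩ := hα.le_of_ne k (by omega) h1
      have h3 : zU - y ∈ boundariesIn F (A ∩ U) (k + 1) :=
        hAU _ ⟨Submodule.sub_mem _ hzU (chainsIn_mono F hsubU _ hy),
          mem_reducedCycles_of_boundary_eq hyb.symm⟩
      have h4 : zV + y ∈ boundariesIn F (A ∩ V) (k + 1) :=
        hAV _ ⟨Submodule.add_mem _ hzV (chainsIn_mono F hsubV _ hy),
          LinearMap.mem_ker.2 (by rw [map_add, h2, hyb, neg_add_cancel])⟩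
      convert! Submodule.add_mem _ (hleU _ h3) (hleV _ h4) using 1
      abel
  · intro z hz
    obtain ⟨zU, hzU, zV, hzV, hcyc, hb⟩ := key _ z hz
    obtain ⟨h1, h2⟩ := split n zU zV hzU hzV hcyc
    obtain ⟨a, y, hy, hyb⟩ := hα.exists_sub_mem _ h1
    refine ⟨a, ?_⟩
    -- The boundary of the `U`-part is `a • α` up to `∂y`, so subtracting `y + a • wU` closes it up;
    -- the other part is corrected with the opposite sign.
    have h3 : zU - (y + a • wU) ∈ boundariesIn F (A ∩ U) (n + 1) :=
      hAU _ ⟨Submodule.sub_mem _ hzU (Submodule.add_mem _ (chainsIn_mono F hsubU _ hy)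
        (Submodule.smul_mem _ _ hwU)), mem_reducedCycles_of_boundary_eq (by
          rw [map_add, map_smul, hyb, hwUα, sub_add_cancel])⟩
    have h4 : zV + (y + a • wV) ∈ boundariesIn F (A ∩ V) (n + 1) :=
      hAV _ ⟨Submodule.add_mem _ hzV (Submodule.add_mem _ (chainsIn_mono F hsubV _ hy)
        (Submodule.smul_mem _ _ hwV)), LinearMap.mem_ker.2 (by
          rw [map_add, map_add, map_smul, hyb, hwVα, h2]; abel)⟩
    convert! Submodule.add_mem _ hb (Submodule.add_mem _ (hleU _ h3) (hleV _ h4)) using 1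
    rw [smul_sub]
    abel

/-! ### Deformation retracts -/

theorem augmentation_push {Y : Type*} [TopologicalSpace Y] (φ : C(X, Y))
    (c : SingularChain F X 0) : augmentation F Y (push F φ 0 c) = augmentation F X c :=
  linearMap_congr_single (f := augmentation F Y ∘ₗ push F φ 0) (g := augmentation F X)
    (fun σ => by simp) c

theorem push_mem_reducedCycles {Y : Type*} [TopologicalSpace Y] (φ : C(X, Y))
    {c : SingularChain F X n} (hc : c ∈ reducedCycles F X n) :
    push F φ n c ∈ reducedCycles F Y n := by
  cases n with
  | zero => exact (augmentation_push φ c).trans hc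
  | succ n =>
    refine LinearMap.mem_ker.2 ?_
    rw [← push_boundary, show boundary F X n c = 0 from hc, map_zero]

/-- The inclusion of a subspace. -/
abbrev inclusionMap (B : Set X) : C(B, X) := ⟨Subtype.val, continuous_subtype_val⟩

theorem push_inclusionMap_injective (B : Set X) (n : ℕ) :
    Function.Injective (push F (inclusionMap B) n) := by
  refine Finsupp.mapDomain_injective fun σ τ h => ?_
  ext1 t
  exact Subtype.ext (DFunLike.congr_fun h t)

theorem mem_reducedCycles_of_push_inclusionMap {c : SingularChain F B n}
    (hc : push F (inclusionMap B) n c ∈ reducedCycles F X n) : c ∈ reducedCycles F B n := by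
  cases n with
  | zero => exact (augmentation_push (inclusionMap B) c).symm.trans hc
  | succ n =>
    refine LinearMap.mem_ker.2 (push_inclusionMap_injective B n ?_)
    rw [push_boundary, map_zero]
    exact hc

theorem chainsIn_le_map_push (h : A ⊆ B) :
    chainsIn F A n ≤
      (chainsIn F (Subtype.val ⁻¹' A : Set B) n).map (push F (inclusionMap B) n) := by
  rw [chainsIn, Finsupp.supported_eq_span_single, Submodule.span_le]
  rintro _ ⟨σ, hσ, rfl⟩
  refine ⟨Finsupp.single ⟨fun t => ⟨σ t, h (hσ t)⟩, by fun_prop⟩ 1,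
    Finsupp.single_mem_supported F _ fun t => hσ t, ?_⟩
  rw [push_single]
  rfl

theorem push_congr_of_mem {Y : Type*} [TopologicalSpace Y] {φ ψ : C(X, Y)}
    (h : ∀ x ∈ A, φ x = ψ x) {c : SingularChain F X n} (hc : c ∈ chainsIn F A n) :
    push F φ n c = push F ψ n c := by
  have := map_mem_of_mem_supported (push F φ n - push F ψ n) ⊥ (fun σ hσ => ?_) hc
  · exact sub_eq_zero.1 this
  · rw [Submodule.mem_bot, LinearMap.sub_apply, push_single, push_single, sub_eq_zero]
    congr 1
    exact ContinuousMap.ext fun t => h _ (hσ t)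

/-- A cycle of the larger set is homologous to one of the deformation retract. -/
theorem IsStrongDeformationRetract.exists_sub_mem (h : IsStrongDeformationRetract A B)
    {z : SingularChain F X n} (hz : z ∈ reducedCyclesIn F B n) :
    ∃ z' ∈ reducedCyclesIn F A n, z - z' ∈ boundariesIn F B n := by
  obtain ⟨hAB, H, h0, h1, hA⟩ := h
  obtain ⟨c, -, rfl⟩ := chainsIn_le_map_push (le_refl B) hz.1
  have hc := mem_reducedCycles_of_push_inclusionMap hz.2
  let φ : C(B, X) := (inclusionMap B).comp (H.comp (sliceMap B 1))
  have hprism : boundary F _ n (prism F B n c) =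
      push F (sliceMap B 0) n c - push F (sliceMap B 1) n c := by
    cases n with
    | zero => exact boundary_prism_zero c
    | succ n =>
      rw [boundary_prism_succ, show boundary F B n c = 0 from hc, map_zero, sub_zero]
  refine ⟨push F φ n c, ⟨push_mem_chainsIn (A := Set.univ) φ (fun x _ => h1 x)
    (mem_chainsIn_univ c), push_mem_reducedCycles φ hc⟩,
    push F ((inclusionMap B).comp H) (n + 1) (prism F B n c),
    push_mem_chainsIn (A := Set.univ) _ (fun x _ => (H x).2) (mem_chainsIn_univ _), ?_⟩
  rw [← push_boundary, hprism, map_sub, push_push, push_push]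
  congr 2
  have : ((inclusionMap B).comp H).comp (sliceMap B 0) = inclusionMap B :=
    ContinuousMap.ext fun x => congrArg Subtype.val (h0 x)
  rw [this]

/-- A chain of the deformation retract bounds in it if it bounds in the larger set. -/
theorem IsStrongDeformationRetract.mem_boundariesIn (h : IsStrongDeformationRetract A B)
    {z : SingularChain F X n} (hz : z ∈ chainsIn F A n) (hb : z ∈ boundariesIn F B n) :
    z ∈ boundariesIn F A n := by
  obtain ⟨hAB, H, h0, h1, hA⟩ := h
  obtain ⟨e, he, hez⟩ := hb
  obtain ⟨c, -, rfl⟩ := chainsIn_le_map_push (le_refl B) he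
  obtain ⟨u, hu, rfl⟩ := chainsIn_le_map_push hAB hz
  let φ : C(B, X) := (inclusionMap B).comp (H.comp (sliceMap B 1))
  refine ⟨push F φ (n + 1) c, push_mem_chainsIn (A := Set.univ) φ (fun x _ => h1 x)
    (mem_chainsIn_univ c), ?_⟩
  rw [← push_boundary] at hez ⊢
  rw [push_inclusionMap_injective B n hez]
  exact push_congr_of_mem (fun x hx => congrArg Subtype.val (hA 1 x hx)) hu

/-- The generator is literally the same chain in both sets. This is what allows one cycle to
represent a whole bar. -/
theorem HasSphereHomology.of_retract (h : IsStrongDeformationRetract A B)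
    {α : SingularChain F X n} (hα : HasSphereHomology A n α) : HasSphereHomology B n α where
  mem := ⟨chainsIn_mono F h.1 n hα.mem.1, hα.mem.2⟩
  notMem hb := hα.notMem (h.mem_boundariesIn hα.mem.1 hb)
  le_of_ne k hk z hz := by
    obtain ⟨z', hz', hb⟩ := h.exists_sub_mem hz
    exact (Submodule.sub_mem_iff_left _ (boundariesIn_mono h.1 (hα.le_of_ne k hk hz'))).1 hb
  exists_sub_mem z hz := by
    obtain ⟨z', hz', hb⟩ := h.exists_sub_mem hz
    obtain ⟨a, ha⟩ := hα.exists_sub_mem z' hz'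
    refine ⟨a, ?_⟩
    convert! Submodule.add_mem _ hb (boundariesIn_mono h.1 ha) using 1
    abel

theorem IsAcyclic.of_retract (h : IsStrongDeformationRetract A B) (hA : IsAcyclic F A) :
    IsAcyclic F B := fun k z hz => by
  obtain ⟨z', hz', hb⟩ := h.exists_sub_mem hz
  exact (Submodule.sub_mem_iff_left _ (boundariesIn_mono h.1 (hA k hz'))).1 hb

/-! ### Constant chains, points and pairs of points -/

/-- The constant `n`-simplices, as a linear map from `0`-chains of the underlying set. -/
def constMap (F : Type*) [Field F] (X : Type*) [TopologicalSpace X] (n : ℕ) :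
    (X →₀ F) →ₗ[F] SingularChain F X n :=
  Finsupp.lmapDomain F F fun x => ContinuousMap.const _ x

@[simp] theorem constMap_single (x : X) (a : F) :
    constMap F X n (Finsupp.single x a) = Finsupp.single (ContinuousMap.const _ x) a := by
  simp [constMap]

theorem constMap_injective : Function.Injective (constMap F X n) := by
  refine Finsupp.mapDomain_injective fun x y h => ?_
  exact DFunLike.congr_fun h (Classical.arbitrary _)

/-- All `n + 2` faces of a constant simplex coincide, so only the parity of their number matters. -/
theorem boundary_constMap (n : ℕ) (u : X →₀ F) :
    boundary F X n (constMap F X (n + 1) u) = if Even n then 0 else constMap F X n u := by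
  have hsum : ∑ i : Fin (n + 2), (-1 : F) ^ (i : ℕ) = if Even n then 0 else 1 := by
    rw [Fin.sum_neg_one_pow]
    simp [Nat.even_add]
  refine linearMap_congr_single (f := boundary F X n ∘ₗ constMap F X (n + 1))
    (g := if Even n then 0 else constMap F X n) (fun x => ?_) u |>.trans (by split_ifs <;> rfl)
  rw [LinearMap.comp_apply, constMap_single, boundary_single_one]
  have : ∀ i : Fin (n + 2), (ContinuousMap.const _ x).comp (faceInclusion n i) =
    ContinuousMap.const _ x := fun i => rfl
  simp only [this]
  rw [← Finset.sum_smul, hsum]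
  split_ifs <;> simp

theorem constMap_mem_chainsIn_iff (u : X →₀ F) :
    constMap F X n u ∈ chainsIn F A n ↔ u ∈ Finsupp.supported F F A := by
  classical
  rw [chainsIn, Finsupp.mem_supported, Finsupp.mem_supported, constMap, Finsupp.lmapDomain_apply,
    Finsupp.mapDomain_support_of_injective]
  · simp only [Finset.coe_image, Set.image_subset_iff]
    refine ⟨fun h x hx => h hx (Classical.arbitrary _), fun h x hx _ => h hx⟩
  · intro x y h
    exact DFunLike.congr_fun h (Classical.arbitrary _)

/-- The singular chains of a subspace all of whose simplices are constant have the homology of a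
discrete space. -/
theorem exists_boundary_constMap {u : X →₀ F} (h : boundary F X n (constMap F X (n + 1) u) = 0) :
    boundary F X (n + 1) (constMap F X (n + 2) u) = constMap F X (n + 1) u := by
  rw [boundary_constMap] at h ⊢
  -- The boundary maps on constants are alternately zero and the identity: either the next one is
  -- the identity, or the present one is, and then the cycle is zero.
  by_cases h1 : Even n
  · rw [if_neg (by simpa [Nat.even_add_one] using h1)]
  · rw [if_neg h1, map_eq_zero_iff _ constMap_injective] at h
    rw [h, map_zero, ite_self]

/-- The image of a simplex is connected, and a connected subset of a finite set in a T1 space has at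
most one point; hence every simplex in `A` is constant. -/
theorem chainsIn_finite (hA : A.Finite) [T1Space X] {c : SingularChain F X n}
    (hc : c ∈ chainsIn F A n) : ∃ u ∈ Finsupp.supported F F A, constMap F X n u = c := by
  have : chainsIn F A n ≤ (Finsupp.supported F F A).map (constMap F X n) := by
    rw [chainsIn, Finsupp.supported_eq_span_single, Submodule.span_le]
    rintro _ ⟨σ, hσ, rfl⟩
    have hpre : IsPreconnected (Set.range σ) := isPreconnected_range σ.continuous
    have hsub : (Set.range σ).Subsingleton := by
      by_contra h
      refine hpre.infinite_of_nontrivial (Set.not_subsingleton_iff.1 h) (hA.subset ?_)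
      rintro _ ⟨t, rfl⟩
      exact hσ t
    let t₀ : stdSimplex ℝ (Fin (n + 1)) := Classical.arbitrary _
    refine ⟨Finsupp.single (σ t₀) 1, Finsupp.single_mem_supported F _ (hσ t₀), ?_⟩
    rw [constMap_single]
    congr 1
    exact ContinuousMap.ext fun t => hsub ⟨t₀, rfl⟩ ⟨t, rfl⟩
  exact this hc

theorem reducedCyclesIn_succ_le_of_finite (hA : A.Finite) [T1Space X] :
    reducedCyclesIn F A (n + 1) ≤ boundariesIn F A (n + 1) := by
  rintro z ⟨hz, hzc⟩
  obtain ⟨u, hu, rfl⟩ := chainsIn_finite hA hz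
  exact ⟨constMap F X (n + 2) u, (constMap_mem_chainsIn_iff u).2 hu, exists_boundary_constMap hzc⟩

theorem isAcyclic_singleton [T1Space X] (x : X) : IsAcyclic F ({x} : Set X) := by
  rintro (_ | n)
  · rintro z ⟨hz, hzc⟩
    obtain ⟨u, hu, rfl⟩ := chainsIn_finite (Set.finite_singleton x) hz
    obtain ⟨a, rfl⟩ := (Finsupp.support_subset_singleton' (f := u) (a := x)).1
      (fun y hy => Finset.mem_singleton.2 (hu hy))
    rw [constMap_single] at hzc ⊢
    have : a = 0 := by
      have h : augmentation F X _ = 0 := hzc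
      simpa using h
    rw [this, Finsupp.single_zero]
    exact Submodule.zero_mem _
  · exact reducedCyclesIn_succ_le_of_finite (Set.finite_singleton x)

theorem hasSphereHomology_pair [T1Space X] {x y : X} (hxy : x ≠ y) :
    HasSphereHomology ({x, y} : Set X) 0 (pointChain F x - pointChain F y) where
  mem := ⟨Submodule.sub_mem _ (pointChain_mem (by simp)) (pointChain_mem (by simp)),
    LinearMap.mem_ker.2 (by simp)⟩
  notMem := by
    rintro ⟨e, he, hb⟩
    obtain ⟨u, -, rfl⟩ := chainsIn_finite (Set.toFinite _) he
    -- The `1`-chains here are constant and have zero boundary, so the difference of the two points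
    -- would vanish as a chain.
    rw [boundary_constMap, if_pos (by decide)] at hb
    refine hxy (Finsupp.single_left_injective (one_ne_zero (α := F)) ?_)
    refine constMap_injective (F := F) (n := 0) ?_
    rw [constMap_single, constMap_single]
    exact (sub_eq_zero.1 hb.symm)
  le_of_ne k hk := by
    obtain ⟨k, rfl⟩ := Nat.exists_eq_succ_of_ne_zero hk
    exact reducedCyclesIn_succ_le_of_finite (Set.toFinite _)
  exists_sub_mem := by
    rintro z ⟨hz, hzc⟩
    obtain ⟨u, hu, rfl⟩ := chainsIn_finite (Set.toFinite _) hz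
    classical
    have hu' : u = Finsupp.single x (u x) + Finsupp.single y (u y) := by
      ext w
      by_cases hwx : w = x
      · subst hwx
        simp [hxy.symm]
      · by_cases hwy : w = y
        · subst hwy
          simp [hxy]
        · have : w ∉ u.support := fun hw => by
            rcases hu hw with h | h
            exacts [hwx h, hwy h]
          simp [Ne.symm hwx, Ne.symm hwy, Finsupp.notMem_support_iff.1 this]
    refine ⟨u x, ?_⟩
    have haug : u x + u y = 0 := by
      have h : augmentation F X (constMap F X 0 u) = 0 := hzc
      rw [hu', map_add, map_add, constMap_single, constMap_single] at h
      simpa using h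
    rw [hu', map_add, constMap_single, constMap_single, eq_neg_of_add_eq_zero_right haug]
    simp only [pointChain, smul_sub, Finsupp.smul_single, smul_eq_mul, mul_one]
    convert! Submodule.zero_mem _ using 1
    simp [hxy.symm]

end SphereHomology

/-! ### Criteria for barcodes -/

namespace ChainFiltration

variable {F : Type*} [Field F] {X : Type*} [TopologicalSpace X] {𝓕 : ChainFiltration F X} {k : ℕ}

theorem homologyClass_eq_zero_iff {r : EReal} {α : SingularChain F X k} (h : α ∈ 𝓕.cycles r k) :
    𝓕.homologyClass r k α h = 0 ↔ α ∈ 𝓕.boundaries r k := by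
  rw [homologyClass, Submodule.Quotient.mk_eq_zero]
  rfl

theorem sum_smul_homologyClass {r : EReal} {ι : Type*} [Fintype ι] {α : ι → SingularChain F X k}
    (h : ∀ j, α j ∈ 𝓕.cycles r k) (g : ι → F) :
    ∑ j, g j • 𝓕.homologyClass r k (α j) (h j) =
      𝓕.homologyClass r k (∑ j, g j • α j)
        (Submodule.sum_mem _ fun j _ => Submodule.smul_mem _ _ (h j)) := by
  change ∑ j, g j • Submodule.mkQ _ (⟨α j, h j⟩ : 𝓕.cycles r k) = Submodule.mkQ _ _
  simp only [← map_smul, ← map_sum]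
  congr 1
  ext1
  simp

/-- A criterion for a finite family of cycles and intervals to be a barcode. -/
theorem hasBettiBarcode_of {ι : Type*} [Fintype ι] {J : ι → Set EReal}
    (α : ι → SingularChain F X k) (hinj : Function.Injective α)
    (hcyc : ∀ j, α j ∈ singularCycles F X k) (hord : ∀ j, (J j).OrdConnected)
    (hmem : ∀ j, ∀ r ∈ J j, α j ∈ 𝓕.cycles r k)
    (hoff : ∀ j r, r ∉ J j → α j ∈ 𝓕.cycles r k → α j ∈ 𝓕.boundaries r k)
    (hind : ∀ r, ∀ g : ι → F, (∀ j, r ∉ J j → g j = 0) →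
      ∑ j, g j • α j ∈ 𝓕.boundaries r k → ∀ j, g j = 0)
    (hspan : ∀ r, ∀ z ∈ 𝓕.cycles r k, ∃ g : ι → F, (∀ j, r ∉ J j → g j = 0) ∧
      z - ∑ j, g j • α j ∈ 𝓕.boundaries r k) :
    𝓕.HasBettiBarcode k J := by
  classical
  have hsub : ∀ j, J j ⊆ 𝓕.homologyInterval k (α j) := by
    refine fun j r hr => ⟨hmem j r hr, fun hb => ?_⟩
    -- Independence applied to a single basis coefficient shows that the cycle is not a boundary
    -- within its interval. The reverse inclusion of intervals is `hoff`.
    have := hind r (Pi.single j 1) (fun i hi => by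
      rw [Pi.single_eq_of_ne]
      rintro rfl
      exact hi hr) (by simpa [Pi.single_apply] using hb) j
    simp at this
  have hsum : ∀ r (g : ι → F), (∀ j, r ∉ J j → g j = 0) →
      ∑ j, g j • α j = ∑ j : {j // r ∈ J j}, g j • α j := by
    intro r g hg
    rw [← Finset.sum_subtype (Finset.univ.filter fun j => r ∈ J j) (by simp)
      (fun j => g j • α j), Finset.sum_filter_of_ne]
    intro j _ hj
    by_contra h
    exact hj (by rw [hg j h, zero_smul])
  refine ⟨α, ⟨hinj, hcyc, hord, hsub, fun r => ?_, fun r => ?_⟩, fun j => ?_⟩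
  · rw [Fintype.linearIndependent_iff]
    intro g hg
    rw [sum_smul_homologyClass, homologyClass_eq_zero_iff] at hg
    let g' : ι → F := fun j => if h : r ∈ J j then g ⟨j, h⟩ else 0
    have hg' : ∀ j : {j // r ∈ J j}, g' j = g j := fun j => by simp [g', j.2]
    have := hind r g' (fun j hj => by simp [g', hj]) (by
      rw [hsum r g' fun j hj => by simp [g', hj]]
      simpa only [hg'] using hg)
    exact fun j => (hg' j).symm.trans (this j)
  · rw [eq_top_iff]
    rintro x -
    obtain ⟨⟨z, hz⟩, rfl⟩ := Submodule.Quotient.mk_surjective _ x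
    obtain ⟨g, hg, hb⟩ := hspan r z hz
    rw [hsum r g hg] at hb
    have hz' : ∑ j : {j // r ∈ J j}, g j • α j ∈ 𝓕.cycles r k :=
      Submodule.sum_mem _ fun j _ => Submodule.smul_mem _ _ (hmem j r j.2)
    have : (Submodule.Quotient.mk ⟨z, hz⟩ : 𝓕.Homology r k) = 𝓕.homologyClass r k _ hz' :=
      (Submodule.Quotient.eq _).2 hb
    rw [this, ← sum_smul_homologyClass (fun j : {j // r ∈ J j} => hmem j r j.2)]
    exact Submodule.sum_mem _ fun j _ => Submodule.smul_mem _ _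
      (Submodule.subset_span ⟨j, rfl⟩)
  · refine (hsub j).antisymm fun r hr => ?_
    by_contra h
    exact hr.2 (hoff j r h hr.1)

theorem hasBettiBarcode_empty (h : ∀ r, 𝓕.cycles r k ≤ 𝓕.boundaries r k) :
    𝓕.HasBettiBarcode k ![] :=
  hasBettiBarcode_of (fun j : Fin 0 => j.elim0) (fun j => j.elim0) (fun j => j.elim0)
    (fun j => j.elim0) (fun j => j.elim0) (fun j => j.elim0) (fun _ _ _ _ j => j.elim0)
    fun r z hz => ⟨0, fun j => j.elim0, by simpa using h r hz⟩

theorem hasBettiBarcode_single {J : Set EReal} (hJ : J.OrdConnected) (α : SingularChain F X k)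
    (hα : α ∈ singularCycles F X k)
    (hon : ∀ r ∈ J, α ∈ 𝓕.cycles r k ∧ α ∉ 𝓕.boundaries r k ∧
      ∀ z ∈ 𝓕.cycles r k, ∃ a : F, z - a • α ∈ 𝓕.boundaries r k)
    (hoff : ∀ r, r ∉ J → 𝓕.cycles r k ≤ 𝓕.boundaries r k) :
    𝓕.HasBettiBarcode k ![J] := by
  refine hasBettiBarcode_of ![α] (Function.injective_of_subsingleton _) ?_ ?_ ?_ ?_ ?_ ?_
  · simpa using hα
  · simpa using hJ
  · simpa using fun r hr => (hon r hr).1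
  · simpa using fun r hr h => hoff r hr h
  · intro r g hg hb
    simp only [Fin.forall_fin_one, Matrix.cons_val_zero, Fin.sum_univ_one] at hg hb ⊢
    by_contra h0
    by_cases hr : r ∈ J
    · exact (hon r hr).2.1 ((Submodule.smul_mem_iff _ h0).1 hb)
    · exact h0 (hg hr)
  · intro r z hz
    by_cases hr : r ∈ J
    · obtain ⟨a, ha⟩ := (hon r hr).2.2 z hz
      exact ⟨fun _ => a, by simp [hr], by simpa using ha⟩
    · exact ⟨0, by simp, by simpa using hoff r hr hz⟩

/-- In degree `k`, the filtration has the same homology as the family of sets `A`. -/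
structure ComputesHomology (𝓕 : ChainFiltration F X) (A : EReal → Set X) (k : ℕ) : Prop where
  le : ∀ r, reducedCyclesIn F (A r) k ≤ 𝓕.cycles r k
  boundariesIn_le : ∀ r, boundariesIn F (A r) k ≤ 𝓕.boundaries r k
  mem_boundariesIn : ∀ r, ∀ z ∈ chainsIn F (A r) k, z ∈ 𝓕.boundaries r k →
    z ∈ boundariesIn F (A r) k
  exists_sub_mem : ∀ r, ∀ z ∈ 𝓕.cycles r k, ∃ z' ∈ reducedCyclesIn F (A r) k,
    z - z' ∈ 𝓕.boundaries r k

/-- Only positive degrees are covered, where ordinary and reduced cycles coincide. -/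
theorem computesHomology_of_part {A : EReal → Set X}
    (h : ∀ r j, 𝓕.part r j = chainsIn F (A r) j) (k : ℕ) : 𝓕.ComputesHomology A (k + 1) where
  le r := by rw [cycles, h]; exact le_rfl
  boundariesIn_le r := by rw [boundaries, h]
  mem_boundariesIn r z _ hz := by rwa [boundaries, h] at hz
  exists_sub_mem r z hz := ⟨z, by rw [cycles, h] at hz; exact hz, by simp⟩

end ChainFiltration

/-! ### Families of sets with the homology of spheres -/

section SphereFamily

variable {F : Type*} [Field F] {X : Type*} [TopologicalSpace X] {p : ℕ}

/-- The levels between the `n`-th threshold and the later ones. -/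
def levelsAt (c : Fin p → EReal) (n : Fin p) : Set EReal :=
  {r | c n ≤ r ∧ ∀ m, n < m → r < c m}

theorem levelsAt_eq_Ico {c : Fin p → EReal} (hc : StrictMono c) {n n' : Fin p}
    (h : (n : ℕ) + 1 = n') : levelsAt c n = Set.Ico (c n) (c n') := by
  ext r
  refine ⟨fun hr => ⟨hr.1, hr.2 n' (Fin.lt_def.2 (by omega))⟩, fun hr => ⟨hr.1, fun m hm => ?_⟩⟩
  exact hr.2.trans_le (hc.monotone (Fin.le_def.2 (by have := Fin.lt_def.1 hm; omega)))

theorem levelsAt_eq_Icc {c : Fin p → EReal} {n : Fin p} (h : (n : ℕ) + 1 = p) :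
    levelsAt c n = Set.Icc (c n) ⊤ := by
  ext r
  refine ⟨fun hr => ⟨hr.1, le_top⟩, fun hr => ⟨hr.1, fun m hm => ?_⟩⟩
  have := Fin.lt_def.1 hm
  omega

theorem exists_mem_levelsAt (c : Fin p → EReal) {i : Fin p} {r : EReal} (h : c i ≤ r) :
    ∃ n, r ∈ levelsAt c n := by
  classical
  obtain ⟨n, hn, hmax⟩ := (Finset.univ.filter fun n => c n ≤ r).exists_max_image id
    ⟨i, by simpa using h⟩
  refine ⟨n, by simpa using hn, fun m hm => ?_⟩
  by_contra hlt
  exact absurd (hmax m (by simpa using not_lt.1 hlt)) (not_le.2 hm)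

/-- The family of sets `A` starts empty and has, from the threshold `c n` until the next one, the
homology of the `n`-sphere, generated by the class of `α n`. -/
structure IsSphereFamily (A : EReal → Set X) (c : Fin p → EReal)
    (α : ∀ n : Fin p, SingularChain F X n) : Prop where
  strictMono : StrictMono c
  sphere : ∀ n, ∀ r ∈ levelsAt c n, HasSphereHomology (A r) (n : ℕ) (α n)
  empty : ∀ r, (∀ n, r ∉ levelsAt c n) → A r = ∅
  nonempty : ∀ n, (levelsAt c n).Nonempty

variable {A : EReal → Set X} {c : Fin p → EReal} {α : ∀ n : Fin p, SingularChain F X n}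

theorem IsSphereFamily.reducedCyclesIn_le (h : IsSphereFamily A c α) {r : EReal} {k : ℕ}
    (hr : ∀ n : Fin p, r ∈ levelsAt c n → k ≠ n) :
    reducedCyclesIn F (A r) k ≤ boundariesIn F (A r) k := by
  by_cases hn : ∃ n, r ∈ levelsAt c n
  · obtain ⟨n, hn⟩ := hn
    exact (h.sphere n r hn).le_of_ne k (hr n hn)
  · rw [h.empty r fun n hn' => hn ⟨n, hn'⟩]
    refine inf_le_left.trans ?_
    rw [chainsIn_empty]
    exact bot_le

theorem IsSphereFamily.cycles_le (h : IsSphereFamily A c α) {𝓕 : ChainFiltration F X} {r : EReal}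
    {k : ℕ} (hF : 𝓕.ComputesHomology A k) (hr : ∀ n : Fin p, r ∈ levelsAt c n → k ≠ n) :
    𝓕.cycles r k ≤ 𝓕.boundaries r k := fun z hz => by
  obtain ⟨z', hz', hb⟩ := hF.exists_sub_mem r z hz
  exact (Submodule.sub_mem_iff_left _
    (hF.boundariesIn_le r (h.reducedCyclesIn_le hr hz'))).1 hb

theorem IsSphereFamily.hasBettiBarcode_of_le (h : IsSphereFamily A c α) {𝓕 : ChainFiltration F X}
    {k : ℕ} (hF : 𝓕.ComputesHomology A k) (hk : p ≤ k) : 𝓕.HasBettiBarcode k ![] :=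
  ChainFiltration.hasBettiBarcode_empty fun _ => h.cycles_le hF fun n _ => by omega

theorem ordConnected_levelsAt (c : Fin p → EReal) (n : Fin p) : (levelsAt c n).OrdConnected :=
  ⟨fun _ hx _ hy _ hz => ⟨hx.1.trans hz.1, fun m hm => hz.2.trans_lt (hy.2 m hm)⟩⟩

theorem IsSphereFamily.hasBettiBarcode (h : IsSphereFamily A c α) {𝓕 : ChainFiltration F X}
    (n : Fin p) (hF : 𝓕.ComputesHomology A n) :
    𝓕.HasBettiBarcode n ![levelsAt c n] := by
  refine ChainFiltration.hasBettiBarcode_single (ordConnected_levelsAt c n) (α n) ?_ ?_ ?_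
  · obtain ⟨r, hr⟩ := h.nonempty n
    exact (hF.le r (h.sphere n r hr).mem).2
  · intro r hr
    have hs := h.sphere n r hr
    refine ⟨hF.le r hs.mem, fun hb => hs.notMem (hF.mem_boundariesIn r _ hs.mem.1 hb), ?_⟩
    intro z hz
    obtain ⟨z', hz', hb⟩ := hF.exists_sub_mem r z hz
    obtain ⟨a, ha⟩ := hs.exists_sub_mem z' hz'
    refine ⟨a, ?_⟩
    convert! Submodule.add_mem _ hb (hF.boundariesIn_le r ha) using 1
    abel
  · exact fun r hr => h.cycles_le hF fun m hm hnm => hr (by rwa [Fin.ext hnm])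

/-- The class of a point `x` splits ordinary degree `0` homology as the augmentation plus reduced
homology. The point `x` carries the infinite bar; the difference `x - y` generates the reduced part
while the set looks like a `0`-sphere and bounds afterwards. -/
theorem IsSphereFamily.hasBettiBarcode_zero (h : IsSphereFamily A c α) {𝓕 : ChainFiltration F X}
    (hF : ∀ r k, 𝓕.part r k = chainsIn F (A r) k) (n : Fin p) (hn : (n : ℕ) = 0) {x y : X}
    (hα : ∀ r ∈ levelsAt c n, HasSphereHomology (A r) 0 (pointChain F x - pointChain F y))
    (hx : ∀ r, c n ≤ r → x ∈ A r) (hy : ∀ r, c n ≤ r → y ∈ A r) :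
    𝓕.HasBettiBarcode 0 ![Set.Icc (c n) ⊤, levelsAt c n] := by
  have hcyc : ∀ r, 𝓕.cycles r 0 = chainsIn F (A r) 0 := fun r => by
    rw [ChainFiltration.cycles, hF]
    exact inf_top_eq _
  have hbd : ∀ r, 𝓕.boundaries r 0 = boundariesIn F (A r) 0 := fun r => by
    rw [ChainFiltration.boundaries, hF]
  have haug : ∀ r, ∀ z ∈ boundariesIn F (A r) 0, augmentation F X z = 0 := fun r z hz =>
    boundariesIn_le_reducedCycles hz
  have hsub : ∀ r, r ∈ levelsAt c n → c n ≤ r := fun r hr => hr.1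
  have hempty : ∀ r, ¬ c n ≤ r → A r = ∅ := fun r hr => h.empty r fun m hm =>
    hr ((h.strictMono.monotone (Fin.le_def.2 (by omega))).trans hm.1)
  have hred : ∀ r, c n ≤ r → ∀ z ∈ chainsIn F (A r) 0,
      z - augmentation F X z • pointChain F x ∈ reducedCyclesIn F (A r) 0 := fun r hr z hz =>
    ⟨Submodule.sub_mem _ hz (Submodule.smul_mem _ _ (pointChain_mem (hx r hr))),
      LinearMap.mem_ker.2 (by simp)⟩
  have hlate : ∀ r, r ∉ levelsAt c n → reducedCyclesIn F (A r) 0 ≤ boundariesIn F (A r) 0 :=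
    fun r hr => h.reducedCyclesIn_le fun m hm h0 => hr (by rwa [← Fin.ext (hn.trans h0)] at hm)
  refine ChainFiltration.hasBettiBarcode_of ![pointChain F x, pointChain F x - pointChain F y]
    ?_ (fun j => Submodule.mem_top) ?_ ?_ ?_ ?_ ?_
  · intro i j hij
    have h0 := congrArg (augmentation F X) hij
    fin_cases i <;> fin_cases j <;> simp at h0 ⊢
  · simp only [Fin.forall_fin_two, Matrix.cons_val_zero, Matrix.cons_val_one]
    exact ⟨Set.ordConnected_Icc, ordConnected_levelsAt c n⟩
  · simp only [Fin.forall_fin_two, Matrix.cons_val_zero, Matrix.cons_val_one, hcyc]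
    exact ⟨fun r hr => pointChain_mem (hx r hr.1), fun r hr =>
      Submodule.sub_mem _ (pointChain_mem (hx r hr.1)) (pointChain_mem (hy r hr.1))⟩
  · simp only [Fin.forall_fin_two, Matrix.cons_val_zero, Matrix.cons_val_one, hcyc, hbd]
    refine ⟨fun r hr hm => ?_, fun r hr hm => hlate r hr ⟨hm, LinearMap.mem_ker.2 (by simp)⟩⟩
    rw [hempty r fun h => hr ⟨h, le_top⟩, chainsIn_empty] at hm
    rw [(Submodule.mem_bot F).1 hm]
    exact Submodule.zero_mem _
  · intro r g
    simp only [Fin.forall_fin_two, Matrix.cons_val_zero, Matrix.cons_val_one, hbd,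
      Fin.sum_univ_two]
    intro hg hb
    -- Boundaries have augmentation zero while `x` has augmentation one, which isolates the
    -- coefficient of `x`.
    have h0 := haug r _ hb
    simp only [map_add, map_smul, map_sub, augmentation_pointChain, sub_self, smul_eq_mul,
      mul_one, mul_zero, add_zero] at h0
    rw [h0, zero_smul, zero_add] at hb
    refine ⟨h0, ?_⟩
    by_contra h1
    by_cases hr : r ∈ levelsAt c n
    · exact (hα r hr).notMem ((Submodule.smul_mem_iff _ h1).1 hb)
    · exact h1 (hg.2 hr)
  · intro r z
    simp only [Fin.forall_fin_two, Matrix.cons_val_zero, Matrix.cons_val_one, hbd, hcyc,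
      Fin.sum_univ_two]
    intro hz
    by_cases hr : c n ≤ r
    · by_cases hr' : r ∈ levelsAt c n
      · obtain ⟨a, ha⟩ := (hα r hr').exists_sub_mem _ (hred r hr z hz)
        exact ⟨![augmentation F X z, a], by simp [hr, hr'],
          by simpa [sub_sub] using ha⟩
      · exact ⟨![augmentation F X z, 0], by simp [hr],
          by simpa using hlate r hr' (hred r hr z hz)⟩
    · refine ⟨0, by simp, ?_⟩
      rw [hempty r hr, chainsIn_empty] at hz
      rw [(Submodule.mem_bot F).1 hz]
      simp

end SphereFamily

/-! ### The Čech filtration -/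

section Cech

variable {F : Type*} [Field F] {X : Type*} [TopologicalSpace X]

theorem constChains_le (k : ℕ) : constChains F X k ≤ LinearMap.range (constMap F X k) := by
  refine Submodule.span_le.2 ?_
  rintro _ ⟨x, rfl⟩
  exact ⟨Finsupp.single x 1, constMap_single x 1⟩

theorem constMap_mem_constChains {k : ℕ} (u : X →₀ F) : constMap F X k u ∈ constChains F X k := by
  refine map_mem_of_mem_supported (s := Set.univ) (constMap F X k) _ (fun x _ => ?_)
    (by simp [Finsupp.supported_univ])
  rw [constMap_single]
  exact Submodule.subset_span ⟨x, rfl⟩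

/-- A chain of `Const + C(A)` is the sum of constant simplices off `A` and a chain of `A`. -/
theorem exists_constMap_add {A : Set X} {k : ℕ} {z : SingularChain F X k}
    (hz : z ∈ constChains F X k ⊔ chainsIn F A k) :
    ∃ u ∈ Finsupp.supported F F Aᶜ, ∃ y ∈ chainsIn F A k, constMap F X k u + y = z := by
  classical
  obtain ⟨c, hc, y, hy, rfl⟩ := Submodule.mem_sup.1 hz
  obtain ⟨u, rfl⟩ := constChains_le k hc
  refine ⟨u.filter (· ∈ Aᶜ), ?_, constMap F X k (u.filter fun x => ¬ x ∈ Aᶜ) + y, ?_, ?_⟩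
  · intro x hx
    simp only [Finset.mem_coe, Finsupp.support_filter, Finset.mem_filter] at hx
    exact hx.2
  · refine Submodule.add_mem _ ((constMap_mem_chainsIn_iff _).2 fun x hx => ?_) hy
    simp only [Finset.mem_coe, Finsupp.support_filter, Finset.mem_filter, Set.mem_compl_iff,
      not_not] at hx
    exact hx.2
  · rw [← add_assoc, ← map_add, Finsupp.filter_add_filter_not]

theorem eq_zero_of_constMap_mem {A : Set X} {k : ℕ} {u : X →₀ F}
    (hu : u ∈ Finsupp.supported F F Aᶜ) (h : constMap F X k u ∈ chainsIn F A k) : u = 0 := by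
  have := Submodule.mem_inf.2 ⟨(constMap_mem_chainsIn_iff u).1 h, hu⟩
  rwa [← Finsupp.supported_inter, Set.inter_compl_self, Finsupp.supported_empty,
    Submodule.mem_bot] at this

theorem cechFiltration_part_succ_of_not_lt (f : X → ℝ) {r : EReal} (hr : ¬ r < 0) (k : ℕ) :
    (cechFiltration F f).part r (k + 1) = constChains F X (k + 1) ⊔
      chainsIn F (superlevel f (r.toENNReal)⁻¹) (k + 1) := by
  simp [cechFiltration, cechPart, hr]

theorem cechFiltration_part_of_lt (f : X → ℝ) {r : EReal} (hr : r < 0) (k : ℕ) :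
    (cechFiltration F f).part r k = ⊥ := by
  cases k <;> simp [cechFiltration, cechPart, hr]

theorem superlevel_of_lt {X : Type*} (f : X → ℝ) {r : EReal} (hr : r < 0) :
    superlevel f (r.toENNReal)⁻¹ = ∅ := by
  ext x
  simp [superlevel, EReal.toENNReal_of_nonpos hr.le]

theorem chainsIn_le_cechFiltration_part (f : X → ℝ) (r : EReal) (k : ℕ) :
    chainsIn F (superlevel f (r.toENNReal)⁻¹) k ≤ (cechFiltration F f).part r k := by
  by_cases hr : r < 0
  · rw [superlevel_of_lt f hr, chainsIn_empty]
    exact bot_le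
  · cases k with
    | zero => simp [cechFiltration, cechPart, hr]
    | succ k =>
      rw [cechFiltration_part_succ_of_not_lt f hr]
      exact le_sup_right

/-- After moving constants in the superlevel set into the second summand, the remaining constants
are supported off it. Boundaries of the two parts then cannot cancel, so the constant part of a
cycle is itself a cycle, and constant cycles of positive degree bound constants. -/
theorem cechFiltration_computesHomology (f : X → ℝ) (k : ℕ) :
    (cechFiltration F f).ComputesHomology (fun r => superlevel f (r.toENNReal)⁻¹) (k + 1) where
  le r := inf_le_inf_right _ (chainsIn_le_cechFiltration_part f r _)
  boundariesIn_le r := Submodule.map_mono (chainsIn_le_cechFiltration_part f r _)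
  mem_boundariesIn r z hz hb := by
    obtain ⟨e, he, rfl⟩ := hb
    by_cases hr : r < 0
    · rw [cechFiltration_part_of_lt f hr] at he
      rw [(Submodule.mem_bot F).1 he, map_zero]
      exact Submodule.zero_mem _
    · rw [cechFiltration_part_succ_of_not_lt f hr] at he
      obtain ⟨u, hu, y, hy, rfl⟩ := exists_constMap_add he
      -- The constant part can be discarded: its boundary is either zero or consists of the same
      -- constants off the superlevel set, which cannot occur in a chain inside that set.
      refine ⟨y, hy, ?_⟩
      rw [map_add, boundary_constMap] at hz ⊢
      split_ifs at hz ⊢ with hk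
      · rw [zero_add]
      · rw [eq_zero_of_constMap_mem hu
          ((Submodule.add_mem_iff_left _ (boundary_mem_chainsIn F _ _ hy)).1 hz), map_zero, zero_add]
  exists_sub_mem r z hz := by
    by_cases hr : r < 0
    · rw [ChainFiltration.cycles, cechFiltration_part_of_lt f hr, bot_inf_eq] at hz
      rw [(Submodule.mem_bot F).1 hz]
      exact ⟨0, Submodule.zero_mem _, by simp⟩
    · obtain ⟨hz1, hz2⟩ := hz
      rw [cechFiltration_part_succ_of_not_lt f hr] at hz1
      obtain ⟨u, hu, y, hy, rfl⟩ := exists_constMap_add hz1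
      have hsum : boundary F X k (constMap F X (k + 1) u) + boundary F X k y = 0 := by
        rw [← map_add]
        exact hz2
      have hu0 : boundary F X k (constMap F X (k + 1) u) = 0 := by
        have hmem : boundary F X k (constMap F X (k + 1) u) ∈
            chainsIn F (superlevel f (r.toENNReal)⁻¹) k := by
          rw [eq_neg_of_add_eq_zero_left hsum]
          exact Submodule.neg_mem _ (boundary_mem_chainsIn F _ _ hy)
        rw [boundary_constMap] at hmem ⊢
        split_ifs at hmem ⊢ with hk
        · rfl
        · rw [eq_zero_of_constMap_mem hu hmem, map_zero]
      refine ⟨y, ⟨hy, LinearMap.mem_ker.2 (by rwa [hu0, zero_add] at hsum)⟩,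
        constMap F X (k + 2) u, ?_, ?_⟩
      · rw [SetLike.mem_coe, cechFiltration_part_succ_of_not_lt f hr]
        exact Submodule.mem_sup_left (constMap_mem_constChains u)
      · rw [exists_boundary_constMap hu0, add_sub_cancel_right]

end Cech

/-! ### Conic subsets of the sphere in orthonormal coordinates -/

section Cone

variable {p : ℕ} (b : OrthonormalBasis (Fin p) ℝ (EuclideanSpace ℝ (Fin p)))

/-- The coordinates of a point of the sphere. -/
def sphereCoord (x : UnitSphere p) (i : Fin p) : ℝ :=
  inner ℝ (b i) (x : EuclideanSpace ℝ (Fin p))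

/-- The vector with given coordinates. -/
def ofCoord (y : Fin p → ℝ) : EuclideanSpace ℝ (Fin p) := ∑ i, y i • b i

/-- The vectors of the basis, as points of the sphere. -/
def basisPoint (i : Fin p) : UnitSphere p := ⟨b i, by simp⟩

/-- The points of the sphere whose coordinates satisfy `P`. -/
def coneSet (P : (Fin p → ℝ) → Prop) : Set (UnitSphere p) := {x | P (sphereCoord b x)}

theorem ofCoord_sphereCoord (x : UnitSphere p) : ofCoord b (sphereCoord b x) = x :=
  b.sum_repr' _

theorem inner_ofCoord (y : Fin p → ℝ) (i : Fin p) : inner ℝ (b i) (ofCoord b y) = y i := by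
  simp [ofCoord, inner_sum, inner_smul_right, b.inner_eq_ite]

theorem ofCoord_ne_zero {y : Fin p → ℝ} (hy : y ≠ 0) : ofCoord b y ≠ 0 := by
  contrapose! hy
  ext i
  rw [← inner_ofCoord b y i, hy, inner_zero_right, Pi.zero_apply]

theorem norm_ofCoord_sq (y : Fin p → ℝ) : ‖ofCoord b y‖ ^ 2 = ∑ i, y i ^ 2 := by
  rw [← b.sum_sq_norm_inner_right]
  simp [inner_ofCoord]

theorem sum_sphereCoord_sq (x : UnitSphere p) : ∑ i, sphereCoord b x i ^ 2 = 1 := by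
  rw [← norm_ofCoord_sq b, ofCoord_sphereCoord]
  simp

theorem sphereCoord_ne_zero (x : UnitSphere p) : sphereCoord b x ≠ 0 := by
  intro h
  have := sum_sphereCoord_sq b x
  simp [h] at this

@[fun_prop]
theorem continuous_ofCoord : Continuous (ofCoord b) := by
  unfold ofCoord
  fun_prop

@[fun_prop]
theorem continuous_sphereCoord (i : Fin p) : Continuous fun x => sphereCoord b x i := by
  unfold sphereCoord
  fun_prop

theorem continuous_sphereCoord_pi : Continuous (sphereCoord b) :=
  continuous_pi fun i => continuous_sphereCoord b i

theorem sphereCoord_basisPoint (i j : Fin p) :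
    sphereCoord b (basisPoint b i) j = if j = i then 1 else 0 := by
  simp [sphereCoord, basisPoint, b.inner_eq_ite]

theorem sphereCoord_injective : Function.Injective (sphereCoord b) := fun x y h => by
  ext1
  rw [← ofCoord_sphereCoord b x, h, ofCoord_sphereCoord]

theorem sphereCoord_neg (x : UnitSphere p) (i : Fin p) :
    sphereCoord b (-x) i = -sphereCoord b x i := by
  simp [sphereCoord]

/-- The point of the sphere in a given direction. -/
def direction (y : Fin p → ℝ) (hy : y ≠ 0) : UnitSphere p :=
  ⟨‖ofCoord b y‖⁻¹ • ofCoord b y, by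
    rw [mem_sphere_zero_iff_norm, norm_smul, norm_inv, norm_norm,
      inv_mul_cancel₀ (norm_ne_zero_iff.2 (ofCoord_ne_zero b hy))]⟩

theorem sphereCoord_direction (y : Fin p → ℝ) (hy : y ≠ 0) :
    sphereCoord b (direction b y hy) = ‖ofCoord b y‖⁻¹ • y := by
  ext i
  simp only [sphereCoord, direction, inner_smul_right, inner_ofCoord, Pi.smul_apply, smul_eq_mul]

theorem direction_sphereCoord (x : UnitSphere p) {y : Fin p → ℝ} (hy : y ≠ 0)
    (h : y = sphereCoord b x) : direction b y hy = x := by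
  subst h
  ext1
  simp [direction, ofCoord_sphereCoord]

/-- A linear homotopy, normalized, is a strong deformation retraction of conic subsets. -/
theorem isStrongDeformationRetract_coneSet {P Q : (Fin p → ℝ) → Prop}
    (g : (Fin p → ℝ) → Fin p → ℝ) (hg : Continuous g)
    (hPc : ∀ a : ℝ, 0 < a → ∀ y, P y → P (a • y)) (hQc : ∀ a : ℝ, 0 < a → ∀ y, Q y → Q (a • y))
    (hPQ : ∀ y, y ≠ 0 → P y → Q y) (hfix : ∀ y, P y → g y = y)
    (hgP : ∀ y, y ≠ 0 → Q y → P (g y))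
    (hQ : ∀ y, y ≠ 0 → Q y → ∀ t : ℝ, 0 ≤ t → t ≤ 1 →
      (1 - t) • y + t • g y ≠ 0 ∧ Q ((1 - t) • y + t • g y)) :
    IsStrongDeformationRetract (coneSet b P) (coneSet b Q) := by
  let mid : unitInterval × coneSet b Q → Fin p → ℝ := fun z =>
    (1 - (z.1 : ℝ)) • sphereCoord b z.2 + (z.1 : ℝ) • g (sphereCoord b z.2)
  have hmid : ∀ z, mid z ≠ 0 ∧ Q (mid z) := fun z =>
    hQ _ (sphereCoord_ne_zero b z.2) z.2.2 z.1 z.1.2.1 z.1.2.2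
  have hcont : Continuous mid := by
    have h1 : Continuous fun z : unitInterval × coneSet b Q => sphereCoord b z.2 :=
      (continuous_sphereCoord_pi b).comp (continuous_subtype_val.comp continuous_snd)
    have h2 := hg.comp h1
    exact ((continuous_const.sub (continuous_subtype_val.comp continuous_fst)).smul h1).add
      ((continuous_subtype_val.comp continuous_fst).smul h2)
  have hpos : ∀ z, 0 < ‖ofCoord b (mid z)‖⁻¹ := fun z =>
    inv_pos.2 (norm_pos_iff.2 (ofCoord_ne_zero b (hmid z).1))
  let H : C(unitInterval × coneSet b Q, coneSet b Q) :=
    ⟨fun z => ⟨direction b (mid z) (hmid z).1, by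
      rw [coneSet, Set.mem_ofPred_eq, sphereCoord_direction]
      exact hQc _ (hpos z) _ (hmid z).2⟩, by
      refine Continuous.subtype_mk (Continuous.subtype_mk ?_ _) _
      have h3 : Continuous fun z => ofCoord b (mid z) := (continuous_ofCoord b).comp hcont
      exact (h3.norm.inv₀ fun z => norm_ne_zero_iff.2 (ofCoord_ne_zero b (hmid z).1)).smul h3⟩
  refine ⟨fun x hx => hPQ _ (sphereCoord_ne_zero b x) hx, H, fun x => ?_, fun x => ?_,
    fun t x hx => ?_⟩
  · exact Subtype.ext (direction_sphereCoord b x (hmid (0, x)).1 (by simp [mid]))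
  · rw [coneSet, Set.mem_ofPred_eq]
    change P (sphereCoord b (direction b (mid (1, x)) (hmid (1, x)).1))
    rw [sphereCoord_direction]
    refine hPc _ (hpos _) _ ?_
    have : mid (1, x) = g (sphereCoord b x) := by simp [mid]
    rw [this]
    exact hgP _ (sphereCoord_ne_zero b x) x.2
  · refine Subtype.ext (direction_sphereCoord b x (hmid (t, x)).1 ?_)
    simp only [mid]
    rw [hfix _ hx, ← add_smul, sub_add_cancel, one_smul]

theorem subsphere_eq_coneSet (n : Fin p) :
    subsphere (basisPoint b) n = coneSet b fun y => ∀ m, n < m → y m = 0 := rfl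

/-- Projection to a subsphere, under conditions on the set to be retracted. -/
theorem isStrongDeformationRetract_subsphere (n : Fin p) {Q : (Fin p → ℝ) → Prop}
    (hQc : ∀ a : ℝ, 0 < a → ∀ y, Q y → Q (a • y))
    (hQ0 : ∀ y, y ≠ 0 → (∀ m, n < m → y m = 0) → Q y)
    (hne : ∀ y, y ≠ 0 → Q y → ∃ i ≤ n, y i ≠ 0)
    (hscale : ∀ y, Q y → ∀ s : ℝ, 0 ≤ s → s ≤ 1 → Q fun i => if i ≤ n then y i else s * y i) :
    IsStrongDeformationRetract (subsphere (basisPoint b) n) (coneSet b Q) := by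
  rw [subsphere_eq_coneSet]
  refine isStrongDeformationRetract_coneSet b (fun y i => if i ≤ n then y i else 0) ?_ ?_ hQc hQ0
    ?_ ?_ ?_
  · refine continuous_pi fun i => ?_
    split_ifs
    · exact continuous_apply i
    · exact continuous_const
  · intro a _ y hy m hm
    rw [Pi.smul_apply, hy m hm, smul_zero]
  · intro y hy
    ext i
    split_ifs with h
    · rfl
    · exact (hy i (not_le.1 h)).symm
  · intro y _ _ m hm
    exact if_neg (not_le.2 hm)
  · intro y hy0 hy t ht0 ht1
    have heq : (1 - t) • y + t • (fun i => if i ≤ n then y i else 0) =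
        fun i => if i ≤ n then y i else (1 - t) * y i := by
      ext i
      by_cases h : i ≤ n
      · simp only [Pi.add_apply, Pi.smul_apply, smul_eq_mul, h, if_true]
        ring
      · simp [h]
    rw [heq]
    -- Coordinates up to `n` do not move, and one of them is nonzero, so the path avoids the origin
    -- and can be normalized.
    refine ⟨fun h0 => ?_, hscale y hy _ (by linarith) (by linarith)⟩
    obtain ⟨i, hi, hyi⟩ := hne y hy0 hy
    have := congrFun h0 i
    simp only [hi, if_true, Pi.zero_apply] at this
    exact hyi this

/-- A punctured subsphere retracts to the pole opposite to the puncture. -/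
theorem isStrongDeformationRetract_pole (n : Fin p) (ε : ℝ) (hε : ε * ε = 1) (x : UnitSphere p)
    (hx : sphereCoord b x = Pi.single n ε) :
    IsStrongDeformationRetract {x} (subsphere (basisPoint b) n ∩
      coneSet b fun y => 0 < ε * y n ∨ ∃ i, i ≠ n ∧ y i ≠ 0) := by
  have h1 : ({x} : Set (UnitSphere p)) =
      coneSet b fun y => (∀ i, i ≠ n → y i = 0) ∧ 0 < ε * y n := by
    ext z
    simp only [coneSet, Set.mem_singleton_iff, Set.mem_ofPred_eq]
    constructor
    · rintro rfl
      rw [hx]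
      exact ⟨fun i hi => Pi.single_eq_of_ne hi _, by simp [hε]⟩
    · rintro ⟨h0, hn⟩
      refine sphereCoord_injective b ?_
      rw [hx]
      have hsum := sum_sphereCoord_sq b z
      rw [Finset.sum_eq_single n (fun i _ hi => by rw [h0 i hi]; simp) (by simp)] at hsum
      ext i
      by_cases hi : i = n
      · subst hi
        rw [Pi.single_eq_same]
        have : (ε * sphereCoord b z i) ^ 2 = 1 ^ 2 := by rw [mul_pow, hsum, sq, hε]; norm_num
        have h2 := (pow_left_inj₀ hn.le zero_le_one two_ne_zero).1 this
        calc sphereCoord b z i = ε * (ε * sphereCoord b z i) := by rw [← mul_assoc, hε, one_mul]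
          _ = ε := by rw [h2, mul_one]
      · rw [h0 i hi, Pi.single_eq_of_ne hi]
  -- The pole is now written as the conic set of positive multiples of `ε` times the `n`-th basis
  -- vector, as the general retraction requires.
  rw [h1, subsphere_eq_coneSet]
  have h2 : coneSet b (fun y => ∀ m, n < m → y m = 0) ∩
      coneSet b (fun y => 0 < ε * y n ∨ ∃ i, i ≠ n ∧ y i ≠ 0) =
      coneSet b fun y => (∀ m, n < m → y m = 0) ∧ (0 < ε * y n ∨ ∃ i, i ≠ n ∧ y i ≠ 0) := rfl
  rw [h2]
  refine isStrongDeformationRetract_coneSet b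
    -- The target is the vector of the same length on the ray through the pole: it depends
    -- continuously on `y` and fixes the ray.
    (fun y => Pi.single n (ε * (∑ i, y i ^ 2).sqrt)) ?_ ?_ ?_ ?_ ?_ ?_ ?_
  · exact (continuous_single n).comp (by fun_prop)
  · rintro a ha y ⟨h0, hn⟩
    refine ⟨fun i hi => by simp [h0 i hi], ?_⟩
    have := mul_pos ha hn
    simp only [Pi.smul_apply, smul_eq_mul]
    linarith
  · rintro a ha y ⟨h0, hn⟩
    refine ⟨fun m hm => by simp [h0 m hm], hn.imp (fun hn => ?_) ?_⟩
    · have := mul_pos ha hn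
      simp only [Pi.smul_apply, smul_eq_mul]
      linarith
    · rintro ⟨i, hi, hyi⟩
      exact ⟨i, hi, by simpa [hyi] using ha.ne'⟩
  · exact fun y _ hy => ⟨fun m hm => hy.1 m hm.ne', Or.inl hy.2⟩
  · rintro y ⟨h0, hn⟩
    rw [Finset.sum_eq_single n (fun i _ hi => by rw [h0 i hi]; simp) (by simp)]
    have hsq : y n ^ 2 = (ε * y n) ^ 2 := by rw [mul_pow, sq ε, hε, one_mul]
    rw [hsq, Real.sqrt_sq hn.le, ← mul_assoc, hε, one_mul]
    ext i
    by_cases hi : i = n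
    · subst hi; simp
    · rw [Pi.single_eq_of_ne hi, h0 i hi]
  · rintro y hy0 -
    refine ⟨fun i hi => Pi.single_eq_of_ne hi _, ?_⟩
    rw [Pi.single_eq_same, ← mul_assoc, hε, one_mul]
    refine Real.sqrt_pos.2 ?_
    rw [← norm_ofCoord_sq b]
    exact pow_pos (norm_pos_iff.2 (ofCoord_ne_zero b hy0)) 2
  · rintro y hy0 ⟨h0, hn⟩ t ht0 ht1
    have hr : 0 < (∑ i, y i ^ 2).sqrt := by
      refine Real.sqrt_pos.2 ?_
      rw [← norm_ofCoord_sq b]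
      exact pow_pos (norm_pos_iff.2 (ofCoord_ne_zero b hy0)) 2
    set r := (∑ i, y i ^ 2).sqrt
    have hcoord : ∀ i, i ≠ n → ((1 - t) • y + t • (Pi.single n (ε * r) : Fin p → ℝ)) i =
        (1 - t) * y i := fun i hi => by
      simp [Pi.single_eq_of_ne hi]
    have hcoordn : ε * ((1 - t) • y + t • (Pi.single n (ε * r) : Fin p → ℝ)) n =
        (1 - t) * (ε * y n) + t * r := by
      simp only [Pi.add_apply, Pi.smul_apply, Pi.single_eq_same, smul_eq_mul]
      linear_combination (t * r) * hε
    have hor : 0 < ε * ((1 - t) • y + t • (Pi.single n (ε * r) : Fin p → ℝ)) n ∨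
        ∃ i, i ≠ n ∧ ((1 - t) • y + t • (Pi.single n (ε * r) : Fin p → ℝ)) i ≠ 0 := by
      -- At time `1` the path is on the ray. Earlier, either the `n`-th coordinate keeps its sign or
      -- a nonzero transverse coordinate stays nonzero; both exclude the antipodal ray and the
      -- origin.
      rcases eq_or_lt_of_le ht1 with rfl | ht1
      · left
        rw [hcoordn]
        simpa using hr
      · rcases hn with hn | ⟨i, hi, hyi⟩
        · left
          rw [hcoordn]
          have := mul_pos (sub_pos.2 ht1) hn
          positivity
        · right
          refine ⟨i, hi, ?_⟩
          rw [hcoord i hi]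
          exact mul_ne_zero (sub_pos.2 ht1).ne' hyi
    refine ⟨fun hz => ?_, fun m hm => by rw [hcoord m hm.ne', h0 m hm, mul_zero], hor⟩
    rw [hz] at hor
    simp at hor

end Cone

/-! ### The homology of the subspheres -/

section Subsphere

variable {F : Type*} [Field F] {p : ℕ}
  (b : OrthonormalBasis (Fin p) ℝ (EuclideanSpace ℝ (Fin p)))

theorem sphereCoord_basisPoint_eq_single (n : Fin p) :
    sphereCoord b (basisPoint b n) = Pi.single n 1 := by
  ext i
  rw [sphereCoord_basisPoint, Pi.single_apply]

theorem sphereCoord_neg_basisPoint_eq_single (n : Fin p) :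
    sphereCoord b (-basisPoint b n) = Pi.single n (-1) := by
  ext i
  rw [sphereCoord_neg, sphereCoord_basisPoint, Pi.single_apply]
  split_ifs <;> simp

theorem subsphere_zero (n : Fin p) (hn : (n : ℕ) = 0) :
    subsphere (basisPoint b) n = {basisPoint b n, -basisPoint b n} := by
  ext x
  rw [subsphere_eq_coneSet]
  simp only [coneSet, Set.mem_ofPred_eq, Set.mem_insert_iff, Set.mem_singleton_iff]
  constructor
  · intro h
    have h0 : ∀ i, i ≠ n → sphereCoord b x i = 0 := fun i hi =>
      h i (lt_of_le_of_ne (Fin.le_def.2 (by omega)) hi.symm)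
    have hsum := sum_sphereCoord_sq b x
    rw [Finset.sum_eq_single n (fun i _ hi => by rw [h0 i hi]; simp) (by simp)] at hsum
    refine (sq_eq_one_iff.1 hsum).imp ?_ ?_ <;> intro h1 <;>
      refine sphereCoord_injective b ?_
    · rw [sphereCoord_basisPoint_eq_single]
      ext i
      by_cases hi : i = n
      · subst hi; simpa using h1
      · rw [h0 i hi, Pi.single_eq_of_ne hi]
    · rw [sphereCoord_neg_basisPoint_eq_single]
      ext i
      by_cases hi : i = n
      · subst hi; simpa using h1
      · rw [h0 i hi, Pi.single_eq_of_ne hi]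
  · rintro (rfl | rfl) m hm
    · rw [sphereCoord_basisPoint, if_neg hm.ne']
    · rw [sphereCoord_neg, sphereCoord_basisPoint, if_neg hm.ne', neg_zero]

theorem basisPoint_ne_neg (n : Fin p) : basisPoint b n ≠ -basisPoint b n := fun h => by
  have := congrFun (congrArg (sphereCoord b) h) n
  rw [sphereCoord_neg, sphereCoord_basisPoint, if_pos rfl] at this
  norm_num at this

theorem hasSphereHomology_subsphere_zero (n : Fin p) (hn : (n : ℕ) = 0) :
    HasSphereHomology (subsphere (basisPoint b) n) 0
      (pointChain F (basisPoint b n) - pointChain F (-basisPoint b n)) := by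
  rw [subsphere_zero b n hn]
  exact hasSphereHomology_pair (basisPoint_ne_neg b n)

theorem isOpen_punctured (n : Fin p) (ε : ℝ) :
    IsOpen (coneSet b fun y => 0 < ε * y n ∨ ∃ i, i ≠ n ∧ y i ≠ 0) := by
  have h1 : IsOpen {x | 0 < ε * sphereCoord b x n} :=
    isOpen_lt continuous_const (by fun_prop)
  have h2 : IsOpen (⋃ i ∈ {i | i ≠ n}, {x | sphereCoord b x i ≠ 0}) :=
    isOpen_biUnion fun i _ => isOpen_ne_fun (by fun_prop) continuous_const
  convert! h1.union h2 using 1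
  ext x
  simp [coneSet]

/-- The subspheres have the homology of spheres. -/
theorem exists_hasSphereHomology_subsphere (n : ℕ) (hn : n < p) :
    ∃ α : SingularChain F (UnitSphere p) n,
      HasSphereHomology (subsphere (basisPoint b) ⟨n, hn⟩) n α := by
  induction n with
  | zero => exact ⟨_, hasSphereHomology_subsphere_zero b ⟨0, hn⟩ rfl⟩
  | succ n ih =>
    obtain ⟨α, hα⟩ := ih (by omega)
    set N : Fin p := ⟨n + 1, hn⟩ with hN
    -- The `N`-th subsphere without its two poles retracts onto its equator, the previous subsphere.
    have hsdr : IsStrongDeformationRetract (subsphere (basisPoint b) ⟨n, by omega⟩)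
        (coneSet b fun y => (∀ m, N < m → y m = 0) ∧ ∃ i ≤ (⟨n, by omega⟩ : Fin p), y i ≠ 0) := by
      refine isStrongDeformationRetract_subsphere b ⟨n, by omega⟩ ?_ ?_ (fun y _ h => h.2) ?_
      · rintro a ha y ⟨h0, i, hi, hyi⟩
        exact ⟨fun m hm => by simp [h0 m hm], i, hi, by simpa [hyi] using ha.ne'⟩
      · intro y hy h0
        refine ⟨fun m hm => h0 m (lt_trans (Fin.lt_def.2 (by simp [hN])) hm), ?_⟩
        by_contra! h
        refine hy (funext fun i => ?_)
        by_cases hi : i ≤ (⟨n, by omega⟩ : Fin p)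
        exacts [h i hi, h0 i (not_le.1 hi)]
      · rintro y ⟨h0, i, hi, hyi⟩ s - -
        refine ⟨fun m hm => ?_, i, hi, by simpa [hi] using hyi⟩
        simp [h0 m hm]
    have hinter : subsphere (basisPoint b) N ∩
        ((coneSet b fun y => 0 < (1 : ℝ) * y N ∨ ∃ i, i ≠ N ∧ y i ≠ 0) ∩
          coneSet b fun y => 0 < (-1 : ℝ) * y N ∨ ∃ i, i ≠ N ∧ y i ≠ 0) =
        coneSet b fun y => (∀ m, N < m → y m = 0) ∧ ∃ i ≤ (⟨n, by omega⟩ : Fin p), y i ≠ 0 := by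
      rw [subsphere_eq_coneSet]
      ext x
      simp only [coneSet, Set.mem_inter_iff, Set.mem_ofPred_eq]
      generalize sphereCoord b x = y
      constructor
      · rintro ⟨h0, h1, h2⟩
        have h3 : ∃ i, i ≠ N ∧ y i ≠ 0 := by
          rcases h1 with h1 | h1
          · exact h2.resolve_left (by linarith)
          · exact h1
        obtain ⟨i, hi, hyi⟩ := h3
        refine ⟨h0, i, ?_, hyi⟩
        by_contra hlt
        refine hyi (h0 i (lt_of_le_of_ne ?_ hi.symm))
        have := Fin.lt_def.1 (not_le.1 hlt)
        exact Fin.le_def.2 this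
      · rintro ⟨h0, i, hi, hyi⟩
        have hne : i ≠ N := fun h => by
          rw [h] at hi
          exact absurd (Fin.le_def.1 hi) (by simp [hN])
        exact ⟨h0, Or.inr ⟨i, hne, hyi⟩, Or.inr ⟨i, hne, hyi⟩⟩
    -- The cover consists of the complements of the two poles. Each piece retracts to the pole it
    -- still contains, hence is acyclic.
    refine HasSphereHomology.of_cover (isOpen_punctured b N 1) (isOpen_punctured b N (-1)) ?_
      ((isAcyclic_singleton _).of_retract (isStrongDeformationRetract_pole b N 1 (by norm_num) _
        (sphereCoord_basisPoint_eq_single b N)))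
      ((isAcyclic_singleton _).of_retract (isStrongDeformationRetract_pole b N (-1) (by norm_num) _
        (sphereCoord_neg_basisPoint_eq_single b N))) (α := α) ?_
    · intro x _
      by_cases h : ∃ i, i ≠ N ∧ sphereCoord b x i ≠ 0
      · exact Or.inl (Or.inr h)
      · push Not at h
        have hN0 : sphereCoord b x N ≠ 0 := fun hN0 => sphereCoord_ne_zero b x <| funext fun i => by
          by_cases hi : i = N
          · rw [hi, hN0]; rfl
          · exact h i hi
        rcases lt_or_gt_of_ne hN0 with h | h
        · exact Or.inr (Or.inl (by linarith))
        · exact Or.inl (Or.inl (by linarith))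
    · rw [hinter]
      exact hα.of_retract hsdr

end Subsphere

/-! ### Sublevel sets of quadratic exponential densities -/

section Sublevel

variable {F : Type*} [Field F] {p : ℕ}
  (b : OrthonormalBasis (Fin p) ℝ (EuclideanSpace ℝ (Fin p)))

/-- The density `d * exp (∑ kᵢ xᵢ²)` in orthonormal coordinates. -/
def coordDensity (k : Fin p → ℝ) (d : ℝ) (x : UnitSphere p) : ℝ :=
  d * Real.exp (∑ i, k i * sphereCoord b x i ^ 2)

/-- The squared coordinates sum to one, so a level of the form can be absorbed into its
coefficients; level sets thus become conic sets. -/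
theorem sum_sub_mul_sq (k : Fin p → ℝ) (c : ℝ) (x : UnitSphere p) :
    ∑ i, (k i - c) * sphereCoord b x i ^ 2 = ∑ i, k i * sphereCoord b x i ^ 2 - c := by
  simp only [sub_mul, Finset.sum_sub_distrib, ← Finset.mul_sum, sum_sphereCoord_sq, mul_one]

theorem sum_smul_sq (e : Fin p → ℝ) (a : ℝ) (y : Fin p → ℝ) :
    ∑ i, e i * (a • y) i ^ 2 = a ^ 2 * ∑ i, e i * y i ^ 2 := by
  rw [Finset.mul_sum]
  refine Finset.sum_congr rfl fun i _ => ?_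
  rw [Pi.smul_apply, smul_eq_mul]
  ring

theorem sum_scale_le {e : Fin p → ℝ} {n : Fin p} (h : ∀ i, n < i → 0 ≤ e i) (y : Fin p → ℝ)
    {s : ℝ} (h0 : 0 ≤ s) (h1 : s ≤ 1) :
    ∑ i, e i * (if i ≤ n then y i else s * y i) ^ 2 ≤ ∑ i, e i * y i ^ 2 := by
  refine Finset.sum_le_sum fun i _ => ?_
  split_ifs with hi
  · exact le_rfl
  · refine mul_le_mul_of_nonneg_left ?_ (h i (not_le.1 hi))
    rw [mul_pow]
    exact mul_le_of_le_one_left (sq_nonneg _) (pow_le_one₀ h0 h1)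

/-- Shrinking coordinates with positive coefficients lowers the form. A nonzero vector where the
form is nonpositive cannot live on those coordinates alone, so the projection never vanishes. -/
theorem isStrongDeformationRetract_le (n : Fin p) (e : Fin p → ℝ) (hle : ∀ i ≤ n, e i ≤ 0)
    (hlt : ∀ i, n < i → 0 < e i) :
    IsStrongDeformationRetract (subsphere (basisPoint b) n)
      (coneSet b fun y => ∑ i, e i * y i ^ 2 ≤ 0) := by
  refine isStrongDeformationRetract_subsphere b n ?_ ?_ ?_ ?_
  · intro a _ y hy
    rw [sum_smul_sq]
    exact mul_nonpos_of_nonneg_of_nonpos (sq_nonneg a) hy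
  · intro y _ h0
    refine Finset.sum_nonpos fun i _ => ?_
    rcases le_or_gt i n with hi | hi
    · exact mul_nonpos_of_nonpos_of_nonneg (hle i hi) (sq_nonneg _)
    · rw [h0 i hi, sq, mul_zero, mul_zero]
  · intro y hy hQ
    by_contra! h
    obtain ⟨j, hj⟩ := Function.ne_iff.1 hy
    refine absurd hQ (not_le.2 (Finset.sum_pos' (fun i _ => ?_) ⟨j, Finset.mem_univ j, ?_⟩))
    · rcases le_or_gt i n with hi | hi
      · rw [h i hi, sq, mul_zero, mul_zero]
      · exact mul_nonneg (hlt i hi).le (sq_nonneg _)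
    · rcases le_or_gt j n with hi | hi
      · exact absurd (h j hi) hj
      · exact mul_pos (hlt j hi) (sq_pos_of_ne_zero hj)
  · exact fun y hy s h0 h1 => (sum_scale_le (fun i hi => (hlt i hi).le) y h0 h1).trans hy

/-- The strict inequality exchanges the roles of strict and weak signs: zero coefficients are now
allowed beyond `n` and excluded up to `n`. This is the version for the open superlevel sets in
Alexander duality. -/
theorem isStrongDeformationRetract_lt (n : Fin p) (e : Fin p → ℝ) (hlt : ∀ i ≤ n, e i < 0)
    (hle : ∀ i, n < i → 0 ≤ e i) :
    IsStrongDeformationRetract (subsphere (basisPoint b) n)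
      (coneSet b fun y => ∑ i, e i * y i ^ 2 < 0) := by
  refine isStrongDeformationRetract_subsphere b n ?_ ?_ ?_ ?_
  · intro a ha y hy
    rw [sum_smul_sq]
    exact mul_neg_of_pos_of_neg (pow_pos ha 2) hy
  · intro y hy h0
    obtain ⟨j, hj⟩ := Function.ne_iff.1 hy
    refine Finset.sum_neg' (fun i _ => ?_) ⟨j, Finset.mem_univ j, ?_⟩
    · rcases le_or_gt i n with hi | hi
      · exact mul_nonpos_of_nonpos_of_nonneg (hlt i hi).le (sq_nonneg _)
      · rw [h0 i hi, sq, mul_zero, mul_zero]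
    · rcases le_or_gt j n with hi | hi
      · exact mul_neg_of_neg_of_pos (hlt j hi) (sq_pos_of_ne_zero hj)
      · exact absurd (h0 j hi) hj
  · intro y _ hQ
    by_contra! h
    refine absurd hQ (not_lt.2 (Finset.sum_nonneg fun i _ => ?_))
    rcases le_or_gt i n with hi | hi
    · rw [h i hi, sq, mul_zero, mul_zero]
    · exact mul_nonneg (hle i hi) (sq_nonneg _)
  · exact fun y hy s h0 h1 => (sum_scale_le hle y h0 h1).trans_lt hy

variable {k : Fin p → ℝ} {d : ℝ}

/-- The critical values of the density. -/
def criticalValue (k : Fin p → ℝ) (d : ℝ) (i : Fin p) : EReal := ((d * Real.exp (k i) : ℝ) : EReal)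

theorem criticalValue_strictMono (hk : StrictMono k) (hd : 0 < d) :
    StrictMono (criticalValue k d) := fun _ _ hij =>
  EReal.coe_lt_coe_iff.2 (mul_lt_mul_of_pos_left (Real.exp_lt_exp.2 (hk hij)) hd)

theorem sublevel_coordDensity (hk : StrictMono k) (hd : 0 < d) {n : Fin p} {r : EReal}
    (hr : r ∈ levelsAt (criticalValue k d) n) :
    ∃ c, (∀ i ≤ n, k i ≤ c) ∧ (∀ i, n < i → c < k i) ∧
      sublevel (coordDensity b k d) r = coneSet b fun y => ∑ i, (k i - c) * y i ^ 2 ≤ 0 := by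
  induction r with
  | bot => exact absurd hr.1 (not_le.2 (EReal.bot_lt_coe _))
  | top =>
    -- At level `⊤` there is no later critical value, so `n` is the last index and `c = k n` already
    -- describes the whole sphere.
    refine ⟨k n, fun i hi => hk.monotone hi, fun i hi => absurd (hr.2 i hi) not_top_lt, ?_⟩
    have hlast : ∀ i, i ≤ n := fun i => not_lt.1 fun hi => absurd (hr.2 i hi) not_top_lt
    refine (Set.eq_univ_of_forall fun x => ?_).trans (Set.eq_univ_of_forall fun x => ?_).symm
    · simp [sublevel]
    · exact Finset.sum_nonpos fun i _ => mul_nonpos_of_nonpos_of_nonneg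
        (sub_nonpos.2 (hk.monotone (hlast i))) (sq_nonneg _)
  | coe ρ =>
    have hr1 : d * Real.exp (k n) ≤ ρ := EReal.coe_le_coe_iff.1 hr.1
    have hρ : 0 < ρ := (mul_pos hd (Real.exp_pos _)).trans_le hr1
    have hlevel : ∀ a, d * Real.exp a ≤ ρ ↔ a ≤ Real.log (ρ / d) := fun a => by
      rw [Real.le_log_iff_exp_le (div_pos hρ hd), le_div_iff₀' hd]
    refine ⟨Real.log (ρ / d), fun i hi => (hk.monotone hi).trans ((hlevel _).1 hr1),
      fun i hi => ?_, ?_⟩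
    · rw [← not_le, ← hlevel, not_le]
      exact EReal.coe_lt_coe_iff.1 (hr.2 i hi)
    · ext x
      simp only [sublevel, coneSet, Set.mem_ofPred_eq, sum_sub_mul_sq, EReal.coe_le_coe_iff]
      rw [coordDensity, hlevel, sub_nonpos]

theorem isStrongDeformationRetract_sublevel (hk : StrictMono k) (hd : 0 < d) {n : Fin p} {r : EReal}
    (hr : r ∈ levelsAt (criticalValue k d) n) :
    IsStrongDeformationRetract (subsphere (basisPoint b) n) (sublevel (coordDensity b k d) r) := by
  obtain ⟨c, h1, h2, h3⟩ := sublevel_coordDensity b hk hd hr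
  rw [h3]
  exact isStrongDeformationRetract_le b n _ (fun i hi => sub_nonpos.2 (h1 i hi))
    fun i hi => sub_pos.2 (h2 i hi)

theorem isStrongDeformationRetract_strict_sublevel (hd : 0 < d) {n : Fin p}
    {ρ : ℝ} (h1 : ∀ i ≤ n, d * Real.exp (k i) < ρ) (h2 : ∀ i, n < i → ρ ≤ d * Real.exp (k i)) :
    IsStrongDeformationRetract (subsphere (basisPoint b) n) {x | coordDensity b k d x < ρ} := by
  have hρ : 0 < ρ := (mul_pos hd (Real.exp_pos _)).trans (h1 n le_rfl)
  have hlevel : ∀ a, d * Real.exp a < ρ ↔ a < Real.log (ρ / d) := fun a => by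
    rw [Real.lt_log_iff_exp_lt (div_pos hρ hd), lt_div_iff₀' hd]
  have hset : {x | coordDensity b k d x < ρ} =
      coneSet b fun y => ∑ i, (k i - Real.log (ρ / d)) * y i ^ 2 < 0 := by
    ext x
    simp only [coneSet, Set.mem_ofPred_eq, sum_sub_mul_sq]
    rw [coordDensity, hlevel, sub_neg]
  rw [hset]
  refine isStrongDeformationRetract_lt b n _ (fun i hi => sub_neg.2 ((hlevel _).1 (h1 i hi)))
    fun i hi => sub_nonneg.2 ?_
  rw [← not_lt, ← hlevel, not_lt]
  exact h2 i hi

theorem criticalValue_le_coordDensity (hk : Monotone k) (hd : 0 < d) (i : Fin p)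
    (hi : (i : ℕ) = 0) (x : UnitSphere p) : d * Real.exp (k i) ≤ coordDensity b k d x := by
  refine mul_le_mul_of_nonneg_left (Real.exp_le_exp.2 ?_) hd.le
  calc k i = ∑ j, k i * sphereCoord b x j ^ 2 := by
        rw [← Finset.mul_sum, sum_sphereCoord_sq, mul_one]
    _ ≤ _ := Finset.sum_le_sum fun j _ =>
        mul_le_mul_of_nonneg_right (hk (Fin.le_def.2 (by omega))) (sq_nonneg _)

theorem coordDensity_le_criticalValue (hk : Monotone k) (hd : 0 < d) (i : Fin p)
    (hi : (i : ℕ) + 1 = p) (x : UnitSphere p) : coordDensity b k d x ≤ d * Real.exp (k i) := by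
  refine mul_le_mul_of_nonneg_left (Real.exp_le_exp.2 ?_) hd.le
  calc _ ≤ ∑ j, k i * sphereCoord b x j ^ 2 := Finset.sum_le_sum fun j _ =>
        mul_le_mul_of_nonneg_right (hk (Fin.le_def.2 (by omega))) (sq_nonneg _)
    _ = k i := by rw [← Finset.mul_sum, sum_sphereCoord_sq, mul_one]

theorem sublevel_eq_empty (hk : Monotone k) (hd : 0 < d) {i : Fin p} (hi : (i : ℕ) = 0)
    {r : EReal} (hr : r < criticalValue k d i) : sublevel (coordDensity b k d) r = ∅ := by
  refine Set.eq_empty_of_forall_notMem fun x hx => ?_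
  exact absurd hr (not_lt.2 ((EReal.coe_le_coe_iff.2
    (criticalValue_le_coordDensity b hk hd i hi x)).trans hx))

/-- The sublevel sets of the density form a family with the homology of spheres. -/
theorem isSphereFamily_sublevel (hp : 0 < p) (hk : StrictMono k) (hd : 0 < d)
    {α : ∀ n : Fin p, SingularChain F (UnitSphere p) n}
    (hα : ∀ n, HasSphereHomology (subsphere (basisPoint b) n) (n : ℕ) (α n)) :
    IsSphereFamily (sublevel (coordDensity b k d)) (criticalValue k d) α where
  strictMono := criticalValue_strictMono hk hd
  sphere n _ hr := (hα n).of_retract (isStrongDeformationRetract_sublevel b hk hd hr)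
  empty r hr := by
    refine sublevel_eq_empty b hk.monotone hd (i := ⟨0, hp⟩) rfl ?_
    by_contra h
    obtain ⟨n, hn⟩ := exists_mem_levelsAt (criticalValue k d) (not_lt.1 h)
    exact hr n hn
  nonempty n := ⟨criticalValue k d n, le_rfl, fun _ hm => criticalValue_strictMono hk hd hm⟩

theorem coordDensity_basisPoint (n : Fin p) :
    coordDensity b k d (basisPoint b n) = d * Real.exp (k n) := by
  simp [coordDensity, sphereCoord_basisPoint]

theorem coordDensity_neg (x : UnitSphere p) : coordDensity b k d (-x) = coordDensity b k d x := by
  simp [coordDensity, sphereCoord_neg]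

/-- The barcodes of a filtration by the sublevel sets of the density. -/
theorem hasBettiBarcode_zero_sublevel (hp : 0 < p) (hk : StrictMono k) (hd : 0 < d)
    {𝓕 : ChainFiltration F (UnitSphere p)}
    (hF : ∀ r j, 𝓕.part r j = chainsIn F (sublevel (coordDensity b k d) r) j) (n : Fin p)
    (hn : (n : ℕ) = 0) : 𝓕.HasBettiBarcode 0
      ![Set.Icc (criticalValue k d n) ⊤, levelsAt (criticalValue k d) n] := by
  choose α hα using fun n : Fin p => exists_hasSphereHomology_subsphere (F := F) b n n.2
  refine (isSphereFamily_sublevel b hp hk hd hα).hasBettiBarcode_zero hF n hn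
    (x := basisPoint b n) (y := -basisPoint b n) (fun r hr => ?_) (fun r hr => ?_) fun r hr => ?_
  · exact (hasSphereHomology_subsphere_zero b n hn).of_retract
      (isStrongDeformationRetract_sublevel b hk hd hr)
  · rw [sublevel, Set.mem_ofPred_eq, coordDensity_basisPoint]
    exact hr
  · rw [sublevel, Set.mem_ofPred_eq, coordDensity_neg, coordDensity_basisPoint]
    exact hr

theorem hasBettiBarcode_sublevel (hp : 0 < p) (hk : StrictMono k) (hd : 0 < d)
    {𝓕 : ChainFiltration F (UnitSphere p)} (n : Fin p)
    (hF : 𝓕.ComputesHomology (sublevel (coordDensity b k d)) n) :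
    𝓕.HasBettiBarcode n ![levelsAt (criticalValue k d) n] := by
  choose α hα using fun n : Fin p => exists_hasSphereHomology_subsphere (F := F) b n n.2
  exact (isSphereFamily_sublevel b hp hk hd hα).hasBettiBarcode n hF

theorem hasBettiBarcode_sublevel_of_le (hp : 0 < p) (hk : StrictMono k) (hd : 0 < d)
    {𝓕 : ChainFiltration F (UnitSphere p)} {j : ℕ} (hj : p ≤ j)
    (hF : 𝓕.ComputesHomology (sublevel (coordDensity b k d)) j) :
    𝓕.HasBettiBarcode j ![] := by
  choose α hα using fun n : Fin p => exists_hasSphereHomology_subsphere (F := F) b n n.2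
  exact (isSphereFamily_sublevel b hp hk hd hα).hasBettiBarcode_of_le hF hj

/-! ### Superlevel sets -/

theorem coordDensity_pos (hd : 0 < d) (x : UnitSphere p) : 0 < coordDensity b k d x :=
  mul_pos hd (Real.exp_pos _)

/-- Negating the exponents reverses their order, so the basis is reversed as well to keep them
increasing. -/
theorem coordDensity_rev (x : UnitSphere p) :
    coordDensity (b.reindex Fin.revPerm) (fun i => -k i.rev) d⁻¹ x =
      (coordDensity b k d x)⁻¹ := by
  have : ∀ i, sphereCoord (b.reindex Fin.revPerm) x i = sphereCoord b x i.rev := fun i => by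
    simp [sphereCoord]
  simp only [coordDensity, this, mul_inv, ← Real.exp_neg, ← Finset.sum_neg_distrib, neg_mul]
  congr 2
  exact Fintype.sum_equiv Fin.revPerm _ _ fun i => rfl

theorem superlevel_coordDensity (hd : 0 < d) (r : EReal) :
    superlevel (coordDensity b k d) (r.toENNReal)⁻¹ =
      sublevel (coordDensity (b.reindex Fin.revPerm) (fun i => -k i.rev) d⁻¹) r := by
  ext x
  have hf := coordDensity_pos b (k := k) hd x
  simp only [superlevel, sublevel, Set.mem_ofPred_eq, coordDensity_rev]
  induction r with
  | bot => simp
  | top => simp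
  | coe ρ =>
    rw [EReal.coe_le_coe_iff, EReal.real_coe_toENNReal]
    -- For `ρ ≤ 0` the truncated inverse is infinite, making the superlevel set empty; the other
    -- side is empty since the reciprocal density is positive.
    rcases le_or_gt ρ 0 with hρ | hρ
    · rw [ENNReal.ofReal_of_nonpos hρ]
      simp only [ENNReal.inv_zero, top_le_iff, ENNReal.ofReal_ne_top, false_iff, not_le]
      exact hρ.trans_lt (inv_pos.2 hf)
    · rw [← ENNReal.ofReal_inv_of_pos hρ, ENNReal.ofReal_le_ofReal_iff hf.le,
        inv_le_comm₀ hρ hf]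

end Sublevel

/-! ### The Bingham density in eigencoordinates -/

section Bingham

variable {p : ℕ} {K : Matrix (Fin p) (Fin p) ℝ} {k : Fin p → ℝ}

/-- Unit eigenvectors of a symmetric matrix for distinct eigenvalues form an orthonormal basis. -/
theorem exists_basis_of_eigenvectors (hK : K.IsSymm) (hk : Function.Injective k)
    (v : Fin p → UnitSphere p)
    (hv : ∀ i, K *ᵥ (v i : EuclideanSpace ℝ (Fin p)).ofLp =
      k i • (v i : EuclideanSpace ℝ (Fin p)).ofLp) :
    ∃ b : OrthonormalBasis (Fin p) ℝ (EuclideanSpace ℝ (Fin p)), v = basisPoint b := by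
  have hdot : ∀ x y : EuclideanSpace ℝ (Fin p), inner ℝ x y = x.ofLp ⬝ᵥ y.ofLp := fun x y => by
    simp [PiLp.inner_apply, dotProduct, mul_comm]
  have hon : Orthonormal ℝ fun i => (v i : EuclideanSpace ℝ (Fin p)) := by
    refine ⟨fun i => by simp, fun i j hij => ?_⟩
    change inner ℝ (v i : EuclideanSpace ℝ (Fin p)) (v j) = 0
    rw [hdot]
    -- Symmetry moves the matrix across the inner product, so the inner product is annihilated by
    -- the difference of two distinct eigenvalues.
    have h1 : (v i : EuclideanSpace ℝ (Fin p)).ofLp ⬝ᵥ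
        K *ᵥ (v j : EuclideanSpace ℝ (Fin p)).ofLp =
        K *ᵥ (v i : EuclideanSpace ℝ (Fin p)).ofLp ⬝ᵥ
          (v j : EuclideanSpace ℝ (Fin p)).ofLp := by
      rw [Matrix.dotProduct_mulVec, ← Matrix.mulVec_transpose, hK.eq]
    rw [hv, hv, dotProduct_smul, smul_dotProduct, smul_eq_mul, smul_eq_mul] at h1
    have h2 : (k j - k i) * ((v i : EuclideanSpace ℝ (Fin p)).ofLp ⬝ᵥ
        (v j : EuclideanSpace ℝ (Fin p)).ofLp) = 0 := by linarith
    exact (mul_eq_zero.1 h2).resolve_left (sub_ne_zero.2 fun h => hij (hk h).symm)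
  have hcard : Fintype.card (Fin p) = Module.finrank ℝ (EuclideanSpace ℝ (Fin p)) := by simp
  rcases isEmpty_or_nonempty (Fin p) with _ | _
  · exact ⟨⟨.refl ℝ _⟩, Subsingleton.elim _ _⟩
  have hspan := (basisOfOrthonormalOfCardEqFinrank hon hcard).span_eq
  rw [coe_basisOfOrthonormalOfCardEqFinrank] at hspan
  refine ⟨OrthonormalBasis.mk hon hspan.ge, funext fun i => Subtype.ext ?_⟩
  simp [basisPoint]

theorem quadForm_eq (b : OrthonormalBasis (Fin p) ℝ (EuclideanSpace ℝ (Fin p)))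
    (hb : ∀ i, K *ᵥ (b i).ofLp = k i • (b i).ofLp) (x : UnitSphere p) :
    quadForm K x = ∑ i, k i * sphereCoord b x i ^ 2 := by
  have hx : (x : EuclideanSpace ℝ (Fin p)).ofLp = ∑ i, sphereCoord b x i • (b i).ofLp := by
    conv_lhs => rw [← ofCoord_sphereCoord b x, ofCoord]
    simp
  have hKx : K *ᵥ (x : EuclideanSpace ℝ (Fin p)).ofLp =
      ∑ i, (k i * sphereCoord b x i) • (b i).ofLp := by
    rw [hx, Matrix.mulVec_sum]
    refine Finset.sum_congr rfl fun i _ => ?_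
    rw [Matrix.mulVec_smul, hb, smul_smul, mul_comm]
  have hcoord : ∀ i, (x : EuclideanSpace ℝ (Fin p)).ofLp ⬝ᵥ (b i).ofLp = sphereCoord b x i :=
    fun i => by simp [sphereCoord, PiLp.inner_apply, dotProduct]
  rw [quadForm, hKx, dotProduct_sum]
  refine Finset.sum_congr rfl fun i _ => ?_
  rw [dotProduct_smul, hcoord, smul_eq_mul]
  ring

theorem continuous_quadForm (K : Matrix (Fin p) (Fin p) ℝ) : Continuous (quadForm K) := by
  unfold quadForm
  have h : Continuous fun x : UnitSphere p => (x : EuclideanSpace ℝ (Fin p)).ofLp :=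
    (PiLp.continuous_ofLp 2 _).comp continuous_subtype_val
  exact h.dotProduct (Continuous.matrix_mulVec continuous_const h)

/-- The integrand is positive, and integrable by compactness; `0 < p` makes the surface measure
nonzero. -/
theorem binghamConst_pos (hp : 0 < p) (K : Matrix (Fin p) (Fin p) ℝ) : 0 < binghamConst K := by
  have : Nonempty (Fin p) := ⟨⟨0, hp⟩⟩
  have : NeZero (volume : Measure (EuclideanSpace ℝ (Fin p))).toSphere :=
    ⟨Measure.toSphere_ne_zero _⟩
  refine inv_pos.2 (integral_exp_pos ?_)
  have hcont : Continuous fun x => Real.exp (quadForm K x) :=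
    Real.continuous_exp.comp (continuous_quadForm K)
  exact hcont.integrable_of_hasCompactSupport (HasCompactSupport.of_compactSpace _)

theorem binghamDensity_eq (b : OrthonormalBasis (Fin p) ℝ (EuclideanSpace ℝ (Fin p)))
    (hb : ∀ i, K *ᵥ (b i).ofLp = k i • (b i).ofLp) :
    binghamDensity K = coordDensity b k (binghamConst K) := by
  ext x
  rw [binghamDensity, coordDensity, quadForm_eq b hb]

end Bingham

/-! ### The cell structure by hemispheres -/

section Cells

/-- A homeomorphism carrying the ball of the maximum norm to the Euclidean ball. -/
theorem exists_homeomorph_euclideanBall (n : ℕ) : ∃ e : (Fin n → ℝ) ≃ₜ (Fin n → ℝ),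
    e '' Metric.ball 0 1 = {u | ∑ i, u i ^ 2 < 1} ∧
    e '' Metric.closedBall 0 1 = {u | ∑ i, u i ^ 2 ≤ 1} ∧
    e '' Metric.sphere 0 1 = {u | ∑ i, u i ^ 2 = 1} := by
  let L := (EuclideanSpace.equiv (Fin n) ℝ).symm
  have hnorm : ∀ u, ‖L u‖ ^ 2 = ∑ i, u i ^ 2 := fun u => by
    rw [EuclideanSpace.norm_sq_eq]
    simp [L]
  set t : Set (Fin n → ℝ) := L ⁻¹' Metric.ball 0 1 with ht
  have htconv : Convex ℝ t := (convex_ball 0 1).linear_preimage L.toLinearMap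
  have htopen : IsOpen t := Metric.isOpen_ball.preimage L.continuous
  have htint : (interior t).Nonempty := ⟨0, by rw [htopen.interior_eq]; simp [ht]⟩
  have htb : Bornology.IsVonNBounded ℝ t := by
    have := (NormedSpace.isVonNBounded_ball ℝ (EuclideanSpace ℝ (Fin n)) 1).image
      (EuclideanSpace.equiv (Fin n) ℝ).toContinuousLinearMap
    convert! this using 1
    ext u
    simp only [ht, Set.mem_preimage, Set.mem_image]
    exact ⟨fun h => ⟨L u, h, rfl⟩, by rintro ⟨w, hw, rfl⟩; simpa [L] using hw⟩
  -- Cells are modelled on balls of the maximum norm, whereas hemispheres project to Euclidean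
  -- balls. Both are bounded convex bodies, and a homeomorphism of the space matches their
  -- interiors, closures and frontiers.
  obtain ⟨e, h1, h2, h3⟩ := exists_homeomorph_image_eq (s := Metric.ball (0 : Fin n → ℝ) 1)
    (convex_ball 0 1) (by simp [Metric.isOpen_ball.interior_eq])
    (NormedSpace.isVonNBounded_ball ℝ _ 1) htconv htint htb
  have hclos : closure t = L ⁻¹' Metric.closedBall 0 1 := by
    rw [← closure_ball (0 : EuclideanSpace ℝ (Fin n)) one_ne_zero]
    exact (L.toHomeomorph.preimage_closure _).symm
  have hmem : ∀ u, u ∈ t ↔ ∑ i, u i ^ 2 < 1 := fun u => by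
    rw [ht, Set.mem_preimage, mem_ball_zero_iff, ← hnorm, sq_lt_one_iff₀ (norm_nonneg _)]
  have hmem' : ∀ u, u ∈ closure t ↔ ∑ i, u i ^ 2 ≤ 1 := fun u => by
    rw [hclos, Set.mem_preimage, mem_closedBall_zero_iff, ← hnorm, sq_le_one_iff₀ (norm_nonneg _)]
  refine ⟨e, ?_, ?_, ?_⟩
  · rw [Metric.isOpen_ball.interior_eq, htopen.interior_eq] at h1
    rw [h1]
    exact Set.ext hmem
  · rw [closure_ball _ one_ne_zero] at h2
    rw [h2]
    exact Set.ext hmem'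
  · rw [frontier_ball _ one_ne_zero] at h3
    rw [h3, frontier, htopen.interior_eq]
    ext u
    rw [Set.mem_sdiff, hmem, hmem', Set.mem_ofPred_eq]
    exact ⟨fun h => le_antisymm h.1 (not_lt.1 h.2), fun h => ⟨h.le, h.not_lt⟩⟩

variable {p : ℕ} (b : OrthonormalBasis (Fin p) ℝ (EuclideanSpace ℝ (Fin p)))

/-- The coordinates of the point over `u` in the hemisphere of dimension `n`. -/
def cellCoord (n : Fin p) (ε : ℤˣ) (u : Fin n → ℝ) (i : Fin p) : ℝ :=
  if h : i < n then u ⟨i, h⟩ else if i = n then ((ε : ℤ) : ℝ) * (1 - ∑ j, u j ^ 2).sqrt else 0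

/-- The projection of a point of the sphere to its first `n` coordinates. -/
def cellProj (n : Fin p) (x : UnitSphere p) (j : Fin n) : ℝ :=
  sphereCoord b x ⟨j, j.2.trans n.2⟩

theorem units_cast_mul_self (ε : ℤˣ) : ((ε : ℤ) : ℝ) * ((ε : ℤ) : ℝ) = 1 := by
  rcases Int.units_eq_one_or ε with rfl | rfl <;> simp

theorem sum_eq_sum_add (n : Fin p) (y : Fin p → ℝ) (h : ∀ m, n < m → y m = 0) :
    ∑ i, y i ^ 2 = ∑ j : Fin n, y ⟨j, j.2.trans n.2⟩ ^ 2 + y n ^ 2 := by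
  classical
  have h1 : ∑ i, y i ^ 2 = ∑ i ∈ Finset.Iio n, y i ^ 2 + y n ^ 2 := by
    rw [add_comm, ← Finset.sum_insert (f := fun i => y i ^ 2) (s := Finset.Iio n) (by simp)]
    refine (Finset.sum_subset (Finset.subset_univ _) fun i _ hi => ?_).symm
    rw [h i, sq, mul_zero]
    simp only [Finset.mem_insert, Finset.mem_Iio, not_or, not_lt] at hi
    exact lt_of_le_of_ne hi.2 (Ne.symm hi.1)
  rw [h1]
  congr 1
  refine Finset.sum_bij' (fun i hi => (⟨i, by simpa using hi⟩ : Fin n))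
    (fun j _ => ⟨j, j.2.trans n.2⟩) ?_ ?_ ?_ ?_ ?_
  · simp
  · intro j _
    exact Finset.mem_Iio.2 (Fin.lt_def.2 j.2)
  · simp
  · simp
  · simp

theorem cellCoord_castLT (n : Fin p) (ε : ℤˣ) (u : Fin n → ℝ) (j : Fin n) :
    cellCoord n ε u ⟨j, j.2.trans n.2⟩ = u j :=
  dif_pos (Fin.lt_def.2 j.2)

theorem cellCoord_self (n : Fin p) (ε : ℤˣ) (u : Fin n → ℝ) :
    cellCoord n ε u n = ((ε : ℤ) : ℝ) * (1 - ∑ j, u j ^ 2).sqrt := by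
  simp [cellCoord]

theorem cellCoord_of_lt (n : Fin p) (ε : ℤˣ) (u : Fin n → ℝ) {m : Fin p} (hm : n < m) :
    cellCoord n ε u m = 0 := by
  simp [cellCoord, hm.not_gt, hm.ne']

theorem sum_cellCoord_sq (n : Fin p) (ε : ℤˣ) (u : Fin n → ℝ) :
    ∑ i, cellCoord n ε u i ^ 2 = ∑ j, u j ^ 2 + (1 - ∑ j, u j ^ 2).sqrt ^ 2 := by
  rw [sum_eq_sum_add n _ fun m hm => cellCoord_of_lt n ε u hm]
  simp only [cellCoord_castLT, cellCoord_self, mul_pow]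
  rw [sq ((ε : ℤ) : ℝ), units_cast_mul_self, one_mul]

/-- Holds for every `u`, also outside the unit ball where the square root is zero by convention, so
the characteristic map is defined and continuous on the whole space. -/
theorem cellCoord_ne_zero (n : Fin p) (ε : ℤˣ) (u : Fin n → ℝ) : cellCoord n ε u ≠ 0 := by
  intro h
  have hsum := sum_cellCoord_sq n ε u
  rw [h] at hsum
  simp only [Pi.zero_apply] at hsum
  have h0 : 0 ≤ ∑ j, u j ^ 2 := Finset.sum_nonneg fun j _ => sq_nonneg _
  have h1 : ∑ j, u j ^ 2 = 0 := by
    have := sq_nonneg (1 - ∑ j, u j ^ 2).sqrt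
    simp at hsum
    linarith
  rw [h1] at hsum
  simp at hsum

theorem continuous_cellCoord (n : Fin p) (ε : ℤˣ) : Continuous (cellCoord n ε) := by
  refine continuous_pi fun i => ?_
  unfold cellCoord
  split_ifs
  · exact continuous_apply _
  · fun_prop
  · exact continuous_const

/-- The point over `u` in the hemisphere of dimension `n`. -/
def cellPoint (n : Fin p) (ε : ℤˣ) (u : Fin n → ℝ) : UnitSphere p :=
  direction b (cellCoord n ε u) (cellCoord_ne_zero n ε u)

theorem continuous_cellPoint (n : Fin p) (ε : ℤˣ) : Continuous (cellPoint b n ε) := by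
  refine Continuous.subtype_mk ?_ _
  have h3 : Continuous fun u => ofCoord b (cellCoord n ε u) :=
    (continuous_ofCoord b).comp (continuous_cellCoord n ε)
  exact (h3.norm.inv₀ fun u =>
    norm_ne_zero_iff.2 (ofCoord_ne_zero b (cellCoord_ne_zero n ε u))).smul h3

theorem sphereCoord_cellPoint (n : Fin p) (ε : ℤˣ) {u : Fin n → ℝ} (hu : ∑ j, u j ^ 2 ≤ 1) :
    sphereCoord b (cellPoint b n ε u) = cellCoord n ε u := by
  have h1 : ‖ofCoord b (cellCoord n ε u)‖ = 1 := by
    rw [← sq_eq_sq₀ (norm_nonneg _) zero_le_one, norm_ofCoord_sq, sum_cellCoord_sq,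
      Real.sq_sqrt (by linarith)]
    ring
  rw [cellPoint, sphereCoord_direction, h1, inv_one, one_smul]

theorem cellProj_cellPoint (n : Fin p) (ε : ℤˣ) {u : Fin n → ℝ} (hu : ∑ j, u j ^ 2 ≤ 1) :
    cellProj b n (cellPoint b n ε u) = u := by
  ext j
  rw [cellProj, sphereCoord_cellPoint b n ε hu, cellCoord_castLT]

theorem continuous_cellProj (n : Fin p) : Continuous (cellProj b n) :=
  continuous_pi fun _ => continuous_sphereCoord b _

/-- The closed hemisphere. -/
def closedHemisphere (n : Fin p) (ε : ℤˣ) : Set (UnitSphere p) :=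
  {x ∈ subsphere (basisPoint b) n | 0 ≤ ((ε : ℤ) : ℝ) * sphereCoord b x n}

theorem mem_openHemisphere_iff (n : Fin p) (ε : ℤˣ) (x : UnitSphere p) :
    x ∈ openHemisphere (basisPoint b) n ε ↔ x ∈ subsphere (basisPoint b) n ∧
      0 < ((ε : ℤ) : ℝ) * sphereCoord b x n := Iff.rfl

theorem sum_cellProj_sq (n : Fin p) {x : UnitSphere p} (hx : x ∈ subsphere (basisPoint b) n) :
    ∑ j, cellProj b n x j ^ 2 = 1 - sphereCoord b x n ^ 2 := by
  rw [eq_sub_iff_add_eq, ← sum_sphereCoord_sq b x,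
    sum_eq_sum_add n (sphereCoord b x) hx]
  rfl

theorem cellPoint_cellProj (n : Fin p) (ε : ℤˣ) {x : UnitSphere p}
    (hx : x ∈ closedHemisphere b n ε) : cellPoint b n ε (cellProj b n x) = x := by
  have hsum := sum_cellProj_sq b n hx.1
  refine sphereCoord_injective b ?_
  rw [sphereCoord_cellPoint b n ε (by rw [hsum]; linarith [sq_nonneg (sphereCoord b x n)])]
  ext i
  rcases lt_trichotomy i n with h | rfl | h
  · exact cellCoord_castLT n ε _ ⟨i, h⟩
  · rw [cellCoord_self, hsum, sub_sub_cancel]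
    have h2 : sphereCoord b x i ^ 2 = (((ε : ℤ) : ℝ) * sphereCoord b x i) ^ 2 := by
      rw [mul_pow, sq ((ε : ℤ) : ℝ), units_cast_mul_self, one_mul]
    rw [h2, Real.sqrt_sq hx.2, ← mul_assoc, units_cast_mul_self, one_mul]
  · rw [cellCoord_of_lt n ε _ h]
    exact (hx.1 i h).symm

theorem cellPoint_mem_closedHemisphere (n : Fin p) (ε : ℤˣ) {u : Fin n → ℝ}
    (hu : ∑ j, u j ^ 2 ≤ 1) : cellPoint b n ε u ∈ closedHemisphere b n ε := by
  refine ⟨fun m hm => ?_, ?_⟩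
  · change sphereCoord b _ m = 0
    rw [sphereCoord_cellPoint b n ε hu, cellCoord_of_lt n ε u hm]
  · rw [sphereCoord_cellPoint b n ε hu, cellCoord_self, ← mul_assoc, units_cast_mul_self, one_mul]
    exact Real.sqrt_nonneg _

/-- The homeomorphism from the ball of the maximum norm to the Euclidean ball. -/
def ballHomeo (n : ℕ) : (Fin n → ℝ) ≃ₜ (Fin n → ℝ) :=
  (exists_homeomorph_euclideanBall n).choose

theorem mem_ball_iff_ballHomeo {n : ℕ} (y : Fin n → ℝ) :
    y ∈ Metric.ball 0 1 ↔ ∑ j, ballHomeo n y j ^ 2 < 1 := by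
  rw [← (ballHomeo n).injective.mem_set_image]
  exact iff_of_eq (congrArg (ballHomeo n y ∈ ·) (exists_homeomorph_euclideanBall n).choose_spec.1)

theorem mem_closedBall_iff_ballHomeo {n : ℕ} (y : Fin n → ℝ) :
    y ∈ Metric.closedBall 0 1 ↔ ∑ j, ballHomeo n y j ^ 2 ≤ 1 := by
  rw [← (ballHomeo n).injective.mem_set_image]
  exact iff_of_eq
    (congrArg (ballHomeo n y ∈ ·) (exists_homeomorph_euclideanBall n).choose_spec.2.1)

theorem mem_sphere_iff_ballHomeo {n : ℕ} (y : Fin n → ℝ) :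
    y ∈ Metric.sphere 0 1 ↔ ∑ j, ballHomeo n y j ^ 2 = 1 := by
  rw [← (ballHomeo n).injective.mem_set_image]
  exact iff_of_eq
    (congrArg (ballHomeo n y ∈ ·) (exists_homeomorph_euclideanBall n).choose_spec.2.2)

/-- The characteristic map of a hemisphere. -/
def cellMap (n : Fin p) (ε : ℤˣ) : PartialEquiv (Fin n → ℝ) (UnitSphere p) where
  toFun y := cellPoint b n ε (ballHomeo n y)
  invFun x := (ballHomeo n).symm (cellProj b n x)
  source := Metric.ball 0 1
  target := openHemisphere (basisPoint b) n ε
  map_source' y hy := by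
    have hu := (mem_ball_iff_ballHomeo y).1 hy
    refine ⟨(cellPoint_mem_closedHemisphere b n ε hu.le).1, ?_⟩
    change 0 < ((ε : ℤ) : ℝ) * sphereCoord b _ n
    rw [sphereCoord_cellPoint b n ε hu.le, cellCoord_self, ← mul_assoc, units_cast_mul_self,
      one_mul]
    exact Real.sqrt_pos.2 (sub_pos.2 hu)
  map_target' x hx := by
    rw [mem_ball_iff_ballHomeo, Homeomorph.apply_symm_apply, sum_cellProj_sq b n hx.1]
    have : sphereCoord b x n ≠ 0 := fun h => by
      have := ((mem_openHemisphere_iff b n ε x).1 hx).2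
      rw [h, mul_zero] at this
      exact lt_irrefl _ this
    linarith [sq_pos_of_ne_zero this]
  left_inv' y hy := by
    rw [cellProj_cellPoint b n ε ((mem_ball_iff_ballHomeo y).1 hy).le,
      Homeomorph.symm_apply_apply]
  right_inv' x hx := by
    rw [Homeomorph.apply_symm_apply]
    exact cellPoint_cellProj b n ε ⟨hx.1, hx.2.le⟩

theorem cellMap_image_ball (n : Fin p) (ε : ℤˣ) :
    cellMap b n ε '' Metric.ball 0 1 = openHemisphere (basisPoint b) n ε :=
  (cellMap b n ε).image_source_eq_target

theorem cellMap_image_closedBall (n : Fin p) (ε : ℤˣ) :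
    cellMap b n ε '' Metric.closedBall 0 1 = closedHemisphere b n ε := by
  ext x
  constructor
  · rintro ⟨y, hy, rfl⟩
    exact cellPoint_mem_closedHemisphere b n ε ((mem_closedBall_iff_ballHomeo y).1 hy)
  · intro hx
    refine ⟨(ballHomeo n).symm (cellProj b n x), ?_, ?_⟩
    · rw [mem_closedBall_iff_ballHomeo, Homeomorph.apply_symm_apply, sum_cellProj_sq b n hx.1]
      linarith [sq_nonneg (sphereCoord b x n)]
    · change cellPoint b n ε _ = x
      rw [Homeomorph.apply_symm_apply]
      exact cellPoint_cellProj b n ε hx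

/-- The last nonzero coordinate gives the dimension of the cell, and its sign gives the hemisphere.
-/
theorem exists_mem_openHemisphere (x : UnitSphere p) :
    ∃ (n : Fin p) (ε : ℤˣ), x ∈ openHemisphere (basisPoint b) n ε := by
  classical
  obtain ⟨i, hi⟩ := Function.ne_iff.1 (sphereCoord_ne_zero b x)
  obtain ⟨n, hn, hmax⟩ := (Finset.univ.filter fun n => sphereCoord b x n ≠ 0).exists_max_image id
    ⟨i, by simpa using hi⟩
  have h0 : x ∈ subsphere (basisPoint b) n := fun m hm => by
    by_contra h
    exact absurd (hmax m (Finset.mem_filter.2 ⟨Finset.mem_univ _, h⟩)) (not_le.2 hm)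
  have hn' : sphereCoord b x n ≠ 0 := by simpa using hn
  rcases lt_or_gt_of_ne hn' with h | h
  · exact ⟨n, -1, (mem_openHemisphere_iff b _ _ x).2 ⟨h0, by simpa using h⟩⟩
  · exact ⟨n, 1, (mem_openHemisphere_iff b _ _ x).2 ⟨h0, by simpa using h⟩⟩

theorem openHemisphere_subset_closedHemisphere (n : Fin p) (ε : ℤˣ) :
    openHemisphere (basisPoint b) n ε ⊆ closedHemisphere b n ε := fun _ hx => ⟨hx.1, hx.2.le⟩

theorem sphereCoord_ne_zero_of_mem {n : Fin p} {ε : ℤˣ} {x : UnitSphere p}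
    (hx : x ∈ openHemisphere (basisPoint b) n ε) : sphereCoord b x n ≠ 0 := fun h => by
  have := ((mem_openHemisphere_iff b n ε x).1 hx).2
  rw [h, mul_zero] at this
  exact lt_irrefl _ this

theorem eq_of_mem_openHemisphere {n m : Fin p} {ε δ : ℤˣ} {x : UnitSphere p}
    (hn : x ∈ openHemisphere (basisPoint b) n ε) (hm : x ∈ openHemisphere (basisPoint b) m δ) :
    n = m ∧ ε = δ := by
  have hnm : n = m := by
    rcases lt_trichotomy n m with h | h | h
    · exact absurd (hn.1 m h) (sphereCoord_ne_zero_of_mem b hm)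
    · exact h
    · exact absurd (hm.1 n h) (sphereCoord_ne_zero_of_mem b hn)
  subst hnm
  refine ⟨rfl, ?_⟩
  have h1 := ((mem_openHemisphere_iff b n ε x).1 hn).2
  have h2 := ((mem_openHemisphere_iff b n δ x).1 hm).2
  rcases Int.units_eq_one_or ε with rfl | rfl <;> rcases Int.units_eq_one_or δ with rfl | rfl
  · rfl
  · simp at h1 h2; linarith
  · simp at h1 h2; linarith
  · rfl

/-- The cell structure on the sphere by hemispheres of the coordinate subspheres. -/
@[reducible]
def hemisphereCWComplex : Topology.CWComplex (Set.univ : Set (UnitSphere p)) :=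
  Topology.CWComplex.mkFinite (Set.univ : Set (UnitSphere p))
    -- The first factor is a single point below dimension `p` and empty from there on.
    (cell := fun n => PLift (n < p) × ℤˣ)
    (map := fun n c => cellMap b ⟨n, c.1.down⟩ c.2)
    (eventually_isEmpty_cell := by
      filter_upwards [Filter.eventually_ge_atTop p] with n hn
      exact ⟨fun c => absurd c.1.down (not_lt.2 hn)⟩)
    (finite_cell := fun n => inferInstance)
    (source_eq := fun n c => rfl)
    (continuousOn := fun n c =>
      ((continuous_cellPoint b ⟨n, c.1.down⟩ c.2).comp (ballHomeo n).continuous).continuousOn)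
    (continuousOn_symm := fun n c =>
      ((ballHomeo n).symm.continuous.comp (continuous_cellProj b ⟨n, c.1.down⟩)).continuousOn)
    (pairwiseDisjoint' := by
      rintro ⟨n, ⟨hn⟩, ε⟩ - ⟨m, ⟨hm⟩, δ⟩ - hne
      refine Set.disjoint_left.2 fun x hx hx' => hne ?_
      have h1 : x ∈ openHemisphere (basisPoint b) ⟨n, hn⟩ ε :=
        cellMap_image_ball b ⟨n, hn⟩ ε ▸ hx
      have h2 : x ∈ openHemisphere (basisPoint b) ⟨m, hm⟩ δ :=
        cellMap_image_ball b ⟨m, hm⟩ δ ▸ hx'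
      obtain ⟨h3, rfl⟩ := eq_of_mem_openHemisphere b h1 h2
      obtain rfl : n = m := congrArg Fin.val h3
      rfl)
    (mapsTo_iff_image_subset := by
      rintro n ⟨⟨hn⟩, ε⟩ y hy
      have hu := (mem_sphere_iff_ballHomeo y).1 hy
      set x := cellMap b ⟨n, hn⟩ ε y with hx
      have hx1 : x ∈ subsphere (basisPoint b) ⟨n, hn⟩ :=
        (cellPoint_mem_closedHemisphere b ⟨n, hn⟩ ε hu.le).1
      -- On the boundary of the ball the square root vanishes, so the last nonzero coordinate has
      -- smaller index and the point lies in a cell of lower dimension.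
      have hx0 : sphereCoord b x ⟨n, hn⟩ = 0 := by
        have h := sphereCoord_cellPoint b ⟨n, hn⟩ ε hu.le
        change sphereCoord b (cellPoint b ⟨n, hn⟩ ε (ballHomeo n y)) _ = 0
        rw [h, cellCoord_self]
        change _ * (1 - ∑ j, ballHomeo n y j ^ 2).sqrt = 0
        rw [hu]
        simp
      obtain ⟨m, δ, hm⟩ := exists_mem_openHemisphere b x
      have hmn : m < ⟨n, hn⟩ := by
        by_contra hlt
        rcases eq_or_lt_of_le (not_lt.1 hlt) with h | h
        · exact sphereCoord_ne_zero_of_mem b hm (h ▸ hx0)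
        · exact sphereCoord_ne_zero_of_mem b hm (hx1 m h)
      refine Set.mem_iUnion₂.2 ⟨m, Fin.lt_def.1 hmn, Set.mem_iUnion.2 ⟨(⟨m.2⟩, δ), ?_⟩⟩
      have := openHemisphere_subset_closedHemisphere b m δ hm
      rw [← cellMap_image_closedBall] at this
      exact this)
    (union' := by
      refine Set.eq_univ_of_forall fun x => ?_
      obtain ⟨m, δ, hm⟩ := exists_mem_openHemisphere b x
      refine Set.mem_iUnion₂.2 ⟨m, (⟨m.2⟩, δ), ?_⟩
      have := openHemisphere_subset_closedHemisphere b m δ hm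
      rw [← cellMap_image_closedBall] at this
      exact this)

theorem skeleton_hemisphereCWComplex (n : Fin p) :
    letI := hemisphereCWComplex b
    (Topology.CWComplex.skeleton (Set.univ : Set (UnitSphere p)) ((n : ℕ) : ℕ∞) :
      Set (UnitSphere p)) = subsphere (basisPoint b) n := by
  let := hemisphereCWComplex b
  have hcell : ∀ (m : ℕ) (c : PLift (m < p) × ℤˣ),
      Topology.RelCWComplex.closedCell (C := (Set.univ : Set (UnitSphere p))) m c =
        closedHemisphere b ⟨m, c.1.down⟩ c.2 := fun m c =>
    cellMap_image_closedBall b ⟨m, c.1.down⟩ c.2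
  rw [Topology.RelCWComplex.skeleton, Topology.RelCWComplex.coe_skeletonLT, Set.empty_union]
  ext x
  simp only [Set.mem_iUnion]
  constructor
  · rintro ⟨m, hm, c, hx⟩
    have hx' : x ∈ closedHemisphere b ⟨m, c.1.down⟩ c.2 := hcell m c ▸ hx
    -- The `n`-skeleton is indexed by cells of dimension strictly below `n + 1`.
    have hmn : m < n + 1 := by exact_mod_cast hm
    intro i hi
    exact hx'.1 i (lt_of_le_of_lt (Fin.le_def.2 (by simpa using Nat.lt_succ_iff.1 hmn)) hi)
  · intro hx
    obtain ⟨m, δ, hm⟩ := exists_mem_openHemisphere b x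
    have hmn : m ≤ n := by
      by_contra hlt
      exact sphereCoord_ne_zero_of_mem b hm (hx m (not_le.1 hlt))
    refine ⟨m, by exact_mod_cast Nat.lt_succ_iff.2 (Fin.le_def.1 hmn), (⟨m.2⟩, δ), ?_⟩
    exact hcell m (⟨m.2⟩, δ) ▸ openHemisphere_subset_closedHemisphere b m δ hm

end Cells

/-! ### Reduced homology and cohomology of subspaces -/

section Subquotient

variable {F : Type*} [Field F] {M : Type*} [AddCommGroup M] [Module F M] {Z B : Submodule F M}

theorem subsingleton_subquotient (h : Z ≤ B) : Subsingleton (Subquotient Z B) :=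
  Submodule.Quotient.subsingleton_iff.2 (Submodule.submoduleOf_eq_top.2 h)

/-- The quotient `Z / B` is a line if `Z` is spanned modulo `B` by one vector outside `B`. -/
theorem nonempty_subquotient_equiv {α : M} (hα : α ∈ Z) (hB : α ∉ B)
    (h : ∀ z ∈ Z, ∃ a : F, z - a • α ∈ B) : Nonempty (Subquotient Z B ≃ₗ[F] F) := by
  let q : Subquotient Z B := Submodule.Quotient.mk ⟨α, hα⟩
  have hq : q ≠ 0 := fun h0 => hB ((Submodule.Quotient.mk_eq_zero (B.submoduleOf Z)).1 h0)
  refine ⟨(LinearEquiv.ofBijective (LinearMap.toSpanSingleton F _ q)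
    ⟨LinearMap.ker_eq_bot.1 (LinearMap.ker_toSpanSingleton F hq), fun y => ?_⟩).symm⟩
  obtain ⟨⟨z, hz⟩, rfl⟩ := Submodule.Quotient.mk_surjective _ y
  obtain ⟨a, ha⟩ := h z hz
  refine ⟨a, ((Submodule.Quotient.eq _).2 ?_).symm⟩
  exact ha

/-- A functional `φ` that kills `B` but not `α` generates: any other functional killing `B` agrees
on `Z` with `φ` scaled by the quotient of their values at `α`. -/
theorem nonempty_dualAnnihilator_subquotient_equiv {α : M} (hα : α ∈ Z) (hB : α ∉ B)
    (h : ∀ z ∈ Z, ∃ a : F, z - a • α ∈ B) :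
    Nonempty (Subquotient B.dualAnnihilator Z.dualAnnihilator ≃ₗ[F] F) := by
  obtain ⟨φ, hφ, hφB⟩ := Submodule.exists_le_ker_of_notMem hB
  have hB0 : ∀ b ∈ B, φ b = 0 := fun b hb => hφB hb
  refine nonempty_subquotient_equiv (α := φ) ((Submodule.mem_dualAnnihilator φ).2 hB0)
    (fun hZ => hφ ((Submodule.mem_dualAnnihilator φ).1 hZ α hα)) fun ψ hψ => ?_
  refine ⟨ψ α / φ α, (Submodule.mem_dualAnnihilator _).2 fun z hz => ?_⟩
  obtain ⟨a, ha⟩ := h z hz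
  have h1 := hB0 _ ha
  have h2 := (Submodule.mem_dualAnnihilator ψ).1 hψ _ ha
  rw [map_sub, map_smul, sub_eq_zero, smul_eq_mul] at h1 h2
  rw [LinearMap.sub_apply, LinearMap.smul_apply, smul_eq_mul, h1, h2]
  field_simp
  ring

end Subquotient

section Reduced

variable {F : Type*} [Field F] {X : Type*} [TopologicalSpace X] {A : Set X} {n k : ℕ}

theorem cocycles_eq_dualAnnihilator :
    cocycles F X k = (LinearMap.range (boundary F X k)).dualAnnihilator :=
  LinearMap.ker_dualMap_eq_dualAnnihilator_range _

/-- Over a field, cocycles and coboundaries are the annihilators of boundaries and cycles;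
cohomology thereby becomes a question about the same two subspaces as homology. -/
theorem reducedCoboundaries_eq_dualAnnihilator :
    reducedCoboundaries F X k = (reducedCycles F X k).dualAnnihilator := by
  cases k <;> exact LinearMap.range_dualMap_eq_dualAnnihilator_ker _

theorem push_inclusionMap_mem_reducedCyclesIn (c : SingularChain F A k) :
    push F (inclusionMap A) k c ∈ reducedCyclesIn F A k ↔ c ∈ reducedCycles F A k :=
  ⟨fun h => mem_reducedCycles_of_push_inclusionMap h.2, fun h =>
    ⟨push_mem_chainsIn (A := Set.univ) _ (fun x _ => x.2) (mem_chainsIn_univ c),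
      push_mem_reducedCycles _ h⟩⟩

theorem push_inclusionMap_mem_boundariesIn (c : SingularChain F A k) :
    push F (inclusionMap A) k c ∈ boundariesIn F A k ↔
      c ∈ LinearMap.range (boundary F A k) := by
  constructor
  · rintro ⟨e, he, hec⟩
    obtain ⟨e, -, rfl⟩ := chainsIn_le_map_push (le_refl A) he
    rw [← push_boundary] at hec
    exact ⟨e, push_inclusionMap_injective A k hec⟩
  · rintro ⟨e, rfl⟩
    exact ⟨push F (inclusionMap A) (k + 1) e,
      push_mem_chainsIn (A := Set.univ) _ (fun x _ => x.2) (mem_chainsIn_univ e),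
      (push_boundary _ (inclusionMap A) k e).symm⟩

namespace HasSphereHomology

variable {α : SingularChain F X n}

theorem reducedCycles_le (h : HasSphereHomology A n α) (hk : k ≠ n) :
    reducedCycles F A k ≤ LinearMap.range (boundary F A k) := fun c hc =>
  (push_inclusionMap_mem_boundariesIn c).1
    (h.le_of_ne k hk ((push_inclusionMap_mem_reducedCyclesIn c).2 hc))

theorem subsingleton_reducedHomology (h : HasSphereHomology A n α) (hk : k ≠ n) :
    Subsingleton (ReducedHomology F A k) :=
  subsingleton_subquotient (h.reducedCycles_le hk)

theorem subsingleton_reducedCohomology (h : HasSphereHomology A n α) (hk : k ≠ n) :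
    Subsingleton (ReducedCohomology F A k) :=
  subsingleton_subquotient (by
    rw [cocycles_eq_dualAnnihilator, reducedCoboundaries_eq_dualAnnihilator]
    exact Submodule.dualAnnihilator_anti (h.reducedCycles_le hk))

theorem exists_generator (h : HasSphereHomology A n α) :
    ∃ β ∈ reducedCycles F A n, β ∉ LinearMap.range (boundary F A n) ∧
      ∀ z ∈ reducedCycles F A n, ∃ a : F, z - a • β ∈ LinearMap.range (boundary F A n) := by
  obtain ⟨β, -, rfl⟩ := chainsIn_le_map_push (le_refl A) h.mem.1
  refine ⟨β, (push_inclusionMap_mem_reducedCyclesIn β).1 h.mem,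
    fun hβ => h.notMem ((push_inclusionMap_mem_boundariesIn β).2 hβ), fun z hz => ?_⟩
  obtain ⟨a, ha⟩ := h.exists_sub_mem _ ((push_inclusionMap_mem_reducedCyclesIn z).2 hz)
  exact ⟨a, (push_inclusionMap_mem_boundariesIn _).1 (by rwa [map_sub, map_smul])⟩

theorem nonempty_reducedHomology_equiv (h : HasSphereHomology A n α) :
    Nonempty (ReducedHomology F A n ≃ₗ[F] F) := by
  obtain ⟨β, h1, h2, h3⟩ := h.exists_generator
  exact nonempty_subquotient_equiv h1 h2 h3

theorem nonempty_reducedCohomology_equiv (h : HasSphereHomology A n α) :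
    Nonempty (ReducedCohomology F A n ≃ₗ[F] F) := by
  obtain ⟨β, h1, h2, h3⟩ := h.exists_generator
  have := nonempty_dualAnnihilator_subquotient_equiv h1 h2 h3
  rwa [← cocycles_eq_dualAnnihilator, ← reducedCoboundaries_eq_dualAnnihilator] at this

theorem nonempty_reducedCohomology_equiv_reducedHomology (h : HasSphereHomology A n α) (k : ℕ) :
    Nonempty (ReducedCohomology F A k ≃ₗ[F] ReducedHomology F A k) := by
  by_cases hk : k = n
  · subst hk
    exact h.nonempty_reducedCohomology_equiv.map2 (fun e e' => e.trans e'.symm)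
      h.nonempty_reducedHomology_equiv
  · have := h.subsingleton_reducedHomology hk
    have := h.subsingleton_reducedCohomology hk
    exact ⟨LinearEquiv.ofSubsingleton _ _⟩

/-- Complementary spheres are dual to each other. -/
theorem nonempty_reducedHomology_equiv_reducedCohomology {Y : Type*} [TopologicalSpace Y]
    {B : Set Y} {m : ℕ} {β : SingularChain F Y m} (hB : HasSphereHomology B m β)
    (h : HasSphereHomology A n α) {i j : ℕ} (hij : i = m ↔ j = n) :
    Nonempty (ReducedHomology F B i ≃ₗ[F] ReducedCohomology F A j) := by
  by_cases hi : i = m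
  · obtain rfl := hij.1 hi
    subst hi
    exact hB.nonempty_reducedHomology_equiv.map2 (fun e e' => e.trans e'.symm)
      h.nonempty_reducedCohomology_equiv
  · have := hB.subsingleton_reducedHomology hi
    have := h.subsingleton_reducedCohomology (mt hij.2 hi)
    exact ⟨LinearEquiv.ofSubsingleton _ _⟩

end HasSphereHomology

end Reduced

/-! ### Complementary sublevel and superlevel sets -/

section Alexander

variable {F : Type*} [Field F] {p : ℕ}
  (b : OrthonormalBasis (Fin p) ℝ (EuclideanSpace ℝ (Fin p))) {k : Fin p → ℝ} {d : ℝ}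

/-- The sublevel set and the strict superlevel set of a value below the maximum have the homology of
complementary spheres. -/
theorem exists_hasSphereHomology_le_and_lt (hp : 0 < p) (hk : StrictMono k) (hd : 0 < d) {r : ℝ}
    (hr : r ∈ Set.range (coordDensity b k d)) (hr' : ∃ y, r < coordDensity b k d y) :
    ∃ n m : ℕ, n + m + 2 = p ∧
      (∃ α : SingularChain F (UnitSphere p) n,
        HasSphereHomology {x | coordDensity b k d x ≤ r} n α) ∧
      ∃ β : SingularChain F (UnitSphere p) m,
        HasSphereHomology {x | r < coordDensity b k d x} m β := by
  obtain ⟨x, hx⟩ := hr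
  obtain ⟨y, hy⟩ := hr'
  have hr0 : 0 < r := hx ▸ coordDensity_pos b hd x
  obtain ⟨n, hn⟩ := exists_mem_levelsAt (criticalValue k d) (i := ⟨0, hp⟩) (r := r)
    (EReal.coe_le_coe_iff.2 (hx ▸ criticalValue_le_coordDensity b hk.monotone hd ⟨0, hp⟩ rfl x))
  have hle : ∀ i ≤ n, d * Real.exp (k i) ≤ r := fun i hi =>
    EReal.coe_le_coe_iff.1 (((criticalValue_strictMono hk hd).monotone hi).trans hn.1)
  have hlt : ∀ i, n < i → r < d * Real.exp (k i) := fun i hi =>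
    EReal.coe_lt_coe_iff.1 (hn.2 i hi)
  -- A value strictly above `r` is attained, so `n` is not the last index and the superlevel sphere
  -- has dimension at least zero.
  have hnp : (n : ℕ) + 1 < p := by
    by_contra h
    exact absurd ((coordDensity_le_criticalValue b hk.monotone hd n (by omega) y).trans
      (hle n le_rfl)) (not_le.2 hy)
  -- The `p - 1 - n` eigenvectors beyond index `n` span the sphere on the other side, of dimension
  -- `p - 2 - n`.
  let m : Fin p := ⟨p - 2 - n, by omega⟩
  have hinv : ∀ i : Fin p, d⁻¹ * Real.exp (-k i.rev) = (d * Real.exp (k i.rev))⁻¹ := fun i => by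
    rw [Real.exp_neg, mul_inv]
  have hpos : ∀ i, 0 < d * Real.exp (k i) := fun i => mul_pos hd (Real.exp_pos _)
  have hset : {x | r < coordDensity b k d x} = {x | coordDensity (b.reindex Fin.revPerm)
      (fun i => -k i.rev) d⁻¹ x < r⁻¹} := by
    ext x
    simp only [Set.mem_ofPred_eq, coordDensity_rev]
    rw [inv_lt_inv₀ (coordDensity_pos b hd x) hr0]
  have hset' : {x | coordDensity b k d x ≤ r} = sublevel (coordDensity b k d) r := by
    ext x
    exact EReal.coe_le_coe_iff.symm
  obtain ⟨α, hα⟩ := exists_hasSphereHomology_subsphere (F := F) b n n.2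
  obtain ⟨β, hβ⟩ := exists_hasSphereHomology_subsphere (F := F) (b.reindex Fin.revPerm) m m.2
  refine ⟨n, m, by simp only [m]; omega, ⟨α, ?_⟩, β, ?_⟩
  · rw [hset']
    exact hα.of_retract (isStrongDeformationRetract_sublevel b hk hd hn)
  · rw [hset]
    refine hβ.of_retract (isStrongDeformationRetract_strict_sublevel _ (inv_pos.2 hd)
      (fun i hi => ?_) fun i hi => ?_)
    · rw [hinv, inv_lt_inv₀ (hpos _) hr0]
      refine hlt _ (Fin.lt_def.2 ?_)
      have := Fin.le_def.1 hi
      simp only [m] at this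
      rw [Fin.val_rev]
      omega
    · rw [hinv, inv_le_inv₀ hr0 (hpos _)]
      refine hle _ (Fin.le_def.2 ?_)
      have := Fin.lt_def.1 hi
      simp only [m] at this
      rw [Fin.val_rev]
      omega

end Alexander

end PersistentDensity

end

/-! ### Assembly of the four statements -/

open PersistentDensity in
theorem mainTheorem6 {F : Type*} [Field F] {p : ℕ} (hp : 2 ≤ p)
    (K : Matrix (Fin p) (Fin p) ℝ) (hK : K.IsSymm)
    (k : Fin p → ℝ) (hk : StrictMono k) (hkpos : ∀ i, 0 < k i)
    (v : Fin p → UnitSphere p)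
    (hv : ∀ i, K *ᵥ (v i : EuclideanSpace ℝ (Fin p)).ofLp =
      k i • (v i : EuclideanSpace ℝ (Fin p)).ofLp) :
    -- Morse filtration
    ((morseFiltration F (binghamDensity K)).HasBettiBarcode 0
        ![Set.Icc ((binghamConst K * Real.exp (k ⟨0, by omega⟩) : ℝ) : EReal) ⊤,
          Set.Ico ((binghamConst K * Real.exp (k ⟨0, by omega⟩) : ℝ) : EReal)
            ((binghamConst K * Real.exp (k ⟨1, by omega⟩) : ℝ) : EReal)] ∧
      (∀ (i : ℕ) (_ : 1 ≤ i) (_ : i + 2 ≤ p),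
        (morseFiltration F (binghamDensity K)).HasBettiBarcode i
          ![Set.Ico ((binghamConst K * Real.exp (k ⟨i, by omega⟩) : ℝ) : EReal)
            ((binghamConst K * Real.exp (k ⟨i + 1, by omega⟩) : ℝ) : EReal)]) ∧
      (morseFiltration F (binghamDensity K)).HasBettiBarcode (p - 1)
        ![Set.Icc ((binghamConst K * Real.exp (k ⟨p - 1, by omega⟩) : ℝ) : EReal) ⊤] ∧
      ∀ i, p ≤ i → (morseFiltration F (binghamDensity K)).HasBettiBarcode i ![]) ∧
    -- the cellular structure by hemispheres, and its relation to the Morse filtration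
    (∃ cw : Topology.CWComplex (Set.univ : Set (UnitSphere p)),
      (∀ n : Fin p, ∃ e : cw.cell n ≃ ℤˣ, ∀ c,
        Topology.CWComplex.openCell (C := (Set.univ : Set (UnitSphere p))) (n : ℕ) c =
          openHemisphere v n (e c)) ∧
      (∀ n, p ≤ n → IsEmpty (cw.cell n)) ∧
      (∀ n : Fin p, (Topology.CWComplex.skeleton (Set.univ : Set (UnitSphere p))
        ((n : ℕ) : ℕ∞) : Set (UnitSphere p)) = subsphere v n) ∧
      (∀ r : EReal, r < ((binghamConst K * Real.exp (k ⟨0, by omega⟩) : ℝ) : EReal) →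
        sublevel (binghamDensity K) r = ∅) ∧
      ∀ (n : Fin p) (r : EReal), ((binghamConst K * Real.exp (k n) : ℝ) : EReal) ≤ r →
        (∀ m, n < m → r < ((binghamConst K * Real.exp (k m) : ℝ) : EReal)) →
        IsStrongDeformationRetract
          (Topology.CWComplex.skeleton (Set.univ : Set (UnitSphere p))
            ((n : ℕ) : ℕ∞) : Set (UnitSphere p))
          (sublevel (binghamDensity K) r)) ∧
    -- superlevel sets and the Čech filtration
    ((superlevelFiltration F (binghamDensity K)).HasBettiBarcode 0
        ![Set.Icc (((binghamConst K)⁻¹ * Real.exp (-k ⟨p - 1, by omega⟩) : ℝ) : EReal) ⊤,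
          Set.Ico (((binghamConst K)⁻¹ * Real.exp (-k ⟨p - 1, by omega⟩) : ℝ) : EReal)
            (((binghamConst K)⁻¹ * Real.exp (-k ⟨p - 2, by omega⟩) : ℝ) : EReal)] ∧
      ∀ 𝓕 ∈ ({superlevelFiltration F (binghamDensity K),
          cechFiltration F (binghamDensity K)} : Set (ChainFiltration F (UnitSphere p))),
        (∀ (i : ℕ) (_ : 1 ≤ i) (_ : i + 2 ≤ p), 𝓕.HasBettiBarcode i
          ![Set.Ico (((binghamConst K)⁻¹ * Real.exp (-k ⟨p - i - 1, by omega⟩) : ℝ) : EReal)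
            (((binghamConst K)⁻¹ * Real.exp (-k ⟨p - i - 2, by omega⟩) : ℝ) : EReal)]) ∧
        𝓕.HasBettiBarcode (p - 1)
          ![Set.Icc (((binghamConst K)⁻¹ * Real.exp (-k ⟨0, by omega⟩) : ℝ) : EReal) ⊤] ∧
        ∀ i, p ≤ i → 𝓕.HasBettiBarcode i ![]) ∧
    -- Alexander duality between superlevel and sublevel sets
    (∀ r : ℝ, r ∈ Set.range (binghamDensity K) → (∃ y, r < binghamDensity K y) →
      (∀ i j : ℕ, i + j + 2 = p →
        Nonempty (ReducedHomology F {x : UnitSphere p // r < binghamDensity K x} i ≃ₗ[F]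
          ReducedCohomology F {x : UnitSphere p // binghamDensity K x ≤ r} j) ∧
        Nonempty (ReducedCohomology F {x : UnitSphere p // binghamDensity K x ≤ r} j ≃ₗ[F]
          ReducedHomology F {x : UnitSphere p // binghamDensity K x ≤ r} j)) ∧
      ∀ i, p ≤ i + 1 →
        Subsingleton (ReducedHomology F {x : UnitSphere p // r < binghamDensity K x} i) ∧
        Subsingleton (ReducedHomology F {x : UnitSphere p // binghamDensity K x ≤ r} i)) := by
  have h0 : 0 < p := by omega
  have hd : 0 < binghamConst K := binghamConst_pos h0 K
  obtain ⟨b, rfl⟩ := exists_basis_of_eigenvectors hK hk.injective v hv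
  rw [binghamDensity_eq b hv]
  have hpart : ∀ r j, (morseFiltration F (coordDensity b k (binghamConst K))).part r j =
      chainsIn F (sublevel (coordDensity b k (binghamConst K)) r) j := fun _ _ => rfl
  have hmono := criticalValue_strictMono hk hd
  have hk' : StrictMono fun i : Fin p => -k i.rev := fun i j hij =>
    neg_lt_neg (hk (Fin.rev_lt_rev.2 hij))
  have hd' := inv_pos.2 hd
  have hmono' := criticalValue_strictMono hk' hd'
  -- Translation of indices: the `i`-th threshold of the reciprocal density comes from the
  -- eigenvalue at position `p - 1 - i`.
  have hval : ∀ (i j : ℕ) (hi : i < p) (hj : j < p), i + j + 1 = p →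
      (((binghamConst K)⁻¹ * Real.exp (-k ⟨j, hj⟩) : ℝ) : EReal) =
        criticalValue (fun i : Fin p => -k i.rev) (binghamConst K)⁻¹ ⟨i, hi⟩ := by
    intro i j hi hj h
    have : (⟨j, hj⟩ : Fin p) = Fin.rev ⟨i, hi⟩ := Fin.ext (by simp only [Fin.val_rev]; omega)
    rw [this, criticalValue]
  have hsuper : ∀ r j, (superlevelFiltration F (coordDensity b k (binghamConst K))).part r j =
      chainsIn F (sublevel (coordDensity (b.reindex Fin.revPerm) (fun i => -k i.rev)
        (binghamConst K)⁻¹) r) j := fun r j => by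
    rw [← superlevel_coordDensity b hd]
    rfl
  refine ⟨⟨?_, fun i hi hip => ?_, ?_, fun i hi => ?_⟩, ?_, ⟨?_, fun 𝓕 h𝓕 => ?_⟩,
    fun r hr hr' => ?_⟩
  · have h := hasBettiBarcode_zero_sublevel b h0 hk hd hpart ⟨0, h0⟩ rfl
    rwa [levelsAt_eq_Ico hmono (n' := ⟨1, hp⟩) rfl] at h
  -- The degree is written as a successor because the comparison of homologies is available only in
  -- positive degrees.
  · obtain ⟨i, rfl⟩ := Nat.exists_eq_add_of_le' hi
    have h := hasBettiBarcode_sublevel b h0 hk hd ⟨i + 1, by omega⟩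
      (ChainFiltration.computesHomology_of_part hpart i)
    rwa [levelsAt_eq_Ico hmono (n' := ⟨i + 1 + 1, by omega⟩) rfl] at h
  · obtain ⟨q, rfl⟩ := Nat.exists_eq_add_of_le' hp
    have h := hasBettiBarcode_sublevel b h0 hk hd ⟨q + 1, by omega⟩
      (ChainFiltration.computesHomology_of_part hpart q)
    rwa [levelsAt_eq_Icc rfl] at h
  · obtain ⟨i, rfl⟩ := Nat.exists_eq_add_of_le' (h0.trans_le hi)
    exact hasBettiBarcode_sublevel_of_le b h0 hk hd hi
      (ChainFiltration.computesHomology_of_part hpart i)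
  · refine ⟨hemisphereCWComplex b, fun n => ?_, fun n hn => ?_, fun n => ?_, fun r hr => ?_,
      fun n r hr hr' => ?_⟩
    · exact ⟨⟨Prod.snd, fun ε => (⟨n.2⟩, ε), fun _ => rfl, fun _ => rfl⟩,
        fun c => cellMap_image_ball b n c.2⟩
    · exact ⟨fun c => absurd c.1.down (not_lt.2 hn)⟩
    · exact skeleton_hemisphereCWComplex b n
    · exact sublevel_eq_empty b hk.monotone hd (i := ⟨0, h0⟩) rfl hr
    · rw [skeleton_hemisphereCWComplex b n]
      exact isStrongDeformationRetract_sublevel b hk hd ⟨hr, hr'⟩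
  · have h := hasBettiBarcode_zero_sublevel (b.reindex Fin.revPerm) h0 hk' hd' hsuper ⟨0, h0⟩ rfl
    rw [levelsAt_eq_Ico hmono' (n' := ⟨1, hp⟩) rfl] at h
    rwa [hval 0 (p - 1) h0 _ (by omega), hval 1 (p - 2) hp _ (by omega)]
  · have hcomp : ∀ j, 𝓕.ComputesHomology (sublevel (coordDensity (b.reindex Fin.revPerm)
        (fun i => -k i.rev) (binghamConst K)⁻¹)) (j + 1) := by
      intro j
      -- Both filtrations compute the positive-degree homology of the same family of sets, so the
      -- barcodes need only one argument.
      rcases h𝓕 with rfl | rfl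
      · exact ChainFiltration.computesHomology_of_part hsuper j
      · have h := cechFiltration_computesHomology (F := F)
          (coordDensity b k (binghamConst K)) j
        simp only [superlevel_coordDensity b hd] at h
        exact h
    refine ⟨fun i hi hip => ?_, ?_, fun i hi => ?_⟩
    · obtain ⟨i, rfl⟩ := Nat.exists_eq_add_of_le' hi
      have h := hasBettiBarcode_sublevel (b.reindex Fin.revPerm) h0 hk' hd' ⟨i + 1, by omega⟩
        (hcomp i)
      rw [levelsAt_eq_Ico hmono' (n' := ⟨i + 1 + 1, by omega⟩) rfl] at h
      rwa [hval (i + 1) _ (by omega) _ (by omega), hval (i + 1 + 1) _ (by omega) _ (by omega)]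
    · obtain ⟨q, rfl⟩ := Nat.exists_eq_add_of_le' hp
      have h := hasBettiBarcode_sublevel (b.reindex Fin.revPerm) h0 hk' hd' ⟨q + 1, by omega⟩
        (hcomp q)
      rw [levelsAt_eq_Icc rfl] at h
      rwa [hval (q + 1) _ (by omega) _ (by omega)]
    · obtain ⟨i, rfl⟩ := Nat.exists_eq_add_of_le' (h0.trans_le hi)
      exact hasBettiBarcode_sublevel_of_le _ h0 hk' hd' hi (hcomp i)
  · obtain ⟨n, m, hnm, ⟨α, hα⟩, β, hβ⟩ :=
      exists_hasSphereHomology_le_and_lt (F := F) b h0 hk hd hr hr'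
    refine ⟨fun i j hij => ⟨?_, ?_⟩, fun i hi => ⟨?_, ?_⟩⟩
    · exact hβ.nonempty_reducedHomology_equiv_reducedCohomology hα (by omega)
    · exact hα.nonempty_reducedCohomology_equiv_reducedHomology j
    · exact hβ.subsingleton_reducedHomology (by omega)
    · exact hα.subsingleton_reducedHomology (by omega)
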